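/- **Setting.** Let $d,p\ge 1$ be integers. For an open set $U\subset\mathbb R^d$ and $k>0$, let $\|u\|^2_{H^1_k(U)} := k^{-2}\|\nabla u\|^2_{L^2(U)}+\|u\|^2_{L^2(U)}$ (complex-valued functions). Let $\Omega\subset\mathbb R^d$ be a bounded open set with a finite conforming mesh $\mathcal T^h$: $\overline\Omega$ is the union of closed, possibly curved, elements $K=F_K(\widehat K)$, where $\widehat K$ is the reference simplex and $F_K:\widehat K\to K$ is a homeomorphism mapping interior onto interior; two different elements meet in a common (possibly empty) proper face, on which the two parametrizations agree up to an affine relabelling of the vertices. Let $h_K$ be the diameter of $K$. Assume that *either* * (simplicial) every $F_K$ is affine and the mesh is shape-regular with constant $\kappa$, i.e. every $K$ contains a ball of diameter $\rho>0$ with $h_K\le\kappa\rho$; *or* * (curved) $F_K\in C^{p,1}(\widehat K)$, $F_K^{-1}\in C^{p,1}(K)$ and, for all $K$ and $1\le|\alpha|\le p+1$, $\|\partial^\alpha F_K\|_{L^\infty(\widehat K)}\le C_{\rm curved}L(h_K/L)^{|\alpha|}$ and $\|\partial^\alpha (F_K^{-1})\|_{L^\infty(K)}\le C_{\rm curved}h_K^{-|\alpha|}$,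 where $L>0$ is a length scale with $\operatorname{diam}\Omega\le L$. Let $\mathcal V$ be a subspace of $H^1(\Omega)$, and let $\mathcal V_h$ be the space of those $v\in\mathcal V$, continuous on $\overline\Omega$, with $v\circ F_K\in\mathcal P_p(\widehat K)$ for every $K$. Let $\mathcal I_h$ be the nodal (Lagrange) interpolation operator of degree $p$: $(\mathcal I_hw)\circ F_K$ is the polynomial of degree at most $p$ that equals $w\circ F_K$ at the points of $\widehat K$ whose barycentric coordinates are multiples of $1/p$. For $\ell=1,\dots,N$ let $\Omega_\ell\subset\Omega$ be an open set that is the interior of its closure (for example a Lipschitz domain), put $h_\ell:=\max_{K\subset\overline{\Omega_\ell}}h_K$, and let $\mathcal V_{\ell,h}$ be a subspace of the functions in $H^1(\Omega_\ell)$ that are continuous on $\overline{\Omega_\ell}$ and piecewise polynomial there (on each $K\cap\overline{\Omega_\ell}$, the composition with $F_K$ coincides with an element of $\mathcal P_p$). Write $\mathcal R_\ell$ for restriction to $\Omega_\ell$. Let $\chi_\ell,\chi_\ell^>$ be real-valued functions on $\overline\Omega$ such that every element on which one of them does not vanish identically is contained in $\overline{\Omega_\ell}$ (as is the case if $\Omega_\ell$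 is a union of elements and both functions vanish on $\Omega\setminus\Omega_\ell$), such that $\chi_\ell,\chi_\ell^>\in C^{p,1}(K)$ for every element $K$, and such that $$\max\{\|\partial^\alpha\chi_\ell\|_{L^\infty(K)},\|\partial^\alpha\chi^>_\ell\|_{L^\infty(K)}\}\le C'_{\rm PoU}\,\delta_\ell^{-|\alpha|}\qquad\text{for all }K\in\mathcal T^h,\ 0\le|\alpha|\le p+1,$$ with some $\delta_\ell>0$, $\delta_\ell\ge h_\ell$. **Claim (super-approximation).** Given $k_0>0$, there is a constant $C_{\rm super}>0$, depending only on $d$, $p$, $k_0$, $C'_{\rm PoU}$, $\kappa$, $C_{\rm curved}$ and $L$, such that for all $\ell$, all $k\ge k_0$ and all $v\in\mathcal R_\ell\mathcal V_h+\mathcal V_{\ell,h}$, the functions $(I-\mathcal I_h)(\chi_\ell v)$ and $(I-\mathcal I_h)(\chi_\ell^> v)$ belong to $H^1(\Omega_\ell)$ and $$\max\Big\{\|(I-\mathcal I_h)(\chi_\ell v)\|_{H^1_k(\Omega_\ell)},\ \|(I-\mathcal I_h)(\chi^>_\ell v)\|_{H^1_k(\Omega_\ell)}\Big\}\le \mu_\ell\,\|v\|_{H^1_k(\Omega_\ell)},\qquad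 \mu_\ell:=C_{\rm super}\Big(\frac{h_\ell}{\delta_\ell}+\Big(\frac{h_\ell}{\delta_\ell}\Big)^p\frac1{k\delta_\ell}\Big).$$ -/

import Mathlib

open MeasureTheory Set
open scoped ContDiff

noncomputable section

namespace FEM

/-- `ℝ^d` with its Euclidean norm. -/
abbrev E (d : ℕ) := EuclideanSpace ℝ (Fin d)

/-- The `j`-th coordinate vector of `ℝ^d`. -/
def e {d : ℕ} (j : Fin d) : E d := EuclideanSpace.single j (1 : ℝ)

/-! ### The Sobolev space `H¹(U)` and its `k`-weighted norm -/

/-- `g = (g_1, …, g_d)` is a square-integrable weak gradient of `u` on `U`: for all real test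
functions `φ ∈ C_c^∞(U)` and all `j`, `∫_U u ∂_j φ = - ∫_U g_j φ`. -/
def IsWeakGrad {d : ℕ} (U : Set (E d)) (u : E d → ℂ) (g : Fin d → E d → ℂ) : Prop :=
  (∀ j, MemLp (g j) 2 (volume.restrict U)) ∧
  ∀ φ : E d → ℝ, ContDiff ℝ ∞ φ → HasCompactSupport φ → tsupport φ ⊆ U → ∀ j,
    ∫ x in U, u x * ((fderiv ℝ φ x (e j) : ℝ) : ℂ) = - ∫ x in U, g j x * ((φ x : ℝ) : ℂ)

/-- A square-integrable function with a square-integrable weak gradient. -/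
def MemH1 {d : ℕ} (U : Set (E d)) (u : E d → ℂ) : Prop :=
  MemLp u 2 (volume.restrict U) ∧ ∃ g, IsWeakGrad U u g

theorem integrable_mul_test {d : ℕ} {U : Set (E d)} {u : E d → ℂ}
    (hu : MemLp u 2 (volume.restrict U)) {ψ : E d → ℝ} (hψ : Continuous ψ)
    (hc : HasCompactSupport ψ) :
    Integrable (fun x => u x * ((ψ x : ℝ) : ℂ)) (volume.restrict U) := by
  have hψ2 : MemLp (fun x => ((ψ x : ℝ) : ℂ)) 2 (volume.restrict U) := by
    refine Continuous.memLp_of_hasCompactSupport (by fun_prop) ?_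
    exact hc.comp_left (g := fun r : ℝ => (r : ℂ)) (by simp)
  exact hu.integrable_mul hψ2

theorem continuous_partial {d : ℕ} {φ : E d → ℝ} (hφ : ContDiff ℝ ∞ φ) (j : Fin d) :
    Continuous (fun x => fderiv ℝ φ x (e j)) :=
  (hφ.continuous_fderiv (by simp)).clm_apply continuous_const

theorem hasCompactSupport_partial {d : ℕ} {φ : E d → ℝ} (hc : HasCompactSupport φ) (j : Fin d) :
    HasCompactSupport (fun x => fderiv ℝ φ x (e j)) :=
  (hc.fderiv ℝ).comp_left (g := fun L : E d →L[ℝ] ℝ => L (e j)) (by simp)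

/-- The complex vector space `H¹(U)`, as a space of functions on `ℝ^d` of which only the values
on `U` (up to null sets) matter. -/
def H1 {d : ℕ} (U : Set (E d)) : Submodule ℂ (E d → ℂ) where
  carrier := {u | MemH1 U u}
  zero_mem' := by
    refine ⟨MemLp.zero', fun _ _ => 0, fun _ => MemLp.zero', ?_⟩
    intro φ _ _ _ j
    simp
  add_mem' := by
    rintro u v ⟨hu, gu, hgu, hu'⟩ ⟨hv, gv, hgv, hv'⟩
    refine ⟨hu.add hv, fun j => gu j + gv j, fun j => (hgu j).add (hgv j), ?_⟩
    intro φ hφ hc hs j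
    simp only [Pi.add_apply, add_mul]
    rw [integral_add (integrable_mul_test hu (continuous_partial hφ j)
        (hasCompactSupport_partial hc j))
      (integrable_mul_test hv (continuous_partial hφ j) (hasCompactSupport_partial hc j)),
      integral_add (integrable_mul_test (hgu j) hφ.continuous hc)
      (integrable_mul_test (hgv j) hφ.continuous hc), hu' φ hφ hc hs j, hv' φ hφ hc hs j]
    ring
  smul_mem' := by
    rintro c u ⟨hu, gu, hgu, hu'⟩
    refine ⟨hu.const_smul c, fun j => c • gu j, fun j => (hgu j).const_smul c, ?_⟩
    intro φ hφ hc hs j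
    simp only [Pi.smul_apply, smul_eq_mul, mul_assoc]
    rw [integral_const_mul, integral_const_mul, hu' φ hφ hc hs j]
    ring

open Classical in
/-- The weak gradient of `u` on `U` (unique up to null sets); it is set to zero if there is
none. -/
def weakGrad {d : ℕ} (U : Set (E d)) (u : E d → ℂ) : Fin d → E d → ℂ :=
  if h : ∃ g, IsWeakGrad U u g then h.choose else 0

/-- `‖u‖_{H¹_k(U)} = (k⁻² ‖∇u‖²_{L²(U)} + ‖u‖²_{L²(U)})^{1/2}`. -/
def h1kNorm {d : ℕ} (k : ℝ) (U : Set (E d)) (u : E d → ℂ) : ℝ :=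
  Real.sqrt ((k ^ 2)⁻¹ * (∑ j, ∫ x in U, ‖weakGrad U u j x‖ ^ 2) + ∫ x in U, ‖u x‖ ^ 2)

/-! ### Regularity classes and bounds on derivatives -/

/-- `f ∈ C^{n,1}(K)` for a closed set `K` (the closure of its interior): `f` is continuous on
`K`, `n` times continuously differentiable inside `K`, and its derivatives of order `n` are
Lipschitz continuous. -/
def MemCLip {d : ℕ} {G : Type*} [NormedAddCommGroup G] [NormedSpace ℝ G]
    (n : ℕ) (K : Set (E d)) (f : E d → G) : Prop :=
  ContinuousOn f K ∧ ContDiffOn ℝ n f (interior K) ∧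
    ∃ M, LipschitzOnWith M (iteratedFDeriv ℝ n f) (interior K)

/-- `‖∂^α f‖_{L^∞(K)} ≤ B` for all multi-indices `α` with `|α| = m`; the partial derivative
`∂^α f` is `D^m f (e_{j_1}, …, e_{j_m})`, and boundary points of `K` are disregarded. -/
def PartialsBounded {d : ℕ} {G : Type*} [NormedAddCommGroup G] [NormedSpace ℝ G]
    (m : ℕ) (K : Set (E d)) (f : E d → G) (B : ℝ) : Prop :=
  ∀ j : Fin m → Fin d, ∀ᵐ x ∂(volume.restrict (interior K)),
    ‖iteratedFDeriv ℝ m f x (fun t => e (j t))‖ ≤ B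

/-! ### The reference simplex and nodal interpolation on it -/

/-- Barycentric coordinates with respect to the vertices `0, e_1, …, e_d`. -/
def bary {d : ℕ} (x : E d) : Fin (d + 1) → ℝ :=
  Fin.cons (1 - ∑ j, x j) (fun j => x j)

/-- The closed reference simplex, with vertices `0, e_1, …, e_d`. -/
def refSimplex (d : ℕ) : Set (E d) := {x | ∀ s, 0 ≤ bary x s}

/-- The closed face of the reference simplex spanned by the vertices in `S` (empty for
`S = ∅`). -/
def refFace {d : ℕ} (S : Finset (Fin (d + 1))) : Set (E d) :=
  {x | x ∈ refSimplex d ∧ ∀ s, s ∉ S → bary x s = 0}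

/-- The affine bijection of the reference simplex that sends vertex `s` to vertex `σ s`. -/
def permMap {d : ℕ} (σ : Equiv.Perm (Fin (d + 1))) (x : E d) : E d :=
  WithLp.toLp 2 (fun j => bary x (σ.symm j.succ))

/-- The node of the principal lattice of order `p` with barycentric coordinates `a / p`. -/
def refNode {d : ℕ} (p : ℕ) (a : Fin (d + 1) → ℕ) : E d :=
  WithLp.toLp 2 (fun j => (a j.succ : ℝ) / p)

/-- The Lagrange nodal basis function of degree `p` of the node `refNode p a`, `∑ a_s = p`: with
barycentric coordinates `λ_s` it is `∏_s ∏_{m < a_s} (p λ_s - m) / (m + 1)`, a polynomial of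
degree `p` that equals one at `refNode p a` and vanishes at all other nodes. -/
def lagrange {d : ℕ} (p : ℕ) (a : Fin (d + 1) → ℕ) (x : E d) : ℝ :=
  ∏ s, ∏ m ∈ Finset.range (a s), ((p : ℝ) * bary x s - m) / (m + 1)

/-- Degree-`p` nodal (Lagrange) interpolation on the reference simplex. -/
def refInterp {d : ℕ} (p : ℕ) (f : E d → ℂ) (x : E d) : ℂ :=
  ∑ a ∈ Finset.piAntidiag (Finset.univ : Finset (Fin (d + 1))) p,
    (lagrange p a x : ℂ) * f (refNode p a)

/-! ### Meshes -/

/-- A conforming mesh of `Ω` by finitely many, possibly curved, simplicial elements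
`K_i = F_i (K̂)`, where `F_i = map i` is a homeomorphism of the reference simplex onto `K_i` with
inverse `inv i`. Two different elements meet in a common proper face (possibly empty), on which
the two parametrizations agree up to a relabelling of the vertices, so that the nodes of the two
elements on that face coincide. -/
structure Mesh {d : ℕ} (Ω : Set (E d)) where
  n : ℕ
  map : Fin n → E d → E d
  inv : Fin n → E d → E d
  left_inv : ∀ i, ∀ x ∈ refSimplex d, inv i (map i x) = x
  continuousOn_map : ∀ i, ContinuousOn (map i) (refSimplex d)
  image_interior : ∀ i, map i '' interior (refSimplex d) = interior (map i '' refSimplex d)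
  cover : ⋃ i, map i '' refSimplex d = closure Ω
  conforming : ∀ i j, i ≠ j → ∃ S : Finset (Fin (d + 1)), ∃ σ : Equiv.Perm (Fin (d + 1)),
    S ≠ Finset.univ ∧
    (map i '' refSimplex d) ∩ (map j '' refSimplex d) = map i '' refFace S ∧
    ∀ x ∈ refFace S, map i x = map j (permMap σ x)

namespace Mesh

variable {d : ℕ} {Ω : Set (E d)}

/-- The closed element `K_i`. -/
def elem (T : Mesh Ω) (i : Fin T.n) : Set (E d) := T.map i '' refSimplex d

/-- The element diameter `h_K`. -/
def diam (T : Mesh Ω) (i : Fin T.n) : ℝ := Metric.diam (T.elem i)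

/-- `max {h_K : K ⊆ closure U}` (zero if there is no such element). -/
def localWidth (T : Mesh Ω) (U : Set (E d)) : ℝ :=
  ⨆ i : {i : Fin T.n // T.elem i ⊆ closure U}, T.diam i

/-- A simplicial mesh (affine element maps) that is shape-regular with constant `κ`: every
element contains a ball whose diameter `ρ` satisfies `h_K ≤ κ ρ`. -/
def ShapeRegularSimplicial (T : Mesh Ω) (κ : ℝ) : Prop :=
  ∀ i, (∃ A : E d →ᵃ[ℝ] E d, EqOn (T.map i) A (refSimplex d)) ∧
    ∃ c r, 0 < r ∧ Metric.closedBall c r ⊆ T.elem i ∧ T.diam i ≤ κ * (2 * r)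

/-- Curved elements of order `p`: the element maps and their inverses are of class `C^{p,1}`, and
for `1 ≤ |α| ≤ p + 1`, `‖∂^α F_K‖_{L^∞} ≤ C L (h_K / L)^{|α|}` and
`‖∂^α (F_K⁻¹)‖_{L^∞} ≤ C h_K^{-|α|}`. -/
def CurvedRegular (T : Mesh Ω) (p : ℕ) (C L : ℝ) : Prop :=
  ∀ i, MemCLip p (refSimplex d) (T.map i) ∧ MemCLip p (T.elem i) (T.inv i) ∧
    ∀ m, 1 ≤ m → m ≤ p + 1 →
      PartialsBounded m (refSimplex d) (T.map i) (C * L * (T.diam i / L) ^ m) ∧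
      PartialsBounded m (T.elem i) (T.inv i) (C * (T.diam i)⁻¹ ^ m)

/-- The functions `v` in `V` whose values on the closed set `D` are piecewise polynomial on the
mesh: `v ∘ F_K` coincides with a polynomial of total degree at most `p` wherever `F_K` takes
values in `D`, for every element `K`. Functions are single-valued on the faces shared by
elements, hence continuous on `D`. -/
def feSpace (T : Mesh Ω) (p : ℕ) (D : Set (E d)) (V : Submodule ℂ (E d → ℂ)) :
    Submodule ℂ (E d → ℂ) where
  carrier := {v | v ∈ V ∧ ∀ i, ∃ q : MvPolynomial (Fin d) ℂ, q.totalDegree ≤ p ∧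
    ∀ x ∈ refSimplex d, T.map i x ∈ D →
      v (T.map i x) = MvPolynomial.eval (fun j => ((x j : ℝ) : ℂ)) q}
  zero_mem' := ⟨V.zero_mem, fun _ => ⟨0, by simp, by simp⟩⟩
  add_mem' := by
    rintro u v ⟨hu, hu'⟩ ⟨hv, hv'⟩
    refine ⟨V.add_mem hu hv, fun i => ?_⟩
    obtain ⟨q, hq, hq'⟩ := hu' i
    obtain ⟨r, hr, hr'⟩ := hv' i
    refine ⟨q + r, (MvPolynomial.totalDegree_add q r).trans (max_le hq hr), fun x hx hD => ?_⟩
    simp [hq' x hx hD, hr' x hx hD]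
  smul_mem' := by
    rintro c u ⟨hu, hu'⟩
    refine ⟨V.smul_mem c hu, fun i => ?_⟩
    obtain ⟨q, hq, hq'⟩ := hu' i
    refine ⟨c • q, (MvPolynomial.totalDegree_smul_le c q).trans hq, fun x hx hD => ?_⟩
    simp [hq' x hx hD, MvPolynomial.smul_eval]

open Classical in
/-- The nodal interpolant `I_h w`: on the element `K` it is the function whose pull-back by `F_K`
is the degree-`p` nodal interpolant of `w ∘ F_K`. (At a point shared by several elements any of
them may be used, since the nodes on common faces coincide.) -/
def interp (T : Mesh Ω) (p : ℕ) (w : E d → ℂ) (x : E d) : ℂ :=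
  if h : ∃ i, x ∈ T.elem i then
    refInterp p (fun y => w (T.map h.choose y)) (T.inv h.choose x)
  else 0

/-- `(I - I_h)(χ v)`. -/
def interpError (T : Mesh Ω) (p : ℕ) (χ : E d → ℝ) (v : E d → ℂ) : E d → ℂ :=
  fun x => (χ x : ℂ) * v x - T.interp p (fun y => (χ y : ℂ) * v y) x

end Mesh

end FEM

end

noncomputable section

open Filter Topology

set_option maxSynthPendingDepth 3

namespace FEM

/-! The estimate is local. Write `p = n + 1`. On an element `K = F(K̂)` of diameter `h` put `f = χ ∘
F` and `q = v ∘ F`, a polynomial of degree at most `p`, and split `f q = q(0) f + f(0) (q - q(0)) +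
(f - f(0)) (q - q(0))`. Interpolation reproduces the middle term, which therefore drops out of the
error. The first term contributes `q(0)` times the interpolation error of `f`, and this sees only
derivatives of order `p + 1`. The last is a product of two increments, so it is small together with
its gradient, and mere stability of interpolation suffices for it. If the gradient of `f` is of size
`A ~ h/δ` and every further derivative costs a factor `c`, the error and its gradient are bounded by
a constant times `A ‖∇q‖_∞ + A c^p ‖q‖_∞` (`exists_ref_superapprox`). The interpolation error of `f`
comes from the Taylor polynomial at the point where the error is measured, compared with `f` at the
nodes (`exists_interp_error`).

All norms of polynomials of bounded degree are equivalent (`exists_inverse_estimate`), so the sup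
norms become L² norms. Changing variables gives, for the error `w` on `K` and up to constants, `‖w‖
≤ (h/δ) ‖v‖` and `‖∇w‖ ≤ (h/δ) ‖∇v‖ + (c^p/δ) ‖v‖` (`RegularElement.exists_element_estimate`). Both
kinds of meshes consist of elements of the type `RegularElement`, with a rate `b` for the higher
derivatives of `F`: zero for affine maps and `h/L` for curved ones. With `c = max (h/δ) b` one has
`c^p ≤ (h/δ)^p + h/L`. The surplus `(h/δ)/L · ‖v‖`, after division by `k ≥ k₀`, is absorbed in the
term `h/δ`; this is how `k₀` and `L` enter the constant.

To sum over elements, the error must be in H¹ across faces. Interpolation does not depend on the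
element chosen at a shared point (`Mesh.interp_map`), so the error is Lipschitz on each closed
element, hence locally Lipschitz on the subdomain (`Mesh.locLip_of_elem`), and its weak gradient is
the classical one (`LocLip.isWeakGrad`). Faces are null sets.

The derivative bounds of the hypotheses hold only almost everywhere. `locLip_of_ae_fderiv_le`
converts the one of top order into a Lipschitz constant, and `SClass` keeps track of the scaled
bounds through products and compositions. -/

/-- `f` is Lipschitz at every point of `U`, with the common constant `M`. -/
def LocLip {X Y : Type*} [NormedAddCommGroup X] [NormedAddCommGroup Y]
    (U : Set X) (f : X → Y) (M : ℝ) : Prop :=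
  ∀ x ∈ U, ∀ᶠ y in 𝓝 x, ‖f y - f x‖ ≤ M * ‖y - x‖

/-! ### Pointwise Lipschitz constants -/

section LocLip

variable {X Y Z : Type*} [NormedAddCommGroup X] [NormedAddCommGroup Y] [NormedAddCommGroup Z]
  {U : Set X} {f g : X → Y} {M N : ℝ}

theorem LocLip.mono (h : LocLip U f M) (hMN : M ≤ N) : LocLip U f N := fun x hx =>
  (h x hx).mono fun _ hy => hy.trans (by gcongr)

theorem LocLip.subset {V : Set X} (h : LocLip U f M) (hV : V ⊆ U) : LocLip V f M :=
  fun x hx => h x (hV hx)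

theorem LocLip.continuousAt (h : LocLip U f M) {x : X} (hx : x ∈ U) : ContinuousAt f x := by
  rw [ContinuousAt, tendsto_iff_norm_sub_tendsto_zero]
  have h1 : Tendsto (fun y => M * ‖y - x‖) (𝓝 x) (𝓝 0) := by
    have : ContinuousAt (fun y => M * ‖y - x‖) x := by fun_prop
    simpa [ContinuousAt] using this
  exact squeeze_zero' (Eventually.of_forall fun _ => norm_nonneg _) (h x hx) h1

theorem LocLip.continuousOn (h : LocLip U f M) : ContinuousOn f U :=
  fun _ hx => (h.continuousAt hx).continuousWithinAt

theorem LocLip.congr (hU : IsOpen U) (h : LocLip U f M) (hfg : EqOn f g U) : LocLip U g M := by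
  intro x hx
  filter_upwards [h x hx, hU.mem_nhds hx] with y hy hyU
  rwa [← hfg hx, ← hfg hyU]

theorem LocLip.add (hf : LocLip U f M) (hg : LocLip U g N) :
    LocLip U (fun x => f x + g x) (M + N) := by
  intro x hx
  filter_upwards [hf x hx, hg x hx] with y h1 h2
  calc ‖f y + g y - (f x + g x)‖ = ‖(f y - f x) + (g y - g x)‖ := by congr 1; abel
    _ ≤ ‖f y - f x‖ + ‖g y - g x‖ := norm_add_le _ _
    _ ≤ M * ‖y - x‖ + N * ‖y - x‖ := add_le_add h1 h2
    _ = _ := by ring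

theorem LocLip.comp {g : Y → Z} {V : Set Y} (hg : LocLip V g N) (hf : LocLip U f M)
    (hN : 0 ≤ N) (hUV : MapsTo f U V) : LocLip U (fun x => g (f x)) (N * M) := by
  intro x hx
  filter_upwards [hf x hx, (hf.continuousAt hx).eventually (hg (f x) (hUV hx))] with y h1 h2
  calc ‖g (f y) - g (f x)‖ ≤ N * ‖f y - f x‖ := h2
    _ ≤ N * (M * ‖y - x‖) := by gcongr
    _ = _ := by ring

variable [NormedSpace ℝ X]

/-- The pointwise bound controls the right slopes of `t ↦ ‖f (x + t (y - x)) - f x‖`, so a one-sided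
mean value inequality along the segment suffices and no differentiability is needed. -/
theorem LocLip.norm_sub_le (h : LocLip U f M) {x y : X} (hs : segment ℝ x y ⊆ U) :
    ‖f y - f x‖ ≤ M * ‖y - x‖ := by
  have hmem : ∀ t ∈ Icc (0 : ℝ) 1, x + t • (y - x) ∈ U := fun t ht =>
    hs (by rw [segment_eq_image']; exact ⟨t, ht, rfl⟩)
  have hcont : ContinuousOn (fun t : ℝ => f (x + t • (y - x))) (Icc 0 1) := by
    intro t ht
    have h1 := h.continuousAt (hmem t ht)
    have h2 : ContinuousAt (fun t : ℝ => x + t • (y - x)) t := by fun_prop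
    exact (ContinuousAt.comp (f := fun t : ℝ => x + t • (y - x)) h1 h2).continuousWithinAt
  have key := image_le_of_liminf_slope_right_le_deriv_boundary
    (f := fun t : ℝ => ‖f (x + t • (y - x)) - f x‖) (a := 0) (b := 1)
    (B := fun t => (M * ‖y - x‖) * t) (B' := fun _ => M * ‖y - x‖)
    (hcont.sub continuousOn_const).norm (by simp) (by fun_prop)
    (fun t _ => by simpa using ((hasDerivAt_id t).const_mul (M * ‖y - x‖)).hasDerivWithinAt)
    (fun t ht r hr => by
      apply Eventually.frequently
      have h1 := h _ (hmem t ⟨ht.1, ht.2.le⟩)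
      have h2 : Tendsto (fun s : ℝ => x + s • (y - x)) (𝓝[>] t) (𝓝 (x + t • (y - x))) := by
        have : ContinuousAt (fun s : ℝ => x + s • (y - x)) t := by fun_prop
        exact this.tendsto.mono_left nhdsWithin_le_nhds
      filter_upwards [h2.eventually h1, self_mem_nhdsWithin] with s hs hts
      have hts : 0 < s - t := sub_pos.2 hts
      refine lt_of_le_of_lt ?_ hr
      rw [slope_def_field, div_le_iff₀ hts]
      have h3 : x + s • (y - x) - (x + t • (y - x)) = (s - t) • (y - x) := by
        rw [sub_smul]; abel
      rw [h3, norm_smul, Real.norm_of_nonneg hts.le] at hs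
      calc ‖f (x + s • (y - x)) - f x‖ - ‖f (x + t • (y - x)) - f x‖
          ≤ ‖(f (x + s • (y - x)) - f x) - (f (x + t • (y - x)) - f x)‖ := norm_sub_norm_le _ _
        _ = ‖f (x + s • (y - x)) - f (x + t • (y - x))‖ := by congr 1; abel
        _ ≤ _ := hs
        _ = _ := by ring)
  simpa using key (right_mem_Icc.2 zero_le_one)

theorem LocLip.norm_sub_le_of_convex (h : LocLip U f M) (hU : Convex ℝ U) {x y : X}
    (hx : x ∈ U) (hy : y ∈ U) : ‖f y - f x‖ ≤ M * ‖y - x‖ :=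
  h.norm_sub_le (hU.segment_subset hx hy)

theorem locLip_of_fderiv_le [NormedSpace ℝ Y] (hU : IsOpen U)
    (hd : ∀ x ∈ U, DifferentiableAt ℝ f x)
    (hM : ∀ x ∈ U, ‖fderiv ℝ f x‖ ≤ M) : LocLip U f M := by
  intro x hx
  obtain ⟨r, hr, hrU⟩ := Metric.isOpen_iff.1 hU x hx
  filter_upwards [Metric.ball_mem_nhds x hr] with y hy
  exact (convex_ball x r).norm_image_sub_le_of_norm_fderiv_le (fun z hz => hd z (hrU hz))
    (fun z hz => hM z (hrU hz)) (Metric.mem_ball_self hr) hy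

theorem LocLip.norm_fderiv_le [NormedSpace ℝ Y] (h : LocLip U f M) (hM : 0 ≤ M) {x : X}
    (hx : x ∈ U) : ‖fderiv ℝ f x‖ ≤ M :=
  norm_fderiv_le_of_lip' ℝ hM (h x hx)

end LocLip

/-- An exceptional null set could contain a whole segment, so the mean value inequality is applied
to averages of `g` over small balls instead. These are differentiable everywhere, with the averaged
derivative, and converge to `g`. -/
theorem locLip_of_ae_fderiv_le {d : ℕ} {G : Type*} [NormedAddCommGroup G] [NormedSpace ℝ G]
    [FiniteDimensional ℝ G] {U : Set (E d)} (hU : IsOpen U) {g : E d → G} {K : NNReal} {B : ℝ}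
    (hg : LipschitzOnWith K g U) (hB : ∀ᵐ x ∂(volume.restrict U), ‖fderiv ℝ g x‖ ≤ B) :
    LocLip U g B := by
  intro x₀ hx₀
  obtain ⟨r, hr, hrU⟩ := Metric.isOpen_iff.1 hU x₀ hx₀
  have hr2 : 0 < r / 2 := by positivity
  filter_upwards [Metric.ball_mem_nhds x₀ hr2] with y hy
  have hcont : ContinuousOn g U := hg.continuousOn
  have hmem : ∀ ε ≤ r / 2, ∀ z ∈ Metric.ball x₀ (r / 2), ∀ t ∈ Metric.ball (0 : E d) ε,
      z + t ∈ U := by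
    intro ε hε z hz t ht
    apply hrU
    rw [mem_ball_iff_norm] at hz ⊢
    rw [mem_ball_zero_iff] at ht
    calc ‖z + t - x₀‖ = ‖(z - x₀) + t‖ := by congr 1; abel
      _ ≤ ‖z - x₀‖ + ‖t‖ := norm_add_le _ _
      _ < r := by linarith
  have hdiff : ∀ᵐ x : E d, x ∈ U → HasFDerivAt g (fderiv ℝ g x) x ∧ ‖fderiv ℝ g x‖ ≤ B := by
    rw [ae_restrict_iff' hU.measurableSet] at hB
    filter_upwards [hg.ae_differentiableWithinAt_of_mem (μ := volume), hB] with x h1 h2 hx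
    exact ⟨((h1 hx).differentiableAt (hU.mem_nhds hx)).hasFDerivAt, h2 hx⟩
  -- Replacing `g` by its average over a ball of radius `ε` costs at most `K ε` at each of the two
  -- points.
  have main : ∀ ε, 0 < ε → ε ≤ r / 2 → ‖g y - g x₀‖ ≤ B * ‖y - x₀‖ + 2 * K * ε := by
    intro ε hε hεr
    set S := Metric.ball (0 : E d) ε with hS
    set c := volume.real S with hc
    have hcpos : 0 < c :=
      ENNReal.toReal_pos (Metric.measure_ball_pos _ _ hε).ne' measure_ball_lt_top.ne
    have hSm : MeasurableSet S := measurableSet_ball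
    have hfin : volume S ≠ ⊤ := measure_ball_lt_top.ne
    have hcontz : ∀ z ∈ Metric.ball x₀ (r / 2), ContinuousOn (fun t => g (z + t)) S :=
      fun z hz => hcont.comp (by fun_prop) (fun t ht => hmem ε hεr z hz t ht)
    have hint : ∀ z ∈ Metric.ball x₀ (r / 2), IntegrableOn (fun t => g (z + t)) S := by
      intro z hz
      refine ⟨(hcontz z hz).aestronglyMeasurable hSm, ?_⟩
      refine HasFiniteIntegral.restrict_of_bounded (C := ‖g z‖ + K * ε) hfin.lt_top ?_
      refine (ae_restrict_iff' hSm).2 (Eventually.of_forall fun t ht => ?_)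
      have h1 := hg.norm_sub_le (hmem ε hεr z hz t ht) (hrU (Metric.ball_subset_ball (by linarith) hz))
      have h2 : ‖t‖ < ε := by simpa [hS] using ht
      have h3 : ‖g (z + t)‖ ≤ ‖g z‖ + ‖g (z + t) - g z‖ := by
        simpa using norm_add_le (g z) (g (z + t) - g z)
      have h4 : (K : ℝ) * ‖z + t - z‖ ≤ K * ε := by
        gcongr; simpa using h2.le
      linarith
    -- Differentiation under the integral: the Lipschitz constant `K` dominates the difference
    -- quotients, and for each fixed `z` the derivative exists at almost every `z + t` by
    -- Rademacher's theorem.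
    have hder : ∀ z ∈ Metric.ball x₀ (r / 2),
        HasFDerivAt (fun w => ∫ t in S, g (w + t)) (∫ t in S, fderiv ℝ g (z + t)) z ∧
        ‖∫ t in S, fderiv ℝ g (z + t)‖ ≤ B * c := by
      intro z hz
      have hz' : Metric.ball x₀ (r / 2) ∈ 𝓝 z := Metric.isOpen_ball.mem_nhds hz
      have hae : ∀ᵐ t ∂(volume.restrict S), HasFDerivAt g (fderiv ℝ g (z + t)) (z + t) ∧
          ‖fderiv ℝ g (z + t)‖ ≤ B := by
        refine (ae_restrict_iff' hSm).2 ?_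
        have h1 := (measurePreserving_add_left (volume : Measure (E d)) z).quasiMeasurePreserving.ae
          hdiff
        filter_upwards [h1] with t ht htS
        exact ht (hmem ε hεr z hz t htS)
      refine ⟨(hasFDerivAt_integral_of_dominated_loc_of_lip (μ := volume.restrict S)
        (F := fun w t => g (w + t)) (bound := fun _ => (K : ℝ)) hz' ?_
        (hint z hz) ?_ ?_ ?_ ?_).2, ?_⟩
      · filter_upwards [hz'] with w hw
        exact (hint w hw).aestronglyMeasurable
      · have h1 : Measurable (fun t => fderiv ℝ g (z + t)) :=
          (measurable_fderiv ℝ g).comp (measurable_const_add z)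
        exact h1.aestronglyMeasurable
      · refine (ae_restrict_iff' hSm).2 (Eventually.of_forall fun t ht => ?_)
        refine LipschitzOnWith.of_dist_le_mul fun a ha b hb => ?_
        have := hg.dist_le_mul _ (hmem ε hεr a ha t ht) _ (hmem ε hεr b hb t ht)
        simpa using this
      · exact integrableOn_const hfin
      · filter_upwards [hae] with t ht
        exact (hasFDerivAt_comp_add_right t).2 ht.1
      · exact norm_setIntegral_le_of_norm_le_const_ae' hfin.lt_top
          ((ae_restrict_iff' hSm).1 (hae.mono fun t ht => ht.2))
    have hx₀b : x₀ ∈ Metric.ball x₀ (r / 2) := Metric.mem_ball_self hr2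
    have h1 : ‖(∫ t in S, g (y + t)) - ∫ t in S, g (x₀ + t)‖ ≤ B * c * ‖y - x₀‖ :=
      (convex_ball x₀ (r / 2)).norm_image_sub_le_of_norm_hasFDerivWithin_le
        (fun z hz => (hder z hz).1.hasFDerivWithinAt) (fun z hz => (hder z hz).2) hx₀b hy
    have h2 : ∀ z ∈ Metric.ball x₀ (r / 2), ‖(∫ t in S, g (z + t)) - c • g z‖ ≤ K * ε * c := by
      intro z hz
      have h3 : c • g z = ∫ t in S, g z := by simp [hc]
      rw [h3, ← integral_sub (hint z hz) (integrableOn_const hfin)]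
      refine norm_setIntegral_le_of_norm_le_const hfin.lt_top fun t ht => ?_
      have h1 := hg.norm_sub_le (hmem ε hεr z hz t ht)
        (hrU (Metric.ball_subset_ball (by linarith) hz))
      have h2 : ‖t‖ < ε := by simpa [hS] using ht
      calc _ ≤ (K : ℝ) * ‖z + t - z‖ := h1
        _ ≤ K * ε := by gcongr; simpa using h2.le
    have h3 : ‖c • g y - c • g x₀‖ ≤ c * (B * ‖y - x₀‖ + 2 * K * ε) := by
      have e1 : c • g y - c • g x₀ = ((∫ t in S, g (y + t)) - ∫ t in S, g (x₀ + t))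
          - ((∫ t in S, g (y + t)) - c • g y) + ((∫ t in S, g (x₀ + t)) - c • g x₀) := by abel
      rw [e1]
      refine (norm_add_le _ _).trans ?_
      have := norm_sub_le ((∫ t in S, g (y + t)) - ∫ t in S, g (x₀ + t))
        ((∫ t in S, g (y + t)) - c • g y)
      have := h2 y hy
      have := h2 x₀ hx₀b
      nlinarith
    rw [← smul_sub, norm_smul, Real.norm_of_nonneg hcpos.le] at h3
    exact le_of_mul_le_mul_left h3 hcpos
  have hlim : Tendsto (fun ε : ℝ => B * ‖y - x₀‖ + 2 * K * ε) (𝓝[>] 0) (𝓝 (B * ‖y - x₀‖)) := by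
    have : ContinuousAt (fun ε : ℝ => B * ‖y - x₀‖ + 2 * K * ε) 0 := by fun_prop
    have h := this.tendsto.mono_left (nhdsWithin_le_nhds (s := Ioi 0))
    simpa using h
  refine ge_of_tendsto hlim ?_
  filter_upwards [Ioo_mem_nhdsGT hr2] with ε hε
  exact main ε hε.1 hε.2.le

/-! ### Calculus of the classes `C^{n,1}` with scaled bounds -/

/-- The class `C^{n,1}` with scaled bounds: `‖D^m f‖ ≤ A c^m` on `U` for `m ≤ n`, and `D^n f` is
locally Lipschitz with constant `A c^{n+1}`. -/
def SClass {d : ℕ} (U : Set (E d)) : ∀ (_ : ℕ) {G : Type} [NormedAddCommGroup G]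
    [NormedSpace ℝ G], (E d → G) → ℝ → ℝ → Prop
  | 0, _, _, _, f, A, c => (∀ x ∈ U, ‖f x‖ ≤ A) ∧ LocLip U f (A * c)
  | n + 1, _, _, _, f, A, c => (∀ x ∈ U, ‖f x‖ ≤ A ∧ DifferentiableAt ℝ f x) ∧
      SClass U n (fderiv ℝ f) (A * c) c

section SClass

variable {d : ℕ} {U V : Set (E d)} {n : ℕ} {G G₁ G₂ G₃ : Type} [NormedAddCommGroup G]
  [NormedSpace ℝ G] [NormedAddCommGroup G₁] [NormedSpace ℝ G₁] [NormedAddCommGroup G₂]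
  [NormedSpace ℝ G₂] [NormedAddCommGroup G₃] [NormedSpace ℝ G₃]

theorem SClass.norm_le {f : E d → G} {A c : ℝ} (h : SClass U n f A c) {x : E d} (hx : x ∈ U) :
    ‖f x‖ ≤ A := by
  cases n with
  | zero => exact h.1 x hx
  | succ n => exact (h.1 x hx).1

theorem SClass.locLip (hU : IsOpen U) {f : E d → G} {A c : ℝ} (h : SClass U n f A c) :
    LocLip U f (A * c) := by
  cases n with
  | zero => exact h.2
  | succ n => exact locLip_of_fderiv_le hU (fun x hx => (h.1 x hx).2) fun x hx => h.2.norm_le hx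

theorem SClass.mono {f : E d → G} {A A' c c' : ℝ} (h : SClass U n f A c) (hA : 0 ≤ A)
    (hAA : A ≤ A') (hc : 0 ≤ c) (hcc : c ≤ c') : SClass U n f A' c' := by
  have h1 : A * c ≤ A' * c' := mul_le_mul hAA hcc hc (hA.trans hAA)
  induction n generalizing G A A' with
  | zero => exact ⟨fun x hx => (h.1 x hx).trans hAA, h.2.mono h1⟩
  | succ n ih =>
    refine ⟨fun x hx => ⟨(h.1 x hx).1.trans hAA, (h.1 x hx).2⟩, ?_⟩
    exact ih h.2 (mul_nonneg hA hc) h1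
      (mul_le_mul h1 hcc hc ((mul_nonneg hA hc).trans h1))

theorem SClass.congr (hU : IsOpen U) {f g : E d → G} {A c : ℝ} (h : SClass U n f A c)
    (hfg : EqOn f g U) : SClass U n g A c := by
  induction n generalizing G A with
  | zero => exact ⟨fun x hx => hfg hx ▸ h.1 x hx, h.2.congr hU hfg⟩
  | succ n ih =>
    have hev : ∀ x ∈ U, f =ᶠ[𝓝 x] g := fun x hx => by
      filter_upwards [hU.mem_nhds hx] with y hy using hfg hy
    refine ⟨fun x hx => ⟨hfg hx ▸ (h.1 x hx).1,
      (hev x hx).differentiableAt_iff.1 (h.1 x hx).2⟩, ?_⟩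
    exact ih h.2 fun x hx => (hev x hx).fderiv_eq

theorem SClass.of_succ (hU : IsOpen U) {f : E d → G} {A c : ℝ} (h : SClass U (n + 1) f A c) :
    SClass U n f A c := by
  induction n generalizing G A with
  | zero => exact ⟨fun x hx => h.norm_le hx, h.locLip hU⟩
  | succ n ih => exact ⟨h.1, ih h.2⟩

theorem SClass.add (hU : IsOpen U) {f g : E d → G} {A A' c : ℝ} (hf : SClass U n f A c)
    (hg : SClass U n g A' c) : SClass U n (fun x => f x + g x) (A + A') c := by
  induction n generalizing G A A' with
  | zero =>
    exact ⟨fun x hx => (norm_add_le _ _).trans (add_le_add (hf.1 x hx) (hg.1 x hx)),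
      (hf.2.add hg.2).mono (by linarith)⟩
  | succ n ih =>
    refine ⟨fun x hx => ⟨(norm_add_le _ _).trans (add_le_add (hf.1 x hx).1 (hg.1 x hx).1),
      (hf.1 x hx).2.add (hg.1 x hx).2⟩, ?_⟩
    have := (ih hf.2 hg.2).congr hU (g := fderiv ℝ fun x => f x + g x) fun x hx =>
      (fderiv_add (hf.1 x hx).2 (hg.1 x hx).2).symm
    rwa [← add_mul] at this

/-- Leibniz' rule: each differentiation splits the product into two terms of the same kind, and the
last Lipschitz estimate splits it once more, whence `2 ^ (n + 1)`. -/
theorem SClass.bilin (hU : IsOpen U) (B : G₁ →L[ℝ] G₂ →L[ℝ] G₃) (hB : ‖B‖ ≤ 1) {f : E d → G₁}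
    {g : E d → G₂} {A A' c : ℝ} (hA : 0 ≤ A) (hA' : 0 ≤ A') (hc : 0 ≤ c)
    (hf : SClass U n f A c) (hg : SClass U n g A' c) :
    SClass U n (fun x => B (f x) (g x)) (2 ^ (n + 1) * (A * A')) c := by
  have hBle : ∀ u v, ‖B u v‖ ≤ ‖u‖ * ‖v‖ := fun u v => by
    refine (B.le_opNorm₂ u v).trans ?_
    nlinarith [mul_nonneg (norm_nonneg u) (norm_nonneg v)]
  have hbd : ∀ x ∈ U, ‖B (f x) (g x)‖ ≤ 2 ^ (n + 1) * (A * A') := fun x hx => by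
    have h1 : ‖B (f x) (g x)‖ ≤ A * A' := (hBle _ _).trans
      (mul_le_mul (hf.norm_le hx) (hg.norm_le hx) (norm_nonneg _) hA)
    exact h1.trans (le_mul_of_one_le_left (mul_nonneg hA hA') (one_le_pow₀ (by norm_num)))
  induction n generalizing G₁ G₂ G₃ A A' with
  | zero =>
    refine ⟨hbd, fun x hx => ?_⟩
    filter_upwards [hf.2 x hx, hg.2 x hx, hU.mem_nhds hx] with y h1 h2 hy
    have e1 : B (f y) (g y) - B (f x) (g x) = B (f y - f x) (g y) + B (f x) (g y - g x) := by
      simp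
    rw [e1]
    have i1 : ‖B (f y - f x) (g y)‖ ≤ A * c * ‖y - x‖ * A' :=
      (hBle _ _).trans (mul_le_mul h1 (hg.norm_le hy) (norm_nonneg _) (by positivity))
    have i2 : ‖B (f x) (g y - g x)‖ ≤ A * (A' * c * ‖y - x‖) :=
      (hBle _ _).trans (mul_le_mul (hf.norm_le hx) h2 (norm_nonneg _) hA)
    refine (norm_add_le _ _).trans ((add_le_add i1 i2).trans (le_of_eq (by ring)))
  | succ n ih =>
    have hBd : ∀ x ∈ U, HasFDerivAt (fun x => B (f x) (g x))
        (B.precompR (E d) (f x) (fderiv ℝ g x) + B.precompL (E d) (fderiv ℝ f x) (g x)) x :=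
      fun x hx => B.hasFDerivAt_of_bilinear (hf.1 x hx).2.hasFDerivAt (hg.1 x hx).2.hasFDerivAt
    refine ⟨fun x hx => ⟨hbd x hx, (hBd x hx).differentiableAt⟩, ?_⟩
    have hR : ‖B.precompR (E d)‖ ≤ 1 := (B.norm_precompR_le (E d)).trans hB
    have hL : ‖B.precompL (E d)‖ ≤ 1 := (B.norm_precompL_le (E d)).trans hB
    -- The induction hypothesis also asks for the pointwise bounds `hBle` and `hbd` of the new
    -- product; `aux` supplies them.
    have aux : ∀ {H₁ H₂ H₃ : Type} [NormedAddCommGroup H₁] [NormedSpace ℝ H₁]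
        [NormedAddCommGroup H₂] [NormedSpace ℝ H₂] [NormedAddCommGroup H₃] [NormedSpace ℝ H₃]
        (B' : H₁ →L[ℝ] H₂ →L[ℝ] H₃), ‖B'‖ ≤ 1 → ∀ {f' : E d → H₁} {g' : E d → H₂} {D D' : ℝ},
        0 ≤ D → 0 ≤ D' → SClass U n f' D c → SClass U n g' D' c →
        SClass U n (fun x => B' (f' x) (g' x)) (2 ^ (n + 1) * (D * D')) c := by
      intro H₁ H₂ H₃ _ _ _ _ _ _ B' hB' f' g' D D' hD hD' hf' hg'
      have hB'le : ∀ u v, ‖B' u v‖ ≤ ‖u‖ * ‖v‖ := fun u v => by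
        refine (B'.le_opNorm₂ u v).trans ?_
        nlinarith [mul_nonneg (norm_nonneg u) (norm_nonneg v)]
      refine ih B' hB' hD hD' hf' hg' hB'le fun x hx => ?_
      have h1 : ‖B' (f' x) (g' x)‖ ≤ D * D' := (hB'le _ _).trans
        (mul_le_mul (hf'.norm_le hx) (hg'.norm_le hx) (norm_nonneg _) hD)
      exact h1.trans (le_mul_of_one_le_left (mul_nonneg hD hD') (one_le_pow₀ (by norm_num)))
    have h1 := aux (B.precompR (E d)) hR hA (mul_nonneg hA' hc) (hf.of_succ hU) hg.2
    have h2 := aux (B.precompL (E d)) hL (mul_nonneg hA hc) hA' hf.2 (hg.of_succ hU)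
    have h3 := (h1.add hU h2).congr hU (g := fderiv ℝ fun x => B (f x) (g x)) fun x hx =>
      (hBd x hx).fderiv.symm
    convert h3 using 1
    ring

/-- By the chain rule `D(g ∘ F) = (Dg ∘ F) · DF`, so the order drops by one. One derivative of `g`
costs `t` and one factor `DF` costs `H`; the condition `H * t ≤ C * c` makes their product one
factor `c`, and the constant depends on `n` and `C` only. -/
theorem SClass.comp (n : ℕ) (C : ℝ) : ∃ K, 1 ≤ K ∧ ∀ {d : ℕ} {U V : Set (E d)} {G : Type}
    [NormedAddCommGroup G] [NormedSpace ℝ G] {g : E d → G} {F : E d → E d} {A t H c : ℝ},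
    IsOpen U → IsOpen V → MapsTo F U V → 0 ≤ A → 0 ≤ t → 0 ≤ H → 0 ≤ c → H * t ≤ C * c →
    (∀ x ∈ U, DifferentiableAt ℝ F x) → SClass U n (fderiv ℝ F) H c → SClass V n g A t →
    SClass U n (fun x => g (F x)) (K * A) c := by
  induction n with
  | zero =>
    refine ⟨max 1 C, le_max_left _ _, ?_⟩
    intro d U V G _ _ g F A t H c hU hV hUV hA ht hH hc hHt hd hF hg
    refine ⟨fun x hx => (hg.norm_le (hUV hx)).trans
      (le_mul_of_one_le_left hA (le_max_left _ _)), ?_⟩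
    have hFl : LocLip U F H := locLip_of_fderiv_le hU hd fun x hx => hF.norm_le hx
    refine (hg.2.comp hFl (by positivity) hUV).mono ?_
    calc A * t * H = A * (H * t) := by ring
      _ ≤ A * (max 1 C * c) := by
        exact mul_le_mul_of_nonneg_left
          (hHt.trans (mul_le_mul_of_nonneg_right (le_max_right _ _) hc)) hA
      _ = _ := by ring
  | succ n ih =>
    obtain ⟨K, hK, ih⟩ := ih
    refine ⟨max K (2 ^ (n + 1) * K * C), hK.trans (le_max_left _ _), ?_⟩
    intro d U V G _ _ g F A t H c hU hV hUV hA ht hH hc hHt hd hF hg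
    set K' := max K (2 ^ (n + 1) * K * C) with hK'
    have h1 := ih hU hV hUV (mul_nonneg hA ht) ht hH hc hHt hd (hF.of_succ hU) hg.2
    have hder : ∀ x ∈ U, HasFDerivAt (fun x => g (F x))
        ((fderiv ℝ g (F x)).comp (fderiv ℝ F x)) x := fun x hx =>
      (hg.1 _ (hUV hx)).2.hasFDerivAt.comp x (hd x hx).hasFDerivAt
    refine ⟨fun x hx => ⟨(hg.norm_le (hUV hx)).trans (le_mul_of_one_le_left hA
      (hK.trans (le_max_left _ _))), (hder x hx).differentiableAt⟩, ?_⟩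
    have h2 := SClass.bilin hU (ContinuousLinearMap.compL ℝ (E d) (E d) G)
      (ContinuousLinearMap.norm_compL_le ℝ (E d) (E d) G) (by positivity) hH hc h1
      (hF.of_succ hU)
    refine (h2.congr hU (g := fderiv ℝ fun x => g (F x)) fun x hx =>
      (hder x hx).fderiv.symm).mono (by positivity) ?_ hc le_rfl
    calc 2 ^ (n + 1) * (K * (A * t) * H) = 2 ^ (n + 1) * K * A * (H * t) := by ring
      _ ≤ 2 ^ (n + 1) * K * A * (C * c) := by gcongr
      _ = (2 ^ (n + 1) * K * C) * A * c := by ring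
      _ ≤ K' * A * c := by gcongr; exact le_max_right _ _

/-- `iteratedFDeriv` of a derivative and of the function itself agree up to an isometry. -/
theorem exists_isometry_iteratedFDeriv_succ (m : ℕ) :
    ∃ I : (E d [×m]→L[ℝ] (E d →L[ℝ] G)) ≃ₗᵢ[ℝ] (E d [×(m + 1)]→L[ℝ] G),
      ∀ f : E d → G, ∀ x, iteratedFDeriv ℝ (m + 1) f x = I (iteratedFDeriv ℝ m (fderiv ℝ f) x) :=
  ⟨(continuousMultilinearCurryRightEquiv' ℝ m (E d) G).symm, fun _ _ => by
    rw [iteratedFDeriv_succ_eq_comp_right]; rfl⟩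

theorem locLip_isometry_iff {X Y Z : Type*} [NormedAddCommGroup X] [NormedAddCommGroup Y]
    [NormedAddCommGroup Z] [NormedSpace ℝ Y] [NormedSpace ℝ Z] {U : Set X} (I : Y ≃ₗᵢ[ℝ] Z)
    {f : X → Y} {M : ℝ} : LocLip U (fun x => I (f x)) M ↔ LocLip U f M := by
  simp only [LocLip, ← map_sub, LinearIsometryEquiv.norm_map]

/-- The recursive form suits induction through product and chain rules; the form with iterated
derivatives is the one that meets the hypotheses and Taylor's formula. They agree because currying
is an isometry. -/
theorem sClass_iff {f : E d → G} {A c : ℝ} : SClass U n f A c ↔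
    (∀ m ≤ n, ∀ x ∈ U, ‖iteratedFDeriv ℝ m f x‖ ≤ A * c ^ m) ∧
    (∀ m < n, ∀ x ∈ U, DifferentiableAt ℝ (iteratedFDeriv ℝ m f) x) ∧
    LocLip U (iteratedFDeriv ℝ n f) (A * c ^ (n + 1)) := by
  induction n generalizing G A with
  | zero =>
    have h0 : ∀ M, LocLip U (iteratedFDeriv ℝ 0 f) M ↔ LocLip U f M := fun M => by
      rw [← locLip_isometry_iff (continuousMultilinearCurryFin0 ℝ (E d) G).symm (f := f)]
      rfl
    simp [SClass, h0]
  | succ n ih =>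
    have hnorm : ∀ m x, ‖iteratedFDeriv ℝ m (fderiv ℝ f) x‖ = ‖iteratedFDeriv ℝ (m + 1) f x‖ :=
      fun m x => norm_iteratedFDeriv_fderiv
    have hdiff : ∀ m x, DifferentiableAt ℝ (iteratedFDeriv ℝ m (fderiv ℝ f)) x ↔
        DifferentiableAt ℝ (iteratedFDeriv ℝ (m + 1) f) x := fun m x => by
      obtain ⟨I, hI⟩ := exists_isometry_iteratedFDeriv_succ (d := d) (G := G) m
      rw [show iteratedFDeriv ℝ (m + 1) f = I ∘ iteratedFDeriv ℝ m (fderiv ℝ f) from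
        funext (hI f)]
      exact (LinearIsometryEquiv.comp_differentiableAt_iff (E := E d [×m]→L[ℝ] (E d →L[ℝ] G))
        (F := E d [×(m + 1)]→L[ℝ] G) (iso := I)).symm
    have hlip : ∀ M, LocLip U (iteratedFDeriv ℝ n (fderiv ℝ f)) M ↔
        LocLip U (iteratedFDeriv ℝ (n + 1) f) M := fun M => by
      obtain ⟨I, hI⟩ := exists_isometry_iteratedFDeriv_succ (d := d) (G := G) n
      rw [show iteratedFDeriv ℝ (n + 1) f = fun x => I (iteratedFDeriv ℝ n (fderiv ℝ f) x) from
        funext (hI f)]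
      exact (locLip_isometry_iff (Y := E d [×n]→L[ℝ] (E d →L[ℝ] G))
        (Z := E d [×(n + 1)]→L[ℝ] G) I).symm
    have hdiff0 : ∀ x, DifferentiableAt ℝ (iteratedFDeriv ℝ 0 f) x ↔ DifferentiableAt ℝ f x :=
      fun x => by
        rw [show iteratedFDeriv ℝ 0 f = (continuousMultilinearCurryFin0 ℝ (E d) G).symm ∘ f from
          iteratedFDeriv_zero_eq_comp]
        exact (continuousMultilinearCurryFin0 ℝ (E d) G).symm.comp_differentiableAt_iff
    rw [SClass, ih]
    simp only [hnorm, hdiff, hlip]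
    have e : ∀ m, A * c * c ^ m = A * c ^ (m + 1) := fun m => by ring
    simp only [e]
    constructor
    · rintro ⟨h0, h1, h2, h3⟩
      refine ⟨fun m hm x hx => ?_, fun m hm x hx => ?_, h3⟩
      · cases m with
        | zero => simpa using (h0 x hx).1
        | succ m => exact h1 m (by omega) x hx
      · cases m with
        | zero => exact (hdiff0 x).2 (h0 x hx).2
        | succ m => exact h2 m (by omega) x hx
    · rintro ⟨h1, h2, h3⟩
      refine ⟨fun x hx => ⟨by simpa using h1 0 (by omega) x hx,
        (hdiff0 x).1 (h2 0 (by omega) x hx)⟩, fun m hm x hx => h1 _ (by omega) x hx,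
        fun m hm x hx => h2 _ (by omega) x hx, h3⟩

end SClass

/-! ### From bounds on partial derivatives to operator norms -/

section Partials

variable {d : ℕ} {G : Type} [NormedAddCommGroup G] [NormedSpace ℝ G]

theorem abs_apply_le_norm (x : E d) (j : Fin d) : |x j| ≤ ‖x‖ := by
  simpa using PiLp.norm_apply_le x j

theorem sum_smul_e (x : E d) : ∑ j, x j • (e j : E d) = x := by
  ext i
  simp [e, Pi.single_apply]

/-- Expanding each of the `m` arguments in coordinates produces `d ^ m` terms. -/
theorem norm_le_of_forall_e {m : ℕ} (T : E d [×m]→L[ℝ] G) {B : ℝ} (hB : 0 ≤ B)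
    (h : ∀ j : Fin m → Fin d, ‖T (fun t => e (j t))‖ ≤ B) : ‖T‖ ≤ (d : ℝ) ^ m * B := by
  refine T.opNorm_le_bound (by positivity) fun x => ?_
  have h1 : T x = ∑ j : Fin m → Fin d, (∏ t, x t (j t)) • T (fun t => e (j t)) := by
    have : T x = T (fun t => ∑ k, x t k • e k) := by
      congr 1; funext t; exact (sum_smul_e _).symm
    rw [this, T.map_sum]
    exact Finset.sum_congr rfl fun j _ => T.map_smul_univ _ _
  rw [h1]
  calc ‖∑ j : Fin m → Fin d, (∏ t, x t (j t)) • T (fun t => e (j t))‖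
      ≤ ∑ j : Fin m → Fin d, (∏ t, ‖x t‖) * B := by
        refine norm_sum_le_of_le _ fun j _ => ?_
        rw [norm_smul]
        refine mul_le_mul ?_ (h j) (norm_nonneg _) (by positivity)
        rw [norm_prod]
        exact Finset.prod_le_prod (fun _ _ => norm_nonneg _) fun t _ => abs_apply_le_norm _ _
    _ = _ := by simp; ring

theorem le_of_ae_le_of_continuousOn {U : Set (E d)} (hU : IsOpen U) {f : E d → ℝ}
    (hf : ContinuousOn f U) {B : ℝ} (h : ∀ᵐ x ∂(volume.restrict U), f x ≤ B) :
    ∀ x ∈ U, f x ≤ B := by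
  intro x hx
  by_contra! hlt
  have hopen : IsOpen (U ∩ f ⁻¹' Ioi B) := hf.isOpen_inter_preimage hU isOpen_Ioi
  have hpos := hopen.measure_pos (volume : Measure (E d)) ⟨x, hx, hlt⟩
  rw [ae_restrict_iff' hU.measurableSet] at h
  have hz : volume (U ∩ f ⁻¹' Ioi B) = 0 := by
    refine measure_mono_null (fun y hy => ?_) (ae_iff.1 h)
    simp only [mem_ofPred_eq, not_forall]
    exact ⟨hy.1, not_le.2 hy.2⟩
  exact hpos.ne' hz

/-- Rademacher's theorem is going to be applied to the derivative of order `n + 1`, whose values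
must lie in a finite-dimensional space. -/
instance instFiniteDimensionalMultilinear (m : ℕ) [FiniteDimensional ℝ G] :
    FiniteDimensional ℝ (E d [×m]→L[ℝ] G) := by
  let f : (E d [×m]→L[ℝ] G) →ₗ[ℝ] MultilinearMap ℝ (fun _ : Fin m => E d) G :=
    { toFun := fun T => T.toMultilinearMap
      map_add' := fun _ _ => rfl
      map_smul' := fun _ _ => rfl }
  exact FiniteDimensional.of_injective f ContinuousMultilinearMap.toMultilinearMap_injective

/-- The properties of the derivatives of `f` that follow from bounds on those of `fderiv f`. -/
theorem jet_of_sClass_fderiv {U : Set (E d)} {n : ℕ} {f : E d → G} {A c : ℝ}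
    (hd : ∀ x ∈ U, DifferentiableAt ℝ f x) (h : SClass U n (fderiv ℝ f) A c) :
    (∀ m ≤ n, ∀ x ∈ U, DifferentiableAt ℝ (iteratedFDeriv ℝ m f) x) ∧
    LocLip U (iteratedFDeriv ℝ (n + 1) f) (A * c ^ (n + 1)) := by
  obtain ⟨-, h2, h3⟩ := sClass_iff.1 h
  constructor
  · intro m hm x hx
    cases m with
    | zero =>
      rw [show iteratedFDeriv ℝ 0 f = (continuousMultilinearCurryFin0 ℝ (E d) G).symm ∘ f from
        iteratedFDeriv_zero_eq_comp]
      exact (continuousMultilinearCurryFin0 ℝ (E d) G).symm.comp_differentiableAt_iff.2 (hd x hx)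
    | succ m =>
      obtain ⟨I, hI⟩ := exists_isometry_iteratedFDeriv_succ (d := d) (G := G) m
      rw [show iteratedFDeriv ℝ (m + 1) f = I ∘ iteratedFDeriv ℝ m (fderiv ℝ f) from
        funext (hI f)]
      exact (LinearIsometryEquiv.comp_differentiableAt_iff (E := E d [×m]→L[ℝ] (E d →L[ℝ] G))
        (F := E d [×(m + 1)]→L[ℝ] G) (iso := I)).2 (h2 m (by omega) x hx)
  · obtain ⟨I, hI⟩ := exists_isometry_iteratedFDeriv_succ (d := d) (G := G) n
    rw [show iteratedFDeriv ℝ (n + 1) f = fun x => I (iteratedFDeriv ℝ n (fderiv ℝ f) x) from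
      funext (hI f)]
    exact (locLip_isometry_iff (Y := E d [×n]→L[ℝ] (E d →L[ℝ] G))
        (Z := E d [×(n + 1)]→L[ℝ] G) I).2 h3

/-- Up to order `n + 1` the derivatives are continuous, so almost everywhere bounds hold everywhere.
At order `n + 2` only the almost everywhere bound is available, and it becomes a Lipschitz constant
for the derivative below. The exponent is `m - 1` because `A` measures the first derivative; `f`
itself is not small. -/
theorem sClass_fderiv_of_partials (hdpos : 1 ≤ d) [FiniteDimensional ℝ G] {K : Set (E d)} {n : ℕ}
    {f : E d → G} (hf : MemCLip (n + 1) K f) {A c : ℝ} (hA : 0 ≤ A) (hc : 0 ≤ c)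
    (hb : ∀ m, 1 ≤ m → m ≤ n + 2 → PartialsBounded m K f (A * c ^ (m - 1))) :
    (∀ x ∈ interior K, DifferentiableAt ℝ f x) ∧
      SClass (interior K) n (fderiv ℝ f) ((d : ℝ) ^ (n + 2) * A) c := by
  obtain ⟨-, hcd, M, hM⟩ := hf
  have hU : IsOpen (interior K) := isOpen_interior
  have hca : ∀ x ∈ interior K, ContDiffAt ℝ (n + 1 : ℕ) f x := fun x hx =>
    hcd.contDiffAt (hU.mem_nhds hx)
  have hdiff : ∀ m < n + 1, ∀ x ∈ interior K, DifferentiableAt ℝ (iteratedFDeriv ℝ m f) x :=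
    fun m hm x hx => (hca x hx).differentiableAt_iteratedFDeriv (by exact_mod_cast hm)
  have hcont : ∀ m ≤ n + 1, ContinuousOn (iteratedFDeriv ℝ m f) (interior K) := fun m hm => by
    rcases hm.lt_or_eq with hm | rfl
    · exact fun x hx => (hdiff m hm x hx).continuousAt.continuousWithinAt
    · exact hM.continuousOn
  have hae : ∀ m, 1 ≤ m → m ≤ n + 2 → ∀ᵐ x ∂(volume.restrict (interior K)),
      ‖iteratedFDeriv ℝ m f x‖ ≤ (d : ℝ) ^ (n + 2) * A * c ^ (m - 1) := fun m h1 h2 => by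
    filter_upwards [ae_all_iff.2 (hb m h1 h2)] with x hx
    refine (norm_le_of_forall_e _ (by positivity) hx).trans ?_
    rw [mul_assoc]
    gcongr
    exact_mod_cast hdpos
  have hall : ∀ m, 1 ≤ m → m ≤ n + 1 → ∀ x ∈ interior K,
      ‖iteratedFDeriv ℝ m f x‖ ≤ (d : ℝ) ^ (n + 2) * A * c ^ (m - 1) := fun m h1 h2 =>
    le_of_ae_le_of_continuousOn hU (hcont m h2).norm (hae m h1 (by omega))
  have hlip : LocLip (interior K) (iteratedFDeriv ℝ (n + 1) f)
      ((d : ℝ) ^ (n + 2) * A * c ^ (n + 1)) := by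
    refine locLip_of_ae_fderiv_le hU hM ?_
    filter_upwards [hae (n + 2) (by omega) le_rfl] with x hx
    rw [norm_fderiv_iteratedFDeriv]
    exact hx
  refine ⟨fun x hx => (hca x hx).differentiableAt (by simp), sClass_iff.2 ⟨?_, ?_, ?_⟩⟩
  · intro m hm x hx
    rw [norm_iteratedFDeriv_fderiv]
    exact hall (m + 1) (by omega) (by omega) x hx
  · intro m hm x hx
    obtain ⟨I, hI⟩ := exists_isometry_iteratedFDeriv_succ (d := d) (G := G) m
    have h1 := hdiff (m + 1) (by omega) x hx
    rw [show iteratedFDeriv ℝ (m + 1) f = I ∘ iteratedFDeriv ℝ m (fderiv ℝ f) from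
      funext (hI f)] at h1
    exact (LinearIsometryEquiv.comp_differentiableAt_iff (E := E d [×m]→L[ℝ] (E d →L[ℝ] G))
        (F := E d [×(m + 1)]→L[ℝ] G) (iso := I)).1 h1
  · obtain ⟨I, hI⟩ := exists_isometry_iteratedFDeriv_succ (d := d) (G := G) n
    rw [show iteratedFDeriv ℝ (n + 1) f = fun x => I (iteratedFDeriv ℝ n (fderiv ℝ f) x) from
      funext (hI f)] at hlip
    exact (locLip_isometry_iff (Y := E d [×n]→L[ℝ] (E d →L[ℝ] G))
        (Z := E d [×(n + 1)]→L[ℝ] G) I).1 hlip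

end Partials

/-! ### Taylor's formula up to the boundary -/

section Taylor

/-- Induction on the order: the derivative of a Taylor remainder is the remainder of the derivative,
and integrating over `[0, t]` with `t < 1` does not increase the bound. Factorials in the remainder
are not needed. -/
theorem norm_sub_taylor_sum_le {G : Type*} [NormedAddCommGroup G] [NormedSpace ℝ G] (N : ℕ)
    {φ : ℕ → ℝ → G} {M : ℝ}
    (hd : ∀ m < N, ∀ t ∈ Ico (0 : ℝ) 1, HasDerivAt (φ m) (φ (m + 1) t) t)
    (hM : ∀ t ∈ Ico (0 : ℝ) 1, ‖φ N t - φ N 0‖ ≤ M) :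
    ∀ t ∈ Ico (0 : ℝ) 1,
      ‖φ 0 t - ∑ m ∈ Finset.range (N + 1), (t ^ m / m.factorial) • φ m 0‖ ≤ M := by
  induction N generalizing φ with
  | zero => intro t ht; simpa using hM t ht
  | succ N ih =>
    intro t ht
    have h1 := ih (φ := fun m => φ (m + 1)) (fun m hm => hd (m + 1) (by omega)) hM
    have hM0 : 0 ≤ M := (norm_nonneg _).trans (hM 0 ⟨le_rfl, one_pos⟩)
    have hder : ∀ s ∈ Icc 0 t, HasDerivWithinAt
        (fun s => φ 0 s - ∑ m ∈ Finset.range (N + 2), (s ^ m / m.factorial) • φ m 0)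
        (φ 1 s - ∑ m ∈ Finset.range (N + 1), (s ^ m / m.factorial) • φ (m + 1) 0) (Icc 0 t) s := by
      intro s hs
      have h2 : HasDerivAt (fun s : ℝ => ∑ m ∈ Finset.range (N + 2),
          (s ^ m / m.factorial) • φ m 0)
          (∑ m ∈ Finset.range (N + 1), (s ^ m / m.factorial) • φ (m + 1) 0) s := by
        simp only [Finset.sum_range_succ' _ (N + 1)]
        have h3 : HasDerivAt (fun s : ℝ => ∑ m ∈ Finset.range (N + 1),
            (s ^ (m + 1) / (m + 1).factorial) • φ (m + 1) 0)
            (∑ m ∈ Finset.range (N + 1), (s ^ m / m.factorial) • φ (m + 1) 0) s := by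
          refine HasDerivAt.fun_sum fun m _ => ?_
          have h4 := ((hasDerivAt_pow (m + 1) s).div_const ((m + 1).factorial : ℝ)).smul_const
            (φ (m + 1) 0)
          convert h4 using 2
          rw [Nat.factorial_succ]
          have : (m.factorial : ℝ) ≠ 0 := by positivity
          have : (m : ℝ) + 1 ≠ 0 := by positivity
          push_cast
          field_simp
        simpa using h3.add_const (((s : ℝ) ^ 0 / (Nat.factorial 0 : ℝ)) • φ 0 0)
      exact ((hd 0 (by omega) s ⟨hs.1, hs.2.trans_lt ht.2⟩).sub h2).hasDerivWithinAt
    have h5 := norm_image_sub_le_of_norm_deriv_le_segment' hder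
      (fun s hs => h1 s ⟨hs.1, hs.2.trans ht.2⟩) t (right_mem_Icc.2 ht.1)
    have h0 : φ 0 0 - ∑ m ∈ Finset.range (N + 2), ((0 : ℝ) ^ m / m.factorial) • φ m 0 = 0 := by
      simp [Finset.sum_range_succ' _ (N + 1)]
    simp only [h0, sub_zero] at h5
    exact h5.trans (mul_le_of_le_one_right hM0 ht.2.le)

variable {d : ℕ} {G : Type} [NormedAddCommGroup G] [NormedSpace ℝ G]

/-- The expansion point lies in the open set, but `y` may be a node on the boundary, where no
derivative need exist. The bound is proved along the half-open segment and passes to its end by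
continuity. -/
theorem norm_sub_taylor_le {U : Set (E d)} (hU : Convex ℝ U) {n : ℕ} {f : E d → G} {A c : ℝ}
    (hd : ∀ x ∈ U, DifferentiableAt ℝ f x) (h : SClass U n (fderiv ℝ f) A c) {x y : E d}
    (hA : 0 ≤ A) (hc : 0 ≤ c)
    (hxy : ∀ t ∈ Ico (0 : ℝ) 1, x + t • (y - x) ∈ U)
    (hcont : ContinuousOn (fun t : ℝ => f (x + t • (y - x))) (Icc 0 1)) :
    ‖f y - ∑ m ∈ Finset.range (n + 2), ((m.factorial : ℝ)⁻¹) •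
      iteratedFDeriv ℝ m f x (fun _ => y - x)‖ ≤ A * c ^ (n + 1) * ‖y - x‖ ^ (n + 2) := by
  obtain ⟨h1, h2⟩ := jet_of_sClass_fderiv hd h
  set w := y - x with hw
  have hx : x ∈ U := by simpa using hxy 0 ⟨le_rfl, one_pos⟩
  have key := norm_sub_taylor_sum_le (n + 1)
    (φ := fun m t => iteratedFDeriv ℝ m f (x + t • w) (fun _ => w))
    (M := A * c ^ (n + 1) * ‖w‖ ^ (n + 2)) ?_ ?_
  · simp only [zero_smul, add_zero, iteratedFDeriv_zero_apply] at key
    have ht : Tendsto (fun t : ℝ => ‖f (x + t • w) - ∑ m ∈ Finset.range (n + 2),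
        (t ^ m / m.factorial) • iteratedFDeriv ℝ m f x (fun _ => w)‖) (𝓝[<] 1)
        (𝓝 ‖f y - ∑ m ∈ Finset.range (n + 2),
          ((m.factorial : ℝ)⁻¹) • iteratedFDeriv ℝ m f x (fun _ => w)‖) := by
      have hc1 : ContinuousOn (fun t : ℝ => ‖f (x + t • w) - ∑ m ∈ Finset.range (n + 2),
        (t ^ m / m.factorial) • iteratedFDeriv ℝ m f x (fun _ => w)‖) (Icc 0 1) :=
        (hcont.sub (by fun_prop)).norm
      have h3 := (hc1 1 (right_mem_Icc.2 zero_le_one)).tendsto.mono_left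
        (nhdsWithin_mono (1 : ℝ) Ico_subset_Icc_self)
      rw [nhdsWithin_Ico_eq_nhdsLT one_pos] at h3
      simpa [hw] using h3
    refine le_of_tendsto ht ?_
    filter_upwards [Ico_mem_nhdsLT (one_pos : (0 : ℝ) < 1)] with t ht
    exact key t ht
  · intro m hm t ht
    have h3 := (h1 m (by omega) _ (hxy t ht)).hasFDerivAt
    have h4 : HasDerivAt (fun t : ℝ => x + t • w) w t := by
      simpa using ((hasDerivAt_id t).smul_const w).const_add x
    have h5 := h3.comp_hasDerivAt t h4
    have h6 := ((ContinuousMultilinearMap.apply ℝ (fun _ : Fin m => E d) G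
      (fun _ => w)).hasFDerivAt).comp_hasDerivAt t h5
    exact h6
  · intro t ht
    have h3 := h2.norm_sub_le_of_convex hU hx (hxy t ht)
    have h4 : ‖iteratedFDeriv ℝ (n + 1) f (x + t • w) (fun _ => w) -
        iteratedFDeriv ℝ (n + 1) f x (fun _ => w)‖ ≤
        ‖iteratedFDeriv ℝ (n + 1) f (x + t • w) - iteratedFDeriv ℝ (n + 1) f x‖ *
          ‖w‖ ^ (n + 1) := by
      have := (iteratedFDeriv ℝ (n + 1) f (x + t • w) -
        iteratedFDeriv ℝ (n + 1) f x).le_opNorm (fun _ => w)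
      simpa using this
    have h5 : ‖x + t • w - x‖ ≤ ‖w‖ := by
      rw [add_sub_cancel_left, norm_smul, Real.norm_of_nonneg ht.1]
      exact mul_le_of_le_one_left (norm_nonneg _) ht.2.le
    simp only [zero_smul, add_zero]
    calc _ ≤ _ := h4
      _ ≤ (A * c ^ (n + 1) * ‖w‖) * ‖w‖ ^ (n + 1) := by
        gcongr
        exact h3.trans (by gcongr)
      _ = _ := by ring

end Taylor

/-! ### Geometry of the reference simplex -/

section RefSimplex

variable {d : ℕ}

@[simp] theorem bary_zero (x : E d) : bary x 0 = 1 - ∑ j, x j := rfl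

@[simp] theorem bary_succ (x : E d) (j : Fin d) : bary x j.succ = x j := rfl

theorem sum_bary (x : E d) : ∑ s, bary x s = 1 := by
  simp [Fin.sum_univ_succ]

theorem continuous_bary (s : Fin (d + 1)) : Continuous fun x : E d => bary x s := by
  refine Fin.cases ?_ (fun j => ?_) s
  · simp only [bary_zero]; fun_prop
  · simp only [bary_succ]; fun_prop

theorem bary_add_smul_sub (x y : E d) (t : ℝ) (s : Fin (d + 1)) :
    bary (x + t • (y - x)) s = (1 - t) * bary x s + t * bary y s := by
  refine Fin.cases ?_ (fun j => ?_) s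
  · simp only [bary_zero, PiLp.add_apply, PiLp.smul_apply, PiLp.sub_apply, smul_eq_mul,
      Finset.sum_add_distrib, ← Finset.mul_sum, Finset.sum_sub_distrib]
    ring
  · simp only [bary_succ, PiLp.add_apply, PiLp.smul_apply, PiLp.sub_apply, smul_eq_mul]
    ring

theorem isClosed_refSimplex : IsClosed (refSimplex d) := by
  simp only [refSimplex, ofPred_forall]
  exact isClosed_iInter fun s => isClosed_le continuous_const (continuous_bary s)

theorem convex_refSimplex : Convex ℝ (refSimplex d) := by
  rw [convex_iff_add_mem]
  intro x hx y hy a b ha hb hab s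
  have h : a • x + b • y = x + b • (y - x) := by
    rw [← eq_sub_iff_add_eq] at hab; rw [hab]; module
  rw [h, bary_add_smul_sub]
  have := hx s; have := hy s
  have h1 : (1 : ℝ) - b = a := by linarith
  rw [h1]; positivity

theorem norm_le_one_of_mem_refSimplex {x : E d} (hx : x ∈ refSimplex d) : ‖x‖ ≤ 1 := by
  have h0 : ∑ j, x j ≤ 1 := by have := hx 0; simp at this; linarith
  have hj : ∀ j, 0 ≤ x j := fun j => by simpa using hx j.succ
  rw [EuclideanSpace.norm_eq, Real.sqrt_le_one]
  refine le_trans (Finset.sum_le_sum fun j _ => ?_) h0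
  have : x j ≤ 1 := (Finset.single_le_sum (fun i _ => hj i) (Finset.mem_univ j)).trans h0
  rw [Real.norm_of_nonneg (hj j)]
  nlinarith [hj j]

theorem norm_sub_le_two_of_mem_refSimplex {x y : E d} (hx : x ∈ refSimplex d)
    (hy : y ∈ refSimplex d) : ‖y - x‖ ≤ 2 := by
  have := norm_sub_le y x
  have := norm_le_one_of_mem_refSimplex hx
  have := norm_le_one_of_mem_refSimplex hy
  linarith

theorem isCompact_refSimplex : IsCompact (refSimplex d) :=
  Metric.isCompact_of_isClosed_isBounded isClosed_refSimplex
    ((Metric.isBounded_iff_subset_closedBall 0).2 ⟨1, fun x hx => by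
      simpa using norm_le_one_of_mem_refSimplex hx⟩)

theorem zero_mem_refSimplex : (0 : E d) ∈ refSimplex d := by
  intro s
  refine Fin.cases ?_ (fun j => ?_) s <;> simp

theorem refNode_apply (p : ℕ) (a : Fin (d + 1) → ℕ) (j : Fin d) :
    refNode p a j = (a j.succ : ℝ) / p := rfl

theorem bary_refNode {p : ℕ} (hp : 1 ≤ p) {a : Fin (d + 1) → ℕ} (ha : ∑ s, a s = p)
    (s : Fin (d + 1)) : bary (refNode p a : E d) s = (a s : ℝ) / p := by
  have hp' : (p : ℝ) ≠ 0 := by positivity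
  refine Fin.cases ?_ (fun j => ?_) s
  · simp only [bary_zero, refNode_apply]
    rw [Fin.sum_univ_succ] at ha
    rw [← Finset.sum_div, ← Nat.cast_sum, eq_div_iff hp', sub_mul, div_mul_cancel₀ _ hp',
      ← ha]
    push_cast; ring
  · rw [bary_succ, refNode_apply]

theorem refNode_mem_refSimplex {p : ℕ} (hp : 1 ≤ p) {a : Fin (d + 1) → ℕ} (ha : ∑ s, a s = p) :
    (refNode p a : E d) ∈ refSimplex d := fun s => by
  rw [bary_refNode hp ha]; positivity

theorem isOpen_bary_pos : IsOpen {x : E d | ∀ s, 0 < bary x s} := by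
  simp only [ofPred_forall]
  exact isOpen_iInter_of_finite fun s => isOpen_lt continuous_const (continuous_bary s)

theorem interior_refSimplex (hd : 1 ≤ d) :
    interior (refSimplex d) = {x : E d | ∀ s, 0 < bary x s} := by
  refine Subset.antisymm (fun x hx s => ?_)
    (interior_maximal (fun x hx s => (hx s).le) isOpen_bary_pos)
  -- A direction that lowers the barycentric coordinate `s` at unit rate: an interior point can be
  -- moved along it, so this coordinate must be positive.
  obtain ⟨w, hw⟩ : ∃ w : E d, ∀ t : ℝ, bary (x + t • w) s = bary x s - t := by
    refine Fin.cases ⟨e ⟨0, hd⟩, fun t => ?_⟩ (fun j => ⟨-e j, fun t => ?_⟩) s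
    · simp [e, Finset.sum_add_distrib]; ring
    · simp [e]; ring
  have h1 : ContinuousAt (fun t : ℝ => x + t • w) 0 := by fun_prop
  have h2 : ∀ᶠ t : ℝ in 𝓝 0, x + t • w ∈ refSimplex d := by
    refine h1.eventually_mem ?_
    simpa using mem_interior_iff_mem_nhds.1 hx
  obtain ⟨r, hr, h3⟩ := Metric.eventually_nhds_iff.1 h2
  have h4 := h3 (y := r / 2) (by simp [abs_of_pos hr, hr]) s
  rw [hw] at h4
  linarith

theorem add_smul_sub_mem_interior_refSimplex (hd : 1 ≤ d) {x y : E d}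
    (hx : x ∈ interior (refSimplex d)) (hy : y ∈ refSimplex d) {t : ℝ} (ht : t ∈ Ico (0 : ℝ) 1) :
    x + t • (y - x) ∈ interior (refSimplex d) := by
  rw [interior_refSimplex hd] at hx ⊢
  intro s
  rw [bary_add_smul_sub]
  have := hx s; have := hy s
  have : 0 < 1 - t := by linarith [ht.2]
  have := ht.1
  positivity

theorem nonempty_interior_refSimplex (hd : 1 ≤ d) : (interior (refSimplex d)).Nonempty := by
  refine ⟨WithLp.toLp 2 fun _ => ((d : ℝ) + 1)⁻¹, ?_⟩
  rw [interior_refSimplex hd]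
  intro s
  refine Fin.cases ?_ (fun j => ?_) s
  · simp only [bary_zero, Finset.sum_const, Finset.card_univ, Fintype.card_fin, nsmul_eq_mul]
    rw [sub_pos, ← div_eq_mul_inv, div_lt_one (by positivity)]
    linarith
  · simp only [bary_succ]; positivity

theorem closure_interior_refSimplex (hd : 1 ≤ d) :
    closure (interior (refSimplex d)) = refSimplex d := by
  rw [convex_refSimplex.closure_interior_eq_closure_of_nonempty_interior
    (nonempty_interior_refSimplex hd), isClosed_refSimplex.closure_eq]

theorem volume_refSimplex_diff_interior :
    volume (refSimplex d \ interior (refSimplex d)) = 0 := by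
  have := convex_refSimplex.addHaar_frontier (volume : Measure (E d)) (s := refSimplex d)
  rwa [frontier, isClosed_refSimplex.closure_eq] at this

/-- A continuous function on the reference simplex with a locally uniform Lipschitz constant in
the interior is Lipschitz. -/
theorem norm_sub_le_of_locLip_refSimplex (hd : 1 ≤ d) {G : Type*} [NormedAddCommGroup G]
    {f : E d → G} {M : ℝ} (hc : ContinuousOn f (refSimplex d))
    (hf : LocLip (interior (refSimplex d)) f M) (hM : 0 ≤ M) {x y : E d}
    (hx : x ∈ refSimplex d) (hy : y ∈ refSimplex d) : ‖f y - f x‖ ≤ M * ‖y - x‖ := by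
  have h1 : LipschitzOnWith ⟨M, hM⟩ f (interior (refSimplex d)) :=
    LipschitzOnWith.of_dist_le_mul fun y hy x hx => by
      rw [dist_eq_norm, dist_eq_norm]
      exact hf.norm_sub_le_of_convex convex_refSimplex.interior hx hy
  rw [← closure_interior_refSimplex hd] at hc hx hy
  exact ((lipschitzOnWith_closure_iff hc).2 h1).norm_sub_le hy hx

end RefSimplex

/-! ### Lagrange basis and unisolvence -/

section Lagrange

variable {d : ℕ}

/-- The indices of the nodes of degree `p`. -/
abbrev nodeIdx (d p : ℕ) : Finset (Fin (d + 1) → ℕ) :=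
  Finset.piAntidiag (Finset.univ : Finset (Fin (d + 1))) p

theorem mem_nodeIdx {p : ℕ} {a : Fin (d + 1) → ℕ} : a ∈ nodeIdx d p ↔ ∑ s, a s = p := by
  simp [nodeIdx]

/-- The exponent of the monomial with the index `a`. -/
def exponent (a : Fin (d + 1) → ℕ) : Fin d →₀ ℕ := Finsupp.equivFunOnFinite.symm (Fin.tail a)

@[simp] theorem exponent_apply (a : Fin (d + 1) → ℕ) (j : Fin d) : exponent a j = a j.succ := rfl

theorem exponent_injOn (p : ℕ) : Set.InjOn (exponent (d := d)) (nodeIdx d p) := by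
  intro a ha b hb hab
  have h1 : ∀ j : Fin d, a j.succ = b j.succ := fun j => DFunLike.congr_fun hab j
  rw [Finset.mem_coe, mem_nodeIdx, Fin.sum_univ_succ] at ha hb
  have h2 : ∑ j : Fin d, a j.succ = ∑ j : Fin d, b j.succ := Finset.sum_congr rfl fun j _ => h1 j
  funext s
  refine Fin.cases (by omega) h1 s

theorem mem_image_exponent {p : ℕ} {s : Fin d →₀ ℕ} (hs : ∑ j, s j ≤ p) :
    s ∈ (nodeIdx d p).image exponent := by
  refine Finset.mem_image.2 ⟨Fin.cons (p - ∑ j, s j) s, ?_, ?_⟩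
  · rw [mem_nodeIdx, Fin.sum_univ_succ]; simp; omega
  · ext j; simp

theorem sum_le_of_mem_support {R : Type*} [CommSemiring R] {p : ℕ} {q : MvPolynomial (Fin d) R}
    (hq : q.totalDegree ≤ p) {s : Fin d →₀ ℕ} (hs : s ∈ q.support) : ∑ j, s j ≤ p := by
  have := MvPolynomial.le_totalDegree hs
  rw [Finsupp.sum_fintype _ _ (fun _ => rfl)] at this
  exact this.trans hq

/-- Dropping slot `0` turns node indices into exponents of degree at most `p`. Nodes and monomials
thus share one index set, which makes the evaluation matrix square. -/
theorem eval_eq_sum_nodeIdx {R : Type*} [CommSemiring R] {p : ℕ} {q : MvPolynomial (Fin d) R}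
    (hq : q.totalDegree ≤ p) (x : Fin d → R) : MvPolynomial.eval x q =
      ∑ b ∈ nodeIdx d p, q.coeff (exponent b) * ∏ j, x j ^ b j.succ := by
  classical
  rw [MvPolynomial.eval_eq', Finset.sum_subset (s₂ := (nodeIdx d p).image exponent)
    (fun s hs => mem_image_exponent (sum_le_of_mem_support hq hs))
    (fun s _ hs => by rw [MvPolynomial.notMem_support_iff.1 hs, zero_mul]),
    Finset.sum_image (exponent_injOn p)]
  rfl

theorem lagrange_refNode_self {p : ℕ} (hp : 1 ≤ p) {a : Fin (d + 1) → ℕ} (ha : a ∈ nodeIdx d p) :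
    lagrange p a (refNode p a : E d) = 1 := by
  have hp' : (p : ℝ) ≠ 0 := by positivity
  refine Finset.prod_eq_one fun s _ => ?_
  rw [bary_refNode hp (mem_nodeIdx.1 ha), mul_div_cancel₀ _ hp', Finset.prod_div_distrib,
    div_eq_one_iff_eq (Finset.prod_ne_zero_iff.2 fun m _ => by positivity),
    ← Finset.prod_range_reflect]
  refine Finset.prod_congr rfl fun m hm => ?_
  rw [Finset.mem_range] at hm
  rw [Nat.cast_sub (by omega), Nat.cast_sub (by omega)]
  push_cast; ring

theorem lagrange_refNode_of_ne {p : ℕ} (hp : 1 ≤ p) {a b : Fin (d + 1) → ℕ}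
    (ha : a ∈ nodeIdx d p) (hb : b ∈ nodeIdx d p) (hab : a ≠ b) :
    lagrange p a (refNode p b : E d) = 0 := by
  have hp' : (p : ℝ) ≠ 0 := by positivity
  -- Both indices sum to `p`, so they cannot differ without such an `s`; the factor with `m = b s`
  -- then vanishes at the node of `b`.
  obtain ⟨s, hs⟩ : ∃ s, b s < a s := by
    by_contra! h
    refine hab (funext fun s => ?_)
    have h1 : ∑ s, a s = ∑ s, b s := (mem_nodeIdx.1 ha).trans (mem_nodeIdx.1 hb).symm
    exact (Finset.sum_eq_sum_iff_of_le fun s _ => h s).1 h1 s (Finset.mem_univ s)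
  refine Finset.prod_eq_zero (Finset.mem_univ s) (Finset.prod_eq_zero (Finset.mem_range.2 hs) ?_)
  rw [bary_refNode hp (mem_nodeIdx.1 hb), mul_div_cancel₀ _ hp', sub_self, zero_div]

/-- The barycentric coordinates as polynomials. -/
def baryPoly (s : Fin (d + 1)) : MvPolynomial (Fin d) ℝ :=
  Fin.cases (1 - ∑ j, MvPolynomial.X j) (fun j => MvPolynomial.X j) s

theorem eval_baryPoly (s : Fin (d + 1)) (x : E d) :
    MvPolynomial.eval (fun j => x j) (baryPoly s) = bary x s := by
  refine Fin.cases ?_ (fun j => ?_) s <;> simp [baryPoly]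

theorem totalDegree_baryPoly_le (s : Fin (d + 1)) :
    (baryPoly s : MvPolynomial (Fin d) ℝ).totalDegree ≤ 1 := by
  refine Fin.cases ?_ (fun j => ?_) s
  · simp only [baryPoly, Fin.cases_zero]
    refine (MvPolynomial.totalDegree_sub _ _).trans (max_le (by simp) ?_)
    exact MvPolynomial.totalDegree_finsetSum_le fun j _ => by simp
  · simp [baryPoly]

/-- The Lagrange basis functions as polynomials. -/
def lagrangePoly (p : ℕ) (a : Fin (d + 1) → ℕ) : MvPolynomial (Fin d) ℝ :=
  ∏ s, ∏ m ∈ Finset.range (a s), (MvPolynomial.C (p : ℝ) * baryPoly s - MvPolynomial.C (m : ℝ)) *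
    MvPolynomial.C (((m : ℝ) + 1)⁻¹)

theorem eval_lagrangePoly (p : ℕ) (a : Fin (d + 1) → ℕ) (x : E d) :
    MvPolynomial.eval (fun j => x j) (lagrangePoly p a) = lagrange p a x := by
  simp only [lagrangePoly, lagrange, map_prod, map_mul, map_sub, MvPolynomial.eval_C,
    eval_baryPoly, div_eq_mul_inv]

theorem totalDegree_lagrangePoly_le {p : ℕ} {a : Fin (d + 1) → ℕ} (ha : a ∈ nodeIdx d p) :
    (lagrangePoly p a : MvPolynomial (Fin d) ℝ).totalDegree ≤ p := by
  rw [← mem_nodeIdx.1 ha]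
  refine (MvPolynomial.totalDegree_finsetProd _ _).trans (Finset.sum_le_sum fun s _ => ?_)
  refine (MvPolynomial.totalDegree_finsetProd _ _).trans ?_
  refine (Finset.sum_le_sum (g := fun _ => 1) fun m _ => ?_).trans (by simp)
  refine (MvPolynomial.totalDegree_mul _ _).trans ?_
  rw [MvPolynomial.totalDegree_C, add_zero]
  refine (MvPolynomial.totalDegree_sub _ _).trans (max_le ?_ ?_)
  swap
  · rw [MvPolynomial.totalDegree_C]; exact zero_le_one
  refine (MvPolynomial.totalDegree_mul _ _).trans ?_
  rw [MvPolynomial.totalDegree_C, zero_add]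
  exact totalDegree_baryPoly_le s

theorem contDiff_eval (q : MvPolynomial (Fin d) ℂ) :
    ContDiff ℝ ∞ (fun x : E d => MvPolynomial.eval (fun j => ((x j : ℝ) : ℂ)) q) := by
  simp only [MvPolynomial.eval_eq']
  refine ContDiff.sum fun s _ => contDiff_const.mul (contDiff_prod fun j _ => ContDiff.pow ?_ _)
  have h : ContDiff ℝ ∞ fun x : E d => x j := by fun_prop
  exact Complex.ofRealCLM.contDiff.comp h

theorem contDiff_bary (s : Fin (d + 1)) : ContDiff ℝ ∞ fun x : E d => bary x s := by
  refine Fin.cases ?_ (fun j => ?_) s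
  · simp only [bary_zero]; fun_prop
  · simp only [bary_succ]; fun_prop

theorem contDiff_lagrange (p : ℕ) (a : Fin (d + 1) → ℕ) :
    ContDiff ℝ ∞ (lagrange p a : E d → ℝ) := by
  unfold lagrange
  exact contDiff_prod fun s _ => contDiff_prod fun m _ =>
    ((contDiff_const.mul (contDiff_bary s)).sub contDiff_const).div_const _

/-- A polynomial of degree at most `p` vanishes if it vanishes at all nodes. -/
theorem eval_eq_zero_of_nodes {p : ℕ} (hp : 1 ≤ p) {q : MvPolynomial (Fin d) ℝ}
    (hq : q.totalDegree ≤ p)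
    (h0 : ∀ a ∈ nodeIdx d p, MvPolynomial.eval (fun j => (refNode p a : E d) j) q = 0)
    (x : Fin d → ℝ) : MvPolynomial.eval x q = 0 := by
  let ev : (nodeIdx d p → ℝ) →ₗ[ℝ] (nodeIdx d p → ℝ) :=
    { toFun := fun c a => ∑ b, c b * ∏ j, (refNode p (a : Fin (d + 1) → ℕ) : E d) j ^
        (b : Fin (d + 1) → ℕ) j.succ
      map_add' := fun c c' => by
        funext a; simp [add_mul, Finset.sum_add_distrib]
      map_smul' := fun r c => by
        funext a; simp [Finset.mul_sum, mul_assoc] }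
  have hev : ∀ q : MvPolynomial (Fin d) ℝ, q.totalDegree ≤ p →
      ev (fun b => q.coeff (exponent b)) = fun a : nodeIdx d p => MvPolynomial.eval
        (fun j => (refNode p (a : Fin (d + 1) → ℕ) : E d) j) q := fun q hq => by
    funext a
    rw [eval_eq_sum_nodeIdx hq]
    exact Finset.sum_coe_sort (nodeIdx d p) fun b => q.coeff (exponent b) *
      ∏ j, (refNode p (a : Fin (d + 1) → ℕ) : E d) j ^ b j.succ
  -- The Lagrange polynomials are mapped to the standard basis. An endomorphism of a
  -- finite-dimensional space that is surjective is injective, which is unisolvence.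
  have hsurj : Function.Surjective ev := by
    rw [← LinearMap.range_eq_top, eq_top_iff, ← (Pi.basisFun ℝ (nodeIdx d p)).span_eq,
      Submodule.span_le]
    rintro _ ⟨a, rfl⟩
    refine ⟨_, (hev _ (totalDegree_lagrangePoly_le a.2)).trans ?_⟩
    funext b
    rw [eval_lagrangePoly, Pi.basisFun_apply, Pi.single_apply]
    split_ifs with h
    · rw [h]; exact lagrange_refNode_self hp a.2
    · exact lagrange_refNode_of_ne hp a.2 b.2 fun h' => h (Subtype.ext h'.symm)
  have hinj : Function.Injective ev := LinearMap.injective_iff_surjective.2 hsurj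
  have hc : (fun b : nodeIdx d p => q.coeff (exponent b)) = 0 := by
    apply hinj
    rw [hev q hq, map_zero]
    funext a
    exact h0 a a.2
  rw [eval_eq_sum_nodeIdx hq]
  refine Finset.sum_eq_zero fun b hb => ?_
  rw [show q.coeff (exponent b) = 0 from congrFun hc ⟨b, hb⟩, zero_mul]

theorem sum_lagrange_mul_eval {p : ℕ} (hp : 1 ≤ p) {q : MvPolynomial (Fin d) ℝ}
    (hq : q.totalDegree ≤ p) (x : E d) :
    ∑ a ∈ nodeIdx d p, lagrange p a x * MvPolynomial.eval (fun j => (refNode p a : E d) j) q =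
      MvPolynomial.eval (fun j => x j) q := by
  set r : MvPolynomial (Fin d) ℝ := ∑ a ∈ nodeIdx d p, lagrangePoly p a *
    MvPolynomial.C (MvPolynomial.eval (fun j => (refNode p a : E d) j) q) with hr
  have her : ∀ x : E d, MvPolynomial.eval (fun j => x j) r = ∑ a ∈ nodeIdx d p,
      lagrange p a x * MvPolynomial.eval (fun j => (refNode p a : E d) j) q := fun x => by
    simp only [hr, map_sum, map_mul, eval_lagrangePoly, MvPolynomial.eval_C]
  have hdr : r.totalDegree ≤ p := MvPolynomial.totalDegree_finsetSum_le fun a ha => by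
    refine (MvPolynomial.totalDegree_mul _ _).trans ?_
    rw [MvPolynomial.totalDegree_C, add_zero]
    exact totalDegree_lagrangePoly_le ha
  have h := eval_eq_zero_of_nodes (d := d) hp (q := r - q)
    ((MvPolynomial.totalDegree_sub _ _).trans (max_le hdr hq)) (fun b hb => by
      rw [map_sub, her, sub_eq_zero, Finset.sum_eq_single_of_mem b hb
        (fun a ha hab => by rw [lagrange_refNode_of_ne hp ha hb hab, zero_mul]),
        lagrange_refNode_self hp hb, one_mul]) (fun j => x j)
  rw [map_sub, her, sub_eq_zero] at h
  exact h

/-- Nodal interpolation reproduces complex polynomials of degree at most `p`. -/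
theorem refInterp_eval {p : ℕ} (hp : 1 ≤ p) {q : MvPolynomial (Fin d) ℂ} (hq : q.totalDegree ≤ p)
    (x : E d) : refInterp p (fun y => MvPolynomial.eval (fun j => ((y j : ℝ) : ℂ)) q) x =
      MvPolynomial.eval (fun j => ((x j : ℝ) : ℂ)) q := by
  -- Monomials are real, so the real reproduction identity can be cast to `ℂ` and then extended by
  -- linearity.
  have hmon : ∀ b ∈ nodeIdx d p, ∑ a ∈ nodeIdx d p, (lagrange p a x : ℂ) *
      ∏ j, (((refNode p a : E d) j : ℝ) : ℂ) ^ b j.succ = ∏ j, ((x j : ℝ) : ℂ) ^ b j.succ := by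
    intro b hb
    have h := sum_lagrange_mul_eval hp (q := MvPolynomial.monomial (exponent b) (1 : ℝ))
      ((MvPolynomial.totalDegree_monomial_le _ _).trans (by
        rw [Finsupp.sum_fintype _ _ (fun _ => rfl), ← mem_nodeIdx.1 hb, Fin.sum_univ_succ]
        simp)) x
    simp only [MvPolynomial.eval_monomial, one_mul,
      Finsupp.prod_fintype _ _ (fun _ => pow_zero _), exponent_apply] at h
    exact_mod_cast h
  simp only [refInterp, eval_eq_sum_nodeIdx hq, Finset.mul_sum]
  rw [Finset.sum_comm]
  refine Finset.sum_congr rfl fun b hb => ?_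
  rw [← hmon b hb, Finset.mul_sum]
  exact Finset.sum_congr rfl fun a _ => by ring

theorem exists_lagrange_bound (d p : ℕ) : ∃ C, 1 ≤ C ∧ ∀ a ∈ nodeIdx d p, ∀ x ∈ refSimplex d,
    |lagrange p a x| ≤ C ∧ ‖fderiv ℝ (lagrange p a) x‖ ≤ C := by
  have h : ∀ a : Fin (d + 1) → ℕ, ∃ C, ∀ x ∈ refSimplex d,
      |lagrange p a x| ≤ C ∧ ‖fderiv ℝ (lagrange p a) x‖ ≤ C := fun a => by
    obtain ⟨C₁, h₁⟩ := isCompact_refSimplex.exists_bound_of_continuousOn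
      (contDiff_lagrange p a).continuous.continuousOn (s := refSimplex d)
    obtain ⟨C₂, h₂⟩ := isCompact_refSimplex.exists_bound_of_continuousOn
      ((contDiff_lagrange (d := d) p a).continuous_fderiv (by simp)).continuousOn
      (s := refSimplex d)
    exact ⟨max C₁ C₂, fun x hx => ⟨(h₁ x hx).trans (le_max_left _ _),
      (h₂ x hx).trans (le_max_right _ _)⟩⟩
  choose C hC using h
  refine ⟨1 + ∑ a ∈ nodeIdx d p, |C a|, by
    have : 0 ≤ ∑ a ∈ nodeIdx d p, |C a| := Finset.sum_nonneg fun _ _ => abs_nonneg _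
    linarith, fun a ha x hx => ?_⟩
  have h1 : C a ≤ 1 + ∑ a ∈ nodeIdx d p, |C a| := by
    have := Finset.single_le_sum (f := fun a => |C a|) (fun _ _ => abs_nonneg _) ha
    have := le_abs_self (C a)
    linarith
  exact ⟨(hC a x hx).1.trans h1, (hC a x hx).2.trans h1⟩

end Lagrange

/-! ### Interpolation errors on the reference simplex -/

section InterpError

variable {d : ℕ}

/-- The multilinear form `T`, evaluated on the diagonal at `y - x`, as a polynomial in `y`. -/
theorem exists_poly_diag {m : ℕ} (T : E d [×m]→L[ℝ] ℝ) (x : E d) :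
    ∃ q : MvPolynomial (Fin d) ℝ, q.totalDegree ≤ m ∧
      ∀ y : E d, MvPolynomial.eval (fun j => y j) q = T (fun _ => y - x) := by
  refine ⟨∑ j : Fin m → Fin d, (∏ t, (MvPolynomial.X (j t) - MvPolynomial.C (x (j t)))) *
    MvPolynomial.C (T fun t => e (j t)), ?_, fun y => ?_⟩
  · refine MvPolynomial.totalDegree_finsetSum_le fun j _ => ?_
    refine (MvPolynomial.totalDegree_mul _ _).trans ?_
    rw [MvPolynomial.totalDegree_C, add_zero]
    refine (MvPolynomial.totalDegree_finsetProd _ _).trans ?_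
    refine (Finset.sum_le_sum (g := fun _ => 1) fun t _ => ?_).trans (by simp)
    refine (MvPolynomial.totalDegree_sub _ _).trans (max_le (by simp) ?_)
    rw [MvPolynomial.totalDegree_C]; exact zero_le_one
  · have h : T (fun _ => y - x) = T (fun _ => ∑ k, (y - x) k • e k) := by
      congr 1; funext t; exact (sum_smul_e _).symm
    rw [h, T.map_sum]
    simp only [map_sum, map_mul, map_prod, map_sub, MvPolynomial.eval_X, MvPolynomial.eval_C]
    exact Finset.sum_congr rfl fun j _ => (T.map_smul_univ _ _).symm

/-- Error of nodal interpolation of a real function of class `C^{p,1}` on the reference simplex,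
from Taylor expansions at the nodes. -/
theorem exists_interp_error (hd : 1 ≤ d) (n : ℕ) : ∃ C, 0 ≤ C ∧
    ∀ {f : E d → ℝ} {A c : ℝ}, 0 ≤ A → 0 ≤ c → ContinuousOn f (refSimplex d) →
    (∀ x ∈ interior (refSimplex d), DifferentiableAt ℝ f x) →
    SClass (interior (refSimplex d)) n (fderiv ℝ f) A c →
    ∀ x ∈ interior (refSimplex d),
      |f x - ∑ a ∈ nodeIdx d (n + 1), lagrange (n + 1) a x * f (refNode (n + 1) a)| ≤
        C * (A * c ^ (n + 1)) ∧
      ‖fderiv ℝ (fun z => f z - ∑ a ∈ nodeIdx d (n + 1),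
        lagrange (n + 1) a z * f (refNode (n + 1) a)) x‖ ≤ C * (A * c ^ (n + 1)) := by
  obtain ⟨CL, hCL1, hCL⟩ := exists_lagrange_bound d (n + 1)
  refine ⟨(nodeIdx d (n + 1)).card * (CL * 2 ^ (n + 2)), by positivity, ?_⟩
  intro f A c hA hc hf hdf hS x hx
  set N := nodeIdx d (n + 1) with hN
  have hxT : x ∈ refSimplex d := interior_subset hx
  choose Q hQd hQe using fun m : ℕ => exists_poly_diag (iteratedFDeriv ℝ m f x) x
  -- The Taylor polynomial of `f` of degree `n + 1` at the very point `x` where the error is to be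
  -- estimated; `R` below is the Taylor remainder at the nodes.
  set q : MvPolynomial (Fin d) ℝ := ∑ m ∈ Finset.range (n + 2),
    MvPolynomial.C ((m.factorial : ℝ)⁻¹) * Q m with hq
  have hqe : ∀ y : E d, MvPolynomial.eval (fun j => y j) q = ∑ m ∈ Finset.range (n + 2),
      ((m.factorial : ℝ)⁻¹) • iteratedFDeriv ℝ m f x (fun _ => y - x) := fun y => by
    simp only [hq, map_sum, map_mul, MvPolynomial.eval_C, hQe, smul_eq_mul]
  have hqd : q.totalDegree ≤ n + 1 := MvPolynomial.totalDegree_finsetSum_le fun m hm => by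
    refine (MvPolynomial.totalDegree_mul _ _).trans ?_
    rw [MvPolynomial.totalDegree_C, zero_add]
    exact (hQd m).trans (by simpa [Nat.lt_succ_iff] using hm)
  set R : (Fin (d + 1) → ℕ) → ℝ := fun a => f (refNode (n + 1) a) -
    MvPolynomial.eval (fun j => (refNode (n + 1) a : E d) j) q with hR
  have hRle : ∀ a ∈ N, |R a| ≤ A * c ^ (n + 1) * 2 ^ (n + 2) := fun a ha => by
    have hmem := refNode_mem_refSimplex (d := d) (Nat.succ_le_succ n.zero_le) (mem_nodeIdx.1 ha)
    have h1 := norm_sub_taylor_le convex_refSimplex.interior hdf hS (x := x)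
      (y := refNode (n + 1) a) hA hc
      (fun t ht => add_smul_sub_mem_interior_refSimplex hd hx hmem ht)
      (hf.comp (by fun_prop) fun t ht => convex_refSimplex.add_smul_sub_mem hxT hmem ht)
    rw [← hqe] at h1
    refine h1.trans ?_
    gcongr
    exact norm_sub_le_two_of_mem_refSimplex hxT hmem
  -- Since `q` is reproduced, the interpolant of `f` is `q` plus the interpolant of the remainders.
  -- At `x`, where `f - q` vanishes together with its gradient, only the remainders at the nodes are
  -- left.
  have hr : ∀ z : E d, f z - ∑ a ∈ N, lagrange (n + 1) a z * f (refNode (n + 1) a) =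
      f z - MvPolynomial.eval (fun j => z j) q - ∑ a ∈ N, lagrange (n + 1) a z * R a := by
    intro z
    rw [← sum_lagrange_mul_eval (Nat.succ_le_succ n.zero_le) hqd z]
    simp only [hR, mul_sub, Finset.sum_sub_distrib]
    ring
  have hq0 : MvPolynomial.eval (fun j => x j) q = f x := by
    rw [hqe, Finset.sum_range_succ', Finset.sum_eq_zero fun m _ => ?_]
    · simp
    · have h0 : iteratedFDeriv ℝ (m + 1) f x (fun _ => x - x) = 0 :=
        ContinuousMultilinearMap.map_coord_zero _ (0 : Fin (m + 1)) (sub_self x)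
      rw [h0, smul_zero]
  have hq1 : HasFDerivAt (fun z : E d => MvPolynomial.eval (fun j => z j) q) (fderiv ℝ f x) x := by
    simp only [hqe]
    -- Taylor terms of order at least two do not contribute to the gradient at `x`.
    have hterm : ∀ m ∈ Finset.range n, HasFDerivAt (fun y : E d =>
        (((m + 2).factorial : ℝ)⁻¹) • iteratedFDeriv ℝ (m + 2) f x (fun _ => y - x)) (0 : E d →L[ℝ] ℝ) x := by
      intro m _
      refine Asymptotics.IsBigO.hasFDerivAt (n := m + 2) ?_ (by omega)
      refine Asymptotics.IsBigO.of_bound (((m + 2).factorial : ℝ)⁻¹ *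
        ‖iteratedFDeriv ℝ (m + 2) f x‖) (Eventually.of_forall fun y => ?_)
      have h1 := (iteratedFDeriv ℝ (m + 2) f x).le_opNorm (fun _ => y - x)
      simp only [Finset.prod_const, Finset.card_univ, Fintype.card_fin] at h1
      rw [norm_smul, norm_pow, norm_norm, mul_assoc, norm_inv, Real.norm_natCast]
      gcongr
    have h1 := HasFDerivAt.fun_sum hterm
    have h2 : HasFDerivAt (fun y : E d => fderiv ℝ f x (y - x) + f x) (fderiv ℝ f x) x := by
      have := ((fderiv ℝ f x).hasFDerivAt (x := x)).sub_const (fderiv ℝ f x x)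
      simpa only [map_sub] using this.add_const (f x)
    have h3 := h1.add h2
    rw [Finset.sum_const_zero, zero_add] at h3
    refine h3.congr_of_eventuallyEq (Eventually.of_forall fun y => ?_)
    dsimp only
    rw [Finset.sum_range_succ', Finset.sum_range_succ']
    simp [iteratedFDeriv_one_apply, add_assoc]
  have hsum : ∀ g : (Fin (d + 1) → ℕ) → ℝ, (∀ a ∈ N, |g a| ≤ CL) →
      ∑ a ∈ N, |g a| * |R a| ≤ N.card * (CL * 2 ^ (n + 2)) * (A * c ^ (n + 1)) := fun g hg => by
    calc ∑ a ∈ N, |g a| * |R a| ≤ ∑ a ∈ N, CL * (A * c ^ (n + 1) * 2 ^ (n + 2)) :=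
          Finset.sum_le_sum fun a ha => mul_le_mul (hg a ha) (hRle a ha) (abs_nonneg _)
            (by linarith)
      _ = _ := by rw [Finset.sum_const, nsmul_eq_mul]; ring
  constructor
  · rw [hr, hq0, sub_self, zero_sub, abs_neg]
    refine (Finset.abs_sum_le_sum_abs _ _).trans ?_
    simp only [abs_mul]
    exact hsum (fun a => lagrange (n + 1) a x) fun a ha => (hCL a ha x hxT).1
  · simp only [hr]
    have h1 : HasFDerivAt (fun z : E d => ∑ a ∈ N, lagrange (n + 1) a z * R a)
        (∑ a ∈ N, R a • fderiv ℝ (lagrange (n + 1) a) x) x :=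
      HasFDerivAt.fun_sum fun a _ =>
        (((contDiff_lagrange (n + 1) a).differentiable (by simp)) x).hasFDerivAt.mul_const (R a)
    have h2 := (((hdf x hx).hasFDerivAt.sub hq1).sub h1).fderiv
    have h3 : fderiv ℝ (fun z => f z - MvPolynomial.eval (fun j => z j) q -
        ∑ a ∈ N, lagrange (n + 1) a z * R a) x = fderiv ℝ f x - fderiv ℝ f x -
        ∑ a ∈ N, R a • fderiv ℝ (lagrange (n + 1) a) x := h2
    rw [h3, sub_self, zero_sub, norm_neg]
    refine (norm_sum_le _ _).trans ?_
    have h4 := hsum (fun a => ‖fderiv ℝ (lagrange (n + 1) a) x‖) fun a ha => by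
      rw [abs_norm]; exact (hCL a ha x hxT).2
    refine le_trans (le_of_eq (Finset.sum_congr rfl fun a _ => ?_)) h4
    rw [norm_smul, abs_norm, Real.norm_eq_abs, mul_comm]

theorem refInterp_add (p : ℕ) (f g : E d → ℂ) (x : E d) :
    refInterp p (fun y => f y + g y) x = refInterp p f x + refInterp p g x := by
  simp only [refInterp, mul_add, Finset.sum_add_distrib]

theorem refInterp_const_mul (p : ℕ) (c : ℂ) (f : E d → ℂ) (x : E d) :
    refInterp p (fun y => c * f y) x = c * refInterp p f x := by
  simp only [refInterp, Finset.mul_sum]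
  exact Finset.sum_congr rfl fun _ _ => by ring

theorem refInterp_congr {p : ℕ} (hp : 1 ≤ p) {f g : E d → ℂ} (h : EqOn f g (refSimplex d))
    (x : E d) : refInterp p f x = refInterp p g x :=
  Finset.sum_congr rfl fun _ ha => by
    rw [h (refNode_mem_refSimplex hp (mem_nodeIdx.1 ha))]

theorem contDiff_refInterp (p : ℕ) (f : E d → ℂ) : ContDiff ℝ ∞ (refInterp p f) := by
  unfold refInterp
  refine ContDiff.sum fun a _ => ContDiff.mul ?_ contDiff_const
  exact Complex.ofRealCLM.contDiff.comp (contDiff_lagrange p a)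

theorem refInterp_bound {p : ℕ} (hp : 1 ≤ p) {CL : ℝ}
    (hCL : ∀ a ∈ nodeIdx d p, ∀ x ∈ refSimplex d,
      |lagrange p a x| ≤ CL ∧ ‖fderiv ℝ (lagrange p a) x‖ ≤ CL)
    {f : E d → ℂ} {B : ℝ} (hf : ∀ x ∈ refSimplex d, ‖f x‖ ≤ B) {x : E d}
    (hx : x ∈ refSimplex d) : ‖refInterp p f x‖ ≤ (nodeIdx d p).card * (CL * B) ∧
      ‖fderiv ℝ (refInterp p f) x‖ ≤ (nodeIdx d p).card * (CL * B) := by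
  have hB : 0 ≤ B := (norm_nonneg _).trans (hf x hx)
  have hn : ∀ a ∈ nodeIdx d p, ‖f (refNode p a)‖ ≤ B := fun a ha =>
    hf _ (refNode_mem_refSimplex hp (mem_nodeIdx.1 ha))
  constructor
  · refine (norm_sum_le _ _).trans ?_
    rw [← nsmul_eq_mul, ← Finset.sum_const]
    refine Finset.sum_le_sum fun a ha => ?_
    rw [norm_mul, Complex.norm_real]
    exact mul_le_mul (hCL a ha x hx).1 (hn a ha) (norm_nonneg _)
      ((abs_nonneg _).trans (hCL a ha x hx).1)
  · have h1 : HasFDerivAt (refInterp p f) (∑ a ∈ nodeIdx d p,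
        f (refNode p a) • (Complex.ofRealCLM.comp (fderiv ℝ (lagrange p a) x))) x := by
      refine HasFDerivAt.fun_sum fun a _ => ?_
      have h2 := (((contDiff_lagrange p a).differentiable (by simp)) x).hasFDerivAt
      have h3 := Complex.ofRealCLM.hasFDerivAt.comp x h2
      exact h3.mul_const (f (refNode p a))
    rw [h1.fderiv]
    refine (norm_sum_le _ _).trans ?_
    rw [← nsmul_eq_mul, ← Finset.sum_const]
    refine Finset.sum_le_sum fun a ha => ?_
    rw [norm_smul, mul_comm]
    refine mul_le_mul ?_ (hn a ha) (norm_nonneg _) ((abs_nonneg _).trans (hCL a ha x hx).1)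
    refine (ContinuousLinearMap.opNorm_comp_le _ _).trans ?_
    rw [Complex.ofRealCLM_norm, one_mul]
    exact (hCL a ha x hx).2

/-- Super-approximation on the reference simplex. -/
theorem exists_ref_superapprox (hd : 1 ≤ d) (n : ℕ) : ∃ C, 0 ≤ C ∧
    ∀ {f : E d → ℝ} {A c Q₀ Q₁ : ℝ} {q : MvPolynomial (Fin d) ℂ}, 0 ≤ A → 0 ≤ c →
    ContinuousOn f (refSimplex d) → (∀ x ∈ interior (refSimplex d), DifferentiableAt ℝ f x) →
    SClass (interior (refSimplex d)) n (fderiv ℝ f) A c → q.totalDegree ≤ n + 1 →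
    (∀ x ∈ refSimplex d, ‖MvPolynomial.eval (fun j => ((x j : ℝ) : ℂ)) q‖ ≤ Q₀) →
    (∀ x ∈ refSimplex d,
      ‖fderiv ℝ (fun y : E d => MvPolynomial.eval (fun j => ((y j : ℝ) : ℂ)) q) x‖ ≤ Q₁) →
    ∀ r : E d → ℂ, (∀ x, r x = f x * MvPolynomial.eval (fun j => ((x j : ℝ) : ℂ)) q -
      refInterp (n + 1) (fun y => f y * MvPolynomial.eval (fun j => ((y j : ℝ) : ℂ)) q) x) →
    ∀ x ∈ interior (refSimplex d), DifferentiableAt ℝ r x ∧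
      ‖r x‖ ≤ C * (A * Q₁ + A * c ^ (n + 1) * Q₀) ∧
      ‖fderiv ℝ r x‖ ≤ C * (A * Q₁ + A * c ^ (n + 1) * Q₀) := by
  obtain ⟨CL, hCL1, hCL⟩ := exists_lagrange_bound d (n + 1)
  obtain ⟨CI, hCI0, hCI⟩ := exists_interp_error hd n
  -- The function `ψ` below and its gradient are bounded by `4 * (A * Q₁)`; the `4` accounts for
  -- `ψ`, the second summand for its interpolant.
  set κ : ℝ := 4 + (nodeIdx d (n + 1)).card * (CL * 4) with hκ
  have hκ0 : 0 ≤ κ := by positivity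
  refine ⟨max CI κ, hCI0.trans (le_max_left _ _), ?_⟩
  intro f A c Q₀ Q₁ q hA hc hf hdf hS hq hQ₀ hQ₁ r hr x hx
  set v : E d → ℂ := fun y => MvPolynomial.eval (fun j => ((y j : ℝ) : ℂ)) q with hv
  have hxT : x ∈ refSimplex d := interior_subset hx
  have hvd : ContDiff ℝ ∞ v := contDiff_eval q
  have hvdiff : Differentiable ℝ v := hvd.differentiable (by simp)
  have h0T : (0 : E d) ∈ refSimplex d := zero_mem_refSimplex
  have hQ₁0 : 0 ≤ Q₁ := (norm_nonneg _).trans (hQ₁ 0 h0T)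
  have hQ₀0 : 0 ≤ Q₀ := (norm_nonneg _).trans (hQ₀ 0 h0T)
  have hfl : ∀ y ∈ refSimplex d, |f y - f 0| ≤ A * 2 := fun y hy => by
    have h1 : LocLip (interior (refSimplex d)) f A :=
      locLip_of_fderiv_le isOpen_interior hdf fun x hx => hS.norm_le hx
    have h2 := norm_sub_le_of_locLip_refSimplex hd hf h1 hA h0T hy
    exact h2.trans (by gcongr; exact norm_sub_le_two_of_mem_refSimplex h0T hy)
  have hvl : ∀ y ∈ refSimplex d, ‖v y - v 0‖ ≤ Q₁ * 2 := fun y hy => by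
    have h2 := convex_refSimplex.norm_image_sub_le_of_norm_fderiv_le
      (fun z _ => hvdiff z) hQ₁ h0T hy
    exact h2.trans (by gcongr; exact norm_sub_le_two_of_mem_refSimplex h0T hy)
  -- Each increment over the simplex is at most twice a gradient bound, so `ψ` carries the small
  -- factor `A` and the gradient of the polynomial without any power of `c`.
  set ψ : E d → ℂ := fun y => ((f y - f 0 : ℝ) : ℂ) * (v y - v 0) with hψ
  have hψ1 : ∀ y ∈ refSimplex d, ‖ψ y‖ ≤ 4 * (A * Q₁) := fun y hy => by
    rw [hψ, norm_mul, Complex.norm_real]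
    exact (mul_le_mul (hfl y hy) (hvl y hy) (norm_nonneg _) (by positivity)).trans
      (le_of_eq (by ring))
  have hfx : HasFDerivAt (fun y => ((f y - f 0 : ℝ) : ℂ))
      (Complex.ofRealCLM.comp (fderiv ℝ f x)) x :=
    Complex.ofRealCLM.hasFDerivAt.comp x ((hdf x hx).hasFDerivAt.sub_const (f 0))
  have hψd : HasFDerivAt ψ (((f x - f 0 : ℝ) : ℂ) • fderiv ℝ v x +
      (v x - v 0) • Complex.ofRealCLM.comp (fderiv ℝ f x)) x :=
    hfx.mul ((hvdiff x).hasFDerivAt.sub_const (v 0))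
  have hψ2 : ‖fderiv ℝ ψ x‖ ≤ 4 * (A * Q₁) := by
    rw [hψd.fderiv]
    refine (norm_add_le _ _).trans ?_
    rw [norm_smul, norm_smul, Complex.norm_real]
    have i1 : ‖f x - f 0‖ * ‖fderiv ℝ v x‖ ≤ (A * 2) * Q₁ :=
      mul_le_mul (hfl x hxT) (hQ₁ x hxT) (norm_nonneg _) (by positivity)
    have i2 : ‖v x - v 0‖ * ‖Complex.ofRealCLM.comp (fderiv ℝ f x)‖ ≤ (Q₁ * 2) * A := by
      refine mul_le_mul (hvl x hxT) ?_ (norm_nonneg _) (by positivity)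
      refine (ContinuousLinearMap.opNorm_comp_le _ _).trans ?_
      rw [Complex.ofRealCLM_norm, one_mul]
      exact hS.norm_le hx
    linarith
  set g : E d → ℝ := fun z => f z - ∑ a ∈ nodeIdx d (n + 1),
    lagrange (n + 1) a z * f (refNode (n + 1) a) with hg
  have hrep : ∀ z, r z = v 0 * ((g z : ℝ) : ℂ) + (ψ z - refInterp (n + 1) ψ z) := by
    intro z
    -- The decisive splitting. The middle term is a polynomial of degree at most `n + 1` and is
    -- removed by `refInterp_eval`.
    have e1 : (fun y => (f y : ℂ) * v y) = fun y => (v 0 * (f y : ℂ) +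
        ((f 0 : ℂ) * MvPolynomial.eval (fun j => ((y j : ℝ) : ℂ)) (q - MvPolynomial.C (v 0)) +
          ψ y)) := by
      funext y
      simp only [hψ, hv, map_sub, MvPolynomial.eval_C]
      push_cast; ring
    have hdeg : (q - MvPolynomial.C (v 0)).totalDegree ≤ n + 1 :=
      (MvPolynomial.totalDegree_sub _ _).trans (max_le hq (by
        rw [MvPolynomial.totalDegree_C]; omega))
    have e2 : refInterp (n + 1) (fun y => (f y : ℂ)) z = ((∑ a ∈ nodeIdx d (n + 1),
        lagrange (n + 1) a z * f (refNode (n + 1) a) : ℝ) : ℂ) := by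
      simp only [refInterp]; push_cast; rfl
    rw [hr]
    change (f z : ℂ) * v z - refInterp (n + 1) (fun y => (f y : ℂ) * v y) z = _
    rw [e1, refInterp_add, refInterp_add, refInterp_const_mul, refInterp_const_mul,
      refInterp_eval (by omega) hdeg, e2]
    simp only [hg, hψ, hv, map_sub, MvPolynomial.eval_C]
    push_cast; ring
  obtain ⟨hg1, hg2⟩ := hCI hA hc hf hdf hS x hx
  obtain ⟨hI1, hI2⟩ := refInterp_bound (by omega) hCL hψ1 hxT
  have hgd : DifferentiableAt ℝ g x :=
    (hdf x hx).sub (DifferentiableAt.fun_sum fun a _ =>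
      (((contDiff_lagrange (n + 1) a).differentiable (by simp)) x).mul_const _)
  have hId : DifferentiableAt ℝ (refInterp (n + 1) ψ) x :=
    ((contDiff_refInterp (n + 1) ψ).differentiable (by simp)) x
  have hgC : HasFDerivAt (fun z => v 0 * ((g z : ℝ) : ℂ))
      (v 0 • Complex.ofRealCLM.comp (fderiv ℝ g x)) x :=
    (Complex.ofRealCLM.hasFDerivAt.comp x hgd.hasFDerivAt).const_mul (v 0)
  have hrd : HasFDerivAt r (v 0 • Complex.ofRealCLM.comp (fderiv ℝ g x) +
      (fderiv ℝ ψ x - fderiv ℝ (refInterp (n + 1) ψ) x)) x := by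
    rw [show r = _ from funext hrep]
    exact hgC.add (hψd.differentiableAt.hasFDerivAt.sub hId.hasFDerivAt)
  have hv0 : ‖v 0‖ ≤ Q₀ := hQ₀ 0 h0T
  have hfin : ∀ {X Y Z W : ℝ}, X ≤ Q₀ → 0 ≤ Y → Y ≤ CI * (A * c ^ (n + 1)) → Z ≤ 4 * (A * Q₁) →
      W ≤ (nodeIdx d (n + 1)).card * (CL * (4 * (A * Q₁))) →
      X * Y + (Z + W) ≤ max CI κ * (A * Q₁ + A * c ^ (n + 1) * Q₀) := by
    intro X Y Z W hX hY0 hY hZ hW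
    have i1 : X * Y ≤ Q₀ * (CI * (A * c ^ (n + 1))) := mul_le_mul hX hY hY0 hQ₀0
    have i2 : Q₀ * (CI * (A * c ^ (n + 1))) ≤ max CI κ * (A * c ^ (n + 1) * Q₀) := by
      rw [show Q₀ * (CI * (A * c ^ (n + 1))) = CI * (A * c ^ (n + 1) * Q₀) by ring]
      gcongr; exact le_max_left _ _
    have i3 : Z + W ≤ max CI κ * (A * Q₁) := by
      calc Z + W ≤ κ * (A * Q₁) := by rw [hκ]; linarith
        _ ≤ _ := by gcongr; exact le_max_right _ _
    linarith
  refine ⟨hrd.differentiableAt, ?_, ?_⟩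
  · rw [hrep]
    refine (norm_add_le _ _).trans ((add_le_add le_rfl (norm_sub_le _ _)).trans ?_)
    rw [norm_mul, Complex.norm_real]
    exact hfin hv0 (norm_nonneg _) hg1 (hψ1 x hxT) hI1
  · rw [hrd.fderiv]
    refine (norm_add_le _ _).trans ((add_le_add le_rfl (norm_sub_le _ _)).trans ?_)
    rw [norm_smul]
    refine hfin hv0 (norm_nonneg _) ?_ hψ2 hI2
    refine (ContinuousLinearMap.opNorm_comp_le _ _).trans ?_
    rw [Complex.ofRealCLM_norm, one_mul]
    exact hg2

end InterpError

/-! ### Norm equivalence for polynomials -/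

section InverseEstimates

variable {d : ℕ}

/-- The function on `ℝ^d` defined by a complex polynomial. -/
def polyFun (q : MvPolynomial (Fin d) ℂ) (x : E d) : ℂ :=
  MvPolynomial.eval (fun j => ((x j : ℝ) : ℂ)) q

theorem contDiff_polyFun (q : MvPolynomial (Fin d) ℂ) : ContDiff ℝ ∞ (polyFun q) :=
  contDiff_eval q

theorem differentiable_polyFun (q : MvPolynomial (Fin d) ℂ) : Differentiable ℝ (polyFun q) :=
  (contDiff_polyFun q).differentiable (by simp)

theorem totalDegree_pderiv_le {p : ℕ} {q : MvPolynomial (Fin d) ℂ} (hq : q.totalDegree ≤ p)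
    (j : Fin d) : (MvPolynomial.pderiv j q).totalDegree ≤ p := by
  conv_lhs => rw [q.as_sum, map_sum]
  refine MvPolynomial.totalDegree_finsetSum_le fun s hs => ?_
  rw [MvPolynomial.pderiv_monomial]
  refine (MvPolynomial.totalDegree_monomial_le _ _).trans ?_
  rw [Finsupp.sum_fintype _ _ (fun _ => rfl)]
  exact (Finset.sum_le_sum fun i _ => by simp).trans (sum_le_of_mem_support hq hs)

theorem fderiv_polyFun_apply_e (q : MvPolynomial (Fin d) ℂ) (j : Fin d) (x : E d) :
    fderiv ℝ (polyFun q) x (e j) = polyFun (MvPolynomial.pderiv j q) x := by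
  have hX : ∀ i : Fin d, HasFDerivAt (fun y : E d => ((y i : ℝ) : ℂ))
      (Complex.ofRealCLM.comp (EuclideanSpace.proj i : E d →L[ℝ] ℝ)) x := fun i =>
    (Complex.ofRealCLM.comp (EuclideanSpace.proj i : E d →L[ℝ] ℝ)).hasFDerivAt
  induction q using MvPolynomial.induction_on with
  | C a =>
    have : (polyFun (MvPolynomial.C a) : E d → ℂ) = fun _ => a := by
      funext y; simp [polyFun]
    rw [this]
    simp [polyFun]
  | add q r hq hr =>
    have h : (polyFun (q + r) : E d → ℂ) = fun y => polyFun q y + polyFun r y := by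
      funext y; simp [polyFun]
    rw [h, fderiv_fun_add (differentiable_polyFun q x) (differentiable_polyFun r x),
      _root_.add_apply, hq, hr]
    simp [polyFun]
  | mul_X q i hq =>
    have h : (polyFun (q * MvPolynomial.X i) : E d → ℂ) =
        fun y => polyFun q y * ((y i : ℝ) : ℂ) := by
      funext y; simp [polyFun]
    have h1 := ((differentiable_polyFun q x).hasFDerivAt.mul (hX i)).fderiv
    rw [h, show fderiv ℝ (fun y : E d => polyFun q y * ((y i : ℝ) : ℂ)) x = _ from h1]
    simp only [_root_.add_apply, _root_.smul_apply, hq]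
    by_cases hij : i = j
    · subst hij
      simp [polyFun, e]
    · simp [polyFun, e, hij, MvPolynomial.pderiv_X]

theorem norm_le_sum_apply_e {G : Type*} [NormedAddCommGroup G] [NormedSpace ℝ G]
    (L : E d →L[ℝ] G) : ‖L‖ ≤ ∑ j, ‖L (e j)‖ := by
  refine L.opNorm_le_bound (Finset.sum_nonneg fun _ _ => norm_nonneg _) fun x => ?_
  conv_lhs => rw [← sum_smul_e x, map_sum]
  rw [Finset.sum_mul]
  refine norm_sum_le_of_le _ fun j _ => ?_
  rw [map_smul, norm_smul, mul_comm]
  gcongr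
  exact abs_apply_le_norm x j

theorem sq_norm_le_sum_sq_apply_e (L : E d →L[ℝ] ℂ) : ‖L‖ ^ 2 ≤ d * ∑ j, ‖L (e j)‖ ^ 2 := by
  calc ‖L‖ ^ 2 ≤ (∑ j, ‖L (e j)‖) ^ 2 := by gcongr; exact norm_le_sum_apply_e L
    _ ≤ _ := by simpa using sq_sum_le_card_mul_sum_sq (s := Finset.univ) (f := fun j => ‖L (e j)‖)

theorem norm_e (j : Fin d) : ‖(e j : E d)‖ = 1 := by simp [e]

theorem norm_apply_e_le (L : E d →L[ℝ] ℂ) (j : Fin d) : ‖L (e j)‖ ≤ ‖L‖ := by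
  simpa [norm_e] using L.le_opNorm (e j)

theorem integrableOn_interior_refSimplex {G : Type*} [NormedAddCommGroup G] {f : E d → G}
    (hf : Continuous f) : IntegrableOn f (interior (refSimplex d)) :=
  (hf.continuousOn.integrableOn_compact isCompact_refSimplex).mono_set interior_subset

theorem memLp_interior_refSimplex {f : E d → ℂ} (hf : Continuous f) :
    MemLp f 2 (volume.restrict (interior (refSimplex d))) := by
  rw [memLp_two_iff_integrable_sq_norm hf.aestronglyMeasurable]
  exact integrableOn_interior_refSimplex (by fun_prop)

theorem norm_sq_toLp {α : Type*} [MeasurableSpace α] {μ : Measure α} {f : α → ℂ}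
    (hf : MemLp f 2 μ) : ‖hf.toLp f‖ ^ 2 = ∫ x, ‖f x‖ ^ 2 ∂μ := by
  have h := inner_self_eq_norm_sq_to_K (𝕜 := ℂ) (hf.toLp f)
  rw [L2.inner_def, integral_congr_ae (g := fun x => ((‖f x‖ ^ 2 : ℝ) : ℂ)), integral_complex_ofReal] at h
  · rw [← RCLike.ofReal_pow] at h
    exact (RCLike.ofReal_injective (K := ℂ) h).symm
  · filter_upwards [hf.coeFn_toLp] with x hx
    rw [hx, inner_self_eq_norm_sq_to_K]
    push_cast; rfl

theorem infinite_box_subset_interior (hd : 1 ≤ d) : ∃ s : Fin d → Set ℂ, (∀ i, (s i).Infinite) ∧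
    ∀ x ∈ Set.pi .univ s, ∃ y ∈ interior (refSimplex d), x = fun j => ((y j : ℝ) : ℂ) := by
  have hd' : (0 : ℝ) < d := by exact_mod_cast hd
  refine ⟨fun _ => Complex.ofReal '' Ioo 0 ((d : ℝ) + 1)⁻¹, fun _ =>
    (Ioo_infinite (by positivity)).image Complex.ofReal_injective.injOn, fun x hx => ?_⟩
  choose y hy hyx using fun j => hx j (mem_univ j)
  refine ⟨WithLp.toLp 2 y, ?_, funext fun j => (hyx j).symm⟩
  rw [interior_refSimplex hd]
  intro s
  refine Fin.cases ?_ (fun j => ?_) s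
  · simp only [bary_zero, sub_pos]
    calc ∑ j, y j ≤ ∑ _j : Fin d, ((d : ℝ) + 1)⁻¹ := Finset.sum_le_sum fun j _ => (hy j).2.le
      _ = d / (d + 1) := by simp [div_eq_mul_inv]
      _ < 1 := by rw [div_lt_one (by positivity)]; linarith
  · exact (hy j).1

/-- By continuity the polynomial vanishes on the whole interior, which contains a product of
infinite sets. -/
theorem eq_zero_of_polyFun_ae_eq_zero (hd : 1 ≤ d) {q : MvPolynomial (Fin d) ℂ}
    (h : ∀ᵐ x ∂(volume.restrict (interior (refSimplex d))), polyFun q x = 0) : q = 0 := by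
  have h1 : ∀ x ∈ interior (refSimplex d), ‖polyFun q x‖ ≤ 0 :=
    le_of_ae_le_of_continuousOn isOpen_interior
      (contDiff_polyFun q).continuous.norm.continuousOn (h.mono fun x hx => by rw [hx, norm_zero])
  obtain ⟨s, hs, hbox⟩ := infinite_box_subset_interior hd
  refine MvPolynomial.funext_set s hs fun x hx => ?_
  obtain ⟨y, hy, rfl⟩ := hbox x hx
  rw [map_zero]
  exact norm_le_zero_iff.1 (h1 y hy)

/-- The map from coefficients to L² is linear and injective on a finite-dimensional space, hence
bounded below. -/
theorem exists_coeff_bound (hd : 1 ≤ d) (p : ℕ) : ∃ C, 0 ≤ C ∧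
    ∀ q : MvPolynomial (Fin d) ℂ, q.totalDegree ≤ p → ∀ b ∈ nodeIdx d p,
      ‖q.coeff (exponent b)‖ ≤ C * √(∫ x in interior (refSimplex d), ‖polyFun q x‖ ^ 2) := by
  classical
  set μ := (volume : Measure (E d)).restrict (interior (refSimplex d)) with hμ
  let Q : (nodeIdx d p → ℂ) →ₗ[ℂ] MvPolynomial (Fin d) ℂ :=
    ∑ b : nodeIdx d p, MvPolynomial.monomial (exponent (b : Fin (d + 1) → ℕ)) ∘ₗ
      LinearMap.proj b
  have hQ : ∀ c, Q c = ∑ b : nodeIdx d p,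
      MvPolynomial.monomial (exponent (b : Fin (d + 1) → ℕ)) (c b) := fun c => by
    simp [Q]
  have hQc : ∀ (c : nodeIdx d p → ℂ) (b : nodeIdx d p), (Q c).coeff (exponent (b : Fin (d + 1) → ℕ)) = c b :=
      fun c b => by
    rw [hQ]
    simp only [MvPolynomial.coeff_sum, MvPolynomial.coeff_monomial]
    rw [Finset.sum_eq_single b (fun b' _ hb' => if_neg fun h => hb'
      (Subtype.ext (exponent_injOn p b'.2 b.2 h))) (fun h => absurd (Finset.mem_univ _) h),
      if_pos rfl]
  have hmem : ∀ q : MvPolynomial (Fin d) ℂ, MemLp (polyFun q) 2 μ := fun q =>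
    memLp_interior_refSimplex (contDiff_polyFun q).continuous
  let Φ : (nodeIdx d p → ℂ) →ₗ[ℂ] Lp ℂ 2 μ :=
    { toFun := fun c => (hmem (Q c)).toLp _
      map_add' := fun c c' => by
        rw [← MemLp.toLp_add]
        congr 1
        funext x
        simp [polyFun]
      map_smul' := fun r c => by
        rw [RingHom.id_apply, ← MemLp.toLp_const_smul]
        congr 1
        funext x
        simp [polyFun, MvPolynomial.smul_eval] }
  have hinj : Function.Injective Φ := by
    rw [← LinearMap.ker_eq_bot, LinearMap.ker_eq_bot']
    intro c hc
    have h1 : Q c = 0 := eq_zero_of_polyFun_ae_eq_zero hd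
      ((hmem (Q c)).coeFn_toLp.symm.trans (by
        rw [show (hmem (Q c)).toLp _ = 0 from hc]
        exact Lp.coeFn_zero ℂ 2 μ))
    funext b
    rw [← hQc c b, h1]; rfl
  obtain ⟨K, -, hK⟩ := Φ.injective_iff_antilipschitz.1 hinj
  refine ⟨K, K.2, fun q hq b hb => ?_⟩
  set c : nodeIdx d p → ℂ := fun b => q.coeff (exponent (b : Fin (d + 1) → ℕ)) with hc
  have h1 : ‖c‖ ≤ K * ‖Φ c‖ := by
    simpa using hK.le_mul_dist c 0
  have h2 : polyFun (Q c) = polyFun q := by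
    funext x
    simp only [polyFun]
    rw [eval_eq_sum_nodeIdx hq]
    rw [hQ]
    simp only [map_sum, MvPolynomial.eval_monomial,
      Finsupp.prod_fintype _ _ (fun _ => pow_zero _), exponent_apply, hc]
    exact Finset.sum_coe_sort (nodeIdx d p) fun b => q.coeff (exponent b) *
      ∏ j, ((x j : ℝ) : ℂ) ^ b j.succ
  have h3 : ‖Φ c‖ = √(∫ x, ‖polyFun q x‖ ^ 2 ∂μ) := by
    rw [← h2, ← norm_sq_toLp (hmem (Q c)), Real.sqrt_sq (norm_nonneg _)]
    rfl
  rw [h3] at h1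
  exact (norm_le_pi_norm c ⟨b, hb⟩).trans h1

/-- Norm equivalence for polynomials on the reference simplex. -/
theorem exists_inverse_estimate (hd : 1 ≤ d) (p : ℕ) : ∃ C, 0 ≤ C ∧
    ∀ q : MvPolynomial (Fin d) ℂ, q.totalDegree ≤ p → ∀ x ∈ refSimplex d,
      ‖polyFun q x‖ ^ 2 ≤ C * ∫ y in interior (refSimplex d), ‖polyFun q y‖ ^ 2 ∧
      ‖fderiv ℝ (polyFun q) x‖ ^ 2 ≤ C * ∫ y in interior (refSimplex d), ‖polyFun q y‖ ^ 2 ∧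
      ‖fderiv ℝ (polyFun q) x‖ ^ 2 ≤ C * ∑ j, ∫ y in interior (refSimplex d),
        ‖fderiv ℝ (polyFun q) y (e j)‖ ^ 2 := by
  obtain ⟨C₀, hC₀, hcoef⟩ := exists_coeff_bound hd p
  let mon : (Fin (d + 1) → ℕ) → MvPolynomial (Fin d) ℂ := fun b =>
    MvPolynomial.monomial (exponent b) 1
  have hmon : ∃ B, 0 ≤ B ∧ ∀ b ∈ nodeIdx d p, ∀ x ∈ refSimplex d,
      ‖polyFun (mon b) x‖ ≤ B ∧ ‖fderiv ℝ (polyFun (mon b)) x‖ ≤ B := by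
    have h : ∀ b : Fin (d + 1) → ℕ, ∃ B, ∀ x ∈ refSimplex d,
        ‖polyFun (mon b) x‖ ≤ B ∧ ‖fderiv ℝ (polyFun (mon b)) x‖ ≤ B := fun b => by
      obtain ⟨C₁, h₁⟩ := isCompact_refSimplex.exists_bound_of_continuousOn
        (contDiff_polyFun (mon b)).continuous.continuousOn (s := refSimplex d)
      obtain ⟨C₂, h₂⟩ := isCompact_refSimplex.exists_bound_of_continuousOn
        ((contDiff_polyFun (mon b)).continuous_fderiv (by simp)).continuousOn
        (s := refSimplex d)
      exact ⟨max C₁ C₂, fun x hx => ⟨(h₁ x hx).trans (le_max_left _ _),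
        (h₂ x hx).trans (le_max_right _ _)⟩⟩
    choose B hB using h
    refine ⟨∑ b ∈ nodeIdx d p, |B b|, Finset.sum_nonneg fun _ _ => abs_nonneg _,
      fun b hb x hx => ?_⟩
    have h1 : B b ≤ ∑ b ∈ nodeIdx d p, |B b| := (le_abs_self _).trans
      (Finset.single_le_sum (f := fun b => |B b|) (fun _ _ => abs_nonneg _) hb)
    exact ⟨(hB b x hx).1.trans h1, (hB b x hx).2.trans h1⟩
  obtain ⟨B, hB, hmon⟩ := hmon
  have hrep : ∀ q : MvPolynomial (Fin d) ℂ, q.totalDegree ≤ p →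
      polyFun q = fun x => ∑ b ∈ nodeIdx d p, q.coeff (exponent b) * polyFun (mon b) x := by
    intro q hq
    funext x
    simp only [polyFun, mon]
    rw [eval_eq_sum_nodeIdx hq]
    simp only [MvPolynomial.eval_monomial, one_mul, Finsupp.prod_fintype _ _ (fun _ => pow_zero _),
      exponent_apply]
  set m : ℝ := ((nodeIdx d p).card : ℝ) with hm
  set D : ℝ := m * (C₀ * B) with hD
  have hD0 : 0 ≤ D := by positivity
  have key : ∀ q : MvPolynomial (Fin d) ℂ, q.totalDegree ≤ p → ∀ x ∈ refSimplex d,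
      ‖polyFun q x‖ ≤ D * √(∫ y in interior (refSimplex d), ‖polyFun q y‖ ^ 2) ∧
      ‖fderiv ℝ (polyFun q) x‖ ≤ D * √(∫ y in interior (refSimplex d), ‖polyFun q y‖ ^ 2) := by
    intro q hq x hx
    set I := √(∫ y in interior (refSimplex d), ‖polyFun q y‖ ^ 2) with hI
    have hI0 : 0 ≤ I := Real.sqrt_nonneg _
    have hsum : ∀ g : (Fin (d + 1) → ℕ) → ℝ, (∀ b ∈ nodeIdx d p, 0 ≤ g b ∧ g b ≤ B) →
        ∑ b ∈ nodeIdx d p, ‖q.coeff (exponent b)‖ * g b ≤ D * I := fun g hg => by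
      calc ∑ b ∈ nodeIdx d p, ‖q.coeff (exponent b)‖ * g b
          ≤ ∑ b ∈ nodeIdx d p, (C₀ * I) * B := Finset.sum_le_sum fun b hb =>
            mul_le_mul (hcoef q hq b hb) (hg b hb).2 (hg b hb).1 (by positivity)
        _ = _ := by rw [Finset.sum_const, nsmul_eq_mul]; ring
    constructor
    · rw [hrep q hq]
      refine (norm_sum_le _ _).trans ?_
      simp only [norm_mul]
      exact hsum _ fun b hb => ⟨norm_nonneg _, (hmon b hb x hx).1⟩
    · have h1 : HasFDerivAt (polyFun q) (∑ b ∈ nodeIdx d p,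
          q.coeff (exponent b) • fderiv ℝ (polyFun (mon b)) x) x := by
        rw [hrep q hq]
        exact HasFDerivAt.fun_sum fun b _ =>
          (differentiable_polyFun (mon b) x).hasFDerivAt.const_mul _
      rw [h1.fderiv]
      refine (norm_sum_le _ _).trans ?_
      simp only [norm_smul]
      exact hsum _ fun b hb => ⟨norm_nonneg _, (hmon b hb x hx).2⟩
  have hsq : ∀ {u I : ℝ}, 0 ≤ u → 0 ≤ I → u ≤ D * √I → u ^ 2 ≤ D ^ 2 * I := fun hu hI h => by
    calc _ ≤ (D * √_) ^ 2 := by gcongr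
      _ = _ := by rw [mul_pow, Real.sq_sqrt hI]
  have hint0 : ∀ q : MvPolynomial (Fin d) ℂ,
      0 ≤ ∫ y in interior (refSimplex d), ‖polyFun q y‖ ^ 2 := fun q =>
    integral_nonneg fun _ => by positivity
  have hdD : D ^ 2 ≤ d * D ^ 2 := by
    have : (1 : ℝ) ≤ d := by exact_mod_cast hd
    nlinarith [sq_nonneg D]
  -- `D ^ 2` would do for the first two bounds. The third applies the first to each partial
  -- derivative, again a polynomial of degree at most `p`, and loses `d` in passing from the
  -- operator norm to the partial derivatives.
  refine ⟨d * D ^ 2, by positivity, fun q hq x hx => ⟨?_, ?_, ?_⟩⟩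
  · exact (hsq (norm_nonneg _) (hint0 q) (key q hq x hx).1).trans
      (mul_le_mul_of_nonneg_right hdD (hint0 q))
  · exact (hsq (norm_nonneg _) (hint0 q) (key q hq x hx).2).trans
      (mul_le_mul_of_nonneg_right hdD (hint0 q))
  · refine (sq_norm_le_sum_sq_apply_e _).trans ?_
    rw [mul_assoc, Finset.mul_sum (a := D ^ 2)]
    refine mul_le_mul_of_nonneg_left (Finset.sum_le_sum fun j _ => ?_) (by positivity)
    simp only [fderiv_polyFun_apply_e]
    exact hsq (norm_nonneg _) (hint0 _) (key _ (totalDegree_pderiv_le hq j) x hx).1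

end InverseEstimates

/-! ### Change of variables -/

section ChangeOfVariables

variable {d : ℕ}

/-- Compare volumes: the image of the unit ball lies in the ball of radius `‖L‖`. -/
theorem abs_det_le_norm_pow (L : E d →L[ℝ] E d) : |L.det| ≤ ‖L‖ ^ d := by
  have h1 := Measure.addHaar_image_continuousLinearMap (volume : Measure (E d)) L
    (Metric.ball 0 1)
  have h2 : L '' Metric.ball 0 1 ⊆ Metric.closedBall 0 ‖L‖ := by
    rintro _ ⟨x, hx, rfl⟩
    rw [mem_closedBall_zero_iff]
    rw [mem_ball_zero_iff] at hx
    exact (L.le_opNorm x).trans (mul_le_of_le_one_right (norm_nonneg _) hx.le)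
  have h3 := measure_mono (μ := (volume : Measure (E d))) h2
  rw [h1, Measure.addHaar_closedBall _ _ (norm_nonneg L), finrank_euclideanSpace_fin] at h3
  have hpos : volume (Metric.ball (0 : E d) 1) ≠ 0 :=
    (Metric.measure_ball_pos _ _ one_pos).ne'
  have hfin : volume (Metric.ball (0 : E d) 1) ≠ ⊤ := measure_ball_lt_top.ne
  rw [ENNReal.mul_le_mul_iff_left hpos hfin] at h3
  exact (ENNReal.ofReal_le_ofReal_iff (by positivity)).1 h3

/-- Meant for the inverse of an element map: integrals over the reference simplex are bounded by
integrals over the element, and only `‖D G‖` is needed. -/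
theorem setIntegral_image_le {U : Set (E d)} (hU : IsOpen U) {G : E d → E d} {H : ℝ}
    (hG : ∀ x ∈ U, DifferentiableAt ℝ G x) (hH : ∀ x ∈ U, ‖fderiv ℝ G x‖ ≤ H)
    (hinj : InjOn G U) {g : E d → ℝ} (hg : ∀ x, 0 ≤ g x)
    (hint : IntegrableOn (fun x => g (G x)) U) :
    ∫ y in G '' U, g y ≤ H ^ d * ∫ x in U, g (G x) := by
  rw [integral_image_eq_integral_abs_det_fderiv_smul volume hU.measurableSet
    (fun x hx => (hG x hx).hasFDerivAt.hasFDerivWithinAt) hinj, ← integral_const_mul]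
  refine integral_mono_of_nonneg (Eventually.of_forall fun x => ?_) (hint.const_mul _) ?_
  · exact smul_nonneg (abs_nonneg _) (hg _)
  · refine (ae_restrict_iff' hU.measurableSet).2 (Eventually.of_forall fun x hx => ?_)
    refine mul_le_mul_of_nonneg_right ((abs_det_le_norm_pow _).trans ?_) (hg _)
    gcongr
    exact hH x hx

end ChangeOfVariables

/-! ### Weak gradients of locally Lipschitz functions -/

section WeakGradient

variable {d : ℕ}

/-- Integration by parts for Lipschitz functions, against the constant `1`. -/
theorem integral_fderiv_eq_zero_of_real {h : E d → ℝ} {K : NNReal} (hl : LipschitzWith K h)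
    (hc : HasCompactSupport h) (v : E d) : ∫ x, fderiv ℝ h x v = 0 := by
  have h1 := (LipschitzWith.const (1 : ℝ)).integral_lineDeriv_mul_eq (μ := (volume : Measure (E d)))
    hl hc (-v)
  have h0 : ∀ x : E d, lineDeriv ℝ (fun _ : E d => (1 : ℝ)) x (-v) = 0 := fun x => by
    simp [lineDeriv]
  simp only [h0, zero_mul, integral_zero, neg_neg, mul_one] at h1
  rw [h1]
  refine integral_congr_ae ?_
  filter_upwards [hl.ae_differentiableAt (μ := volume)] with x hx
  exact hx.lineDeriv_eq_fderiv.symm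

theorem integrable_fderiv_apply {g : E d → ℂ} {K : NNReal} (hl : LipschitzWith K g)
    (hc : HasCompactSupport g) (v : E d) : Integrable (fun x => fderiv ℝ g x v) := by
  have hm : Measurable (fun x => fderiv ℝ g x v) := measurable_fderiv_apply_const ℝ g v
  have hs : Function.support (fun x => fderiv ℝ g x v) ⊆ tsupport g := by
    intro x hx
    refine support_fderiv_subset ℝ (fun h => hx ?_)
    simp [h]
  rw [← integrableOn_iff_integrable_of_support_subset hs]
  have hcomp : IsCompact (tsupport g) := hc
  refine ⟨hm.aestronglyMeasurable, HasFiniteIntegral.restrict_of_bounded (C := K * ‖v‖)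
    hcomp.measure_lt_top (Eventually.of_forall fun x => ?_)⟩
  refine ((fderiv ℝ g x).le_opNorm v).trans ?_
  gcongr
  exact norm_fderiv_le_of_lipschitz ℝ hl

theorem integral_fderiv_eq_zero {g : E d → ℂ} {K : NNReal} (hl : LipschitzWith K g)
    (hc : HasCompactSupport g) (v : E d) : ∫ x, fderiv ℝ g x v = 0 := by
  have hint := integrable_fderiv_apply hl hc v
  have key : ∀ L : ℂ →L[ℝ] ℝ, L (∫ x, fderiv ℝ g x v) = 0 := fun L => by
    rw [← L.integral_comp_comm hint,
      ← integral_fderiv_eq_zero_of_real (L.lipschitz.comp hl) (hc.comp_left (map_zero L)) v]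
    refine integral_congr_ae ?_
    filter_upwards [hl.ae_differentiableAt (μ := volume)] with x hx
    rw [(L.hasFDerivAt.comp x hx.hasFDerivAt).fderiv]
    rfl
  exact Complex.ext (key Complex.reCLM) (key Complex.imCLM)

/-- Rademacher's theorem on small balls; a set that is null near each of its points is null. -/
theorem LocLip.ae_differentiableAt {U : Set (E d)} (hU : IsOpen U) {u : E d → ℂ} {M : ℝ}
    (hM : 0 ≤ M) (hu : LocLip U u M) : ∀ᵐ x, x ∈ U → DifferentiableAt ℝ u x := by
  rw [ae_iff]
  refine measure_null_of_locally_null _ fun x hx => ?_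
  simp only [mem_ofPred_eq, Classical.not_imp] at hx
  obtain ⟨r, hr, hrU⟩ := Metric.isOpen_iff.1 hU x hx.1
  have hlip : LipschitzOnWith ⟨M, hM⟩ u (Metric.ball x r) :=
    LipschitzOnWith.of_dist_le_mul fun y hy z hz => by
      rw [dist_eq_norm, dist_eq_norm]
      exact (hu.subset hrU).norm_sub_le_of_convex (convex_ball x r) hz hy
  refine ⟨_, inter_mem_nhdsWithin _ (Metric.ball_mem_nhds x hr), ?_⟩
  have h1 := hlip.ae_differentiableWithinAt_of_mem (μ := volume)
  refine measure_mono_null (fun y hy => ?_) (ae_iff.1 h1)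
  simp only [mem_ofPred_eq, Classical.not_imp]
  obtain ⟨hy1, hy2⟩ := hy
  simp only [mem_ofPred_eq, Classical.not_imp] at hy1
  exact ⟨hy2, fun h => hy1.2 (h.differentiableAt (Metric.isOpen_ball.mem_nhds hy2))⟩

theorem LocLip.memLp {U : Set (E d)} (hU : IsOpen U) (hfin : volume U < ⊤) {u : E d → ℂ}
    {M B : ℝ} (hu : LocLip U u M) (hB : ∀ x ∈ U, ‖u x‖ ≤ B) :
    MemLp u 2 (volume.restrict U) := by
  have : IsFiniteMeasure (volume.restrict U) := ⟨by rwa [Measure.restrict_apply_univ]⟩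
  exact MemLp.of_bound (hu.continuousOn.aestronglyMeasurable hU.measurableSet) B
    ((ae_restrict_iff' hU.measurableSet).2 (Eventually.of_forall hB))

theorem setIntegral_mul_test_eq {U W : Set (E d)} (hWU : W ⊆ U) (u : E d → ℂ) {φ : E d → ℝ}
    (hφ : Function.support φ ⊆ W) :
    ∫ x in U, u x * ((φ x : ℝ) : ℂ) = ∫ x in W, u x * ((φ x : ℝ) : ℂ) := by
  have h : ∀ V, W ⊆ V → ∫ x in V, u x * ((φ x : ℝ) : ℂ) = ∫ x, u x * ((φ x : ℝ) : ℂ) :=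
    fun V hV => setIntegral_eq_integral_of_forall_compl_eq_zero fun x hx => by
      have : φ x = 0 := by
        by_contra h0
        exact hx (hV (hφ h0))
      simp [this]
  rw [h U hWU, h W Subset.rfl]

theorem support_partial_subset {φ : E d → ℝ} (j : Fin d) :
    Function.support (fun x => fderiv ℝ φ x (e j)) ⊆ tsupport φ := fun x hx =>
  support_fderiv_subset ℝ fun h => hx (by simp [h])

/-- A bounded, locally Lipschitz function on an open set of finite measure has its classical
gradient, which exists almost everywhere, as its weak gradient. -/
theorem LocLip.isWeakGrad {U : Set (E d)} (hU : IsOpen U) (hfin : volume U < ⊤) {u : E d → ℂ}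
    {M B : ℝ} (hM : 0 ≤ M) (hu : LocLip U u M) (hB0 : 0 ≤ B) (hB : ∀ x ∈ U, ‖u x‖ ≤ B) :
    IsWeakGrad U u (fun j x => fderiv ℝ u x (e j)) := by
  have : IsFiniteMeasure (volume.restrict U) := ⟨by rwa [Measure.restrict_apply_univ]⟩
  have hgrad : ∀ j, MemLp (fun x => fderiv ℝ u x (e j)) 2 (volume.restrict U) := fun j => by
    refine MemLp.of_bound (measurable_fderiv_apply_const ℝ u (e j)).aestronglyMeasurable M
      ((ae_restrict_iff' hU.measurableSet).2 (Eventually.of_forall fun x hx => ?_))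
    exact (norm_apply_e_le _ j).trans (hu.norm_fderiv_le hM hx)
  refine ⟨hgrad, fun φ hφ hc hs j => ?_⟩
  have hu2 := hu.memLp hU hfin hB
  obtain ⟨Bφ, hBφ⟩ := hφ.continuous.bounded_above_of_compact_support hc
  obtain ⟨Lφ, hLφ⟩ := (hφ.continuous_fderiv (by simp)).bounded_above_of_compact_support
    (hc.fderiv ℝ)
  have hBφ0 : 0 ≤ Bφ := (norm_nonneg _).trans (hBφ 0)
  have hLφ0 : 0 ≤ Lφ := (norm_nonneg _).trans (hLφ 0)
  have hφd : Differentiable ℝ φ := hφ.differentiable (by simp)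
  have hφl : LocLip univ φ Lφ := locLip_of_fderiv_le isOpen_univ (fun x _ => hφd x) fun x _ => hLφ x
  -- The product vanishes off the support of `φ`, which lies in `U`, so it is Lipschitz on the whole
  -- space whatever `u` does outside `U`. The integral of its derivative is zero, and the product
  -- rule, valid almost everywhere, is the assertion.
  set g : E d → ℂ := fun x => u x * ((φ x : ℝ) : ℂ) with hg
  have hgl : LocLip univ g (B * Lφ + M * Bφ) := by
    intro x _
    by_cases hx : x ∈ U
    · filter_upwards [hu x hx, hφl x (mem_univ x)] with y h1 h2
      have e1 : g y - g x = u x * (((φ y - φ x : ℝ)) : ℂ) + (u y - u x) * ((φ y : ℝ) : ℂ) := by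
        simp only [hg]; push_cast; ring
      rw [e1]
      refine (norm_add_le _ _).trans ?_
      rw [norm_mul, norm_mul, Complex.norm_real, Complex.norm_real]
      have i1 : ‖u x‖ * ‖φ y - φ x‖ ≤ B * (Lφ * ‖y - x‖) :=
        mul_le_mul (hB x hx) h2 (norm_nonneg _) hB0
      have i2 : ‖u y - u x‖ * ‖φ y‖ ≤ (M * ‖y - x‖) * Bφ :=
        mul_le_mul h1 (hBφ y) (norm_nonneg _) (by positivity)
      linarith
    · have hx' : x ∉ tsupport φ := fun h => hx (hs h)
      have hz : ∀ y, y ∉ tsupport φ → g y = 0 := fun y hy => by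
        simp [hg, image_eq_zero_of_notMem_tsupport hy]
      filter_upwards [(isClosed_tsupport φ).isOpen_compl.mem_nhds hx'] with y hy
      rw [hz y hy, hz x hx', sub_self, norm_zero]
      positivity
  have hgL : LipschitzWith ⟨B * Lφ + M * Bφ, by positivity⟩ g :=
    LipschitzWith.of_dist_le_mul fun y x => by
      rw [dist_eq_norm, dist_eq_norm]
      exact hgl.norm_sub_le_of_convex convex_univ (mem_univ x) (mem_univ y)
  have hgts : tsupport g ⊆ tsupport φ := by
    refine closure_mono fun x hx h => hx ?_
    simp [hg, h]
  have hgc : HasCompactSupport g := hc.mono fun x hx h => hx (by simp [hg, h])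
  have h0 := integral_fderiv_eq_zero hgL hgc (e j)
  rw [← setIntegral_eq_integral_of_forall_compl_eq_zero (s := U) (fun x hx => by
    have h : fderiv ℝ g x = 0 := by
      by_contra h
      exact hx (hs (hgts (support_fderiv_subset ℝ h)))
    simp [h])] at h0
  have hae : ∀ᵐ x ∂(volume.restrict U), fderiv ℝ g x (e j) =
      u x * ((fderiv ℝ φ x (e j) : ℝ) : ℂ) + fderiv ℝ u x (e j) * ((φ x : ℝ) : ℂ) := by
    refine (ae_restrict_iff' hU.measurableSet).2 ?_
    filter_upwards [hu.ae_differentiableAt hU hM] with x hx hxU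
    have h1 := (hx hxU).hasFDerivAt.mul
      (Complex.ofRealCLM.hasFDerivAt.comp x (hφd x).hasFDerivAt)
    have h2 : fderiv ℝ g x = _ := h1.fderiv
    rw [h2]
    simp [mul_comm]
  rw [integral_congr_ae hae, integral_add
    (integrable_mul_test hu2 (continuous_partial hφ j) (hasCompactSupport_partial hc j))
    (integrable_mul_test (hgrad j) hφ.continuous hc)] at h0
  exact eq_neg_of_add_eq_zero_left h0

theorem IsWeakGrad.restrict {U W : Set (E d)} (hWU : W ⊆ U) {u : E d → ℂ}
    {g : Fin d → E d → ℂ} (h : IsWeakGrad U u g) : IsWeakGrad W u g := by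
  refine ⟨fun j => (h.1 j).mono_measure (Measure.restrict_mono hWU le_rfl),
    fun φ hφ hc hs j => ?_⟩
  have h1 := h.2 φ hφ hc (hs.trans hWU) j
  rwa [setIntegral_mul_test_eq hWU (g j) ((subset_tsupport φ).trans hs),
    setIntegral_mul_test_eq hWU u (φ := fun x => fderiv ℝ φ x (e j))
      ((support_partial_subset j).trans hs)] at h1

theorem MemH1.restrict {U W : Set (E d)} (hWU : W ⊆ U) {u : E d → ℂ} (h : MemH1 U u) :
    MemH1 W u :=
  ⟨h.1.mono_measure (Measure.restrict_mono hWU le_rfl), h.2.imp fun _ hg => hg.restrict hWU⟩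

/-- The fundamental lemma of the calculus of variations; it makes the choice in `weakGrad`
immaterial for integrals. -/
theorem IsWeakGrad.ae_eq {U : Set (E d)} (hU : IsOpen U) (hfin : volume U < ⊤) {u : E d → ℂ}
    {g g' : Fin d → E d → ℂ} (h : IsWeakGrad U u g) (h' : IsWeakGrad U u g') (j : Fin d) :
    ∀ᵐ x ∂(volume.restrict U), g j x = g' j x := by
  have : IsFiniteMeasure (volume.restrict U) := ⟨by rwa [Measure.restrict_apply_univ]⟩
  have hint : IntegrableOn (fun x => g j x - g' j x) U :=
    ((h.1 j).sub (h'.1 j)).integrable (by norm_num)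
  have key := hU.ae_eq_zero_of_integral_contDiff_smul_eq_zero hint.locallyIntegrableOn
    fun φ hφ hc hs => by
      have h1 := (h.2 φ hφ hc hs j).symm.trans (h'.2 φ hφ hc hs j)
      have h2 : ∫ x, φ x • (g j x - g' j x) = ∫ x in U, φ x • (g j x - g' j x) :=
        (setIntegral_eq_integral_of_forall_compl_eq_zero fun x hx => by
          rw [image_eq_zero_of_notMem_tsupport fun h => hx (hs h), zero_smul]).symm
      have h3 : ∀ x, φ x • (g j x - g' j x) =
          g j x * ((φ x : ℝ) : ℂ) - g' j x * ((φ x : ℝ) : ℂ) := fun x => by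
        rw [Complex.real_smul]; ring
      rw [h2]
      simp only [h3]
      rw [integral_sub (integrable_mul_test (h.1 j) hφ.continuous hc)
        (integrable_mul_test (h'.1 j) hφ.continuous hc), neg_inj.1 h1, sub_self]
  refine (ae_restrict_iff' hU.measurableSet).2 ?_
  filter_upwards [key] with x hx hxU
  exact sub_eq_zero.1 (hx hxU)

theorem MemH1.isWeakGrad {U : Set (E d)} {u : E d → ℂ} (h : MemH1 U u) :
    IsWeakGrad U u (weakGrad U u) := by
  rw [weakGrad, dif_pos h.2]
  exact h.2.choose_spec

end WeakGradient

/-! ### Interpolation on a common face -/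

section Relabelling

variable {d : ℕ}

theorem bary_permMap (σ : Equiv.Perm (Fin (d + 1))) (x : E d) (t : Fin (d + 1)) :
    bary (permMap σ x) t = bary x (σ.symm t) := by
  refine Fin.cases ?_ (fun j => rfl) t
  have h1 : ∑ t, bary x (σ.symm t) = 1 := by
    rw [Equiv.sum_comp σ.symm (bary x), sum_bary]
  rw [Fin.sum_univ_succ] at h1
  rw [bary_zero, ← h1]
  exact add_sub_cancel_right _ _

theorem permMap_mem_refSimplex (σ : Equiv.Perm (Fin (d + 1))) {x : E d} (hx : x ∈ refSimplex d) :
    permMap σ x ∈ refSimplex d := fun s => by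
  rw [bary_permMap]; exact hx _

theorem permMap_refNode {p : ℕ} (hp : 1 ≤ p) (σ : Equiv.Perm (Fin (d + 1)))
    {a : Fin (d + 1) → ℕ} (ha : a ∈ nodeIdx d p) :
    permMap σ (refNode p a : E d) = refNode p (a ∘ σ.symm) := by
  ext j
  exact bary_refNode hp (mem_nodeIdx.1 ha) _

theorem lagrange_permMap (p : ℕ) (σ : Equiv.Perm (Fin (d + 1))) (a : Fin (d + 1) → ℕ) (x : E d) :
    lagrange p (a ∘ σ.symm) (permMap σ x) = lagrange p a x := by
  simp only [lagrange, bary_permMap, Function.comp_apply]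
  exact Equiv.prod_comp σ.symm
    (fun s => ∏ m ∈ Finset.range (a s), ((p : ℝ) * bary x s - m) / (m + 1))

theorem lagrange_eq_zero_of_mem_refFace {p : ℕ} {S : Finset (Fin (d + 1))} {x : E d}
    (hx : x ∈ refFace S) {a : Fin (d + 1) → ℕ} {s : Fin (d + 1)} (hs : s ∉ S) (ha : a s ≠ 0) :
    lagrange p a x = 0 := by
  refine Finset.prod_eq_zero (Finset.mem_univ s)
    (Finset.prod_eq_zero (Finset.mem_range.2 (Nat.pos_of_ne_zero ha)) ?_)
  simp [hx.2 s hs]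

theorem refNode_mem_refFace {p : ℕ} (hp : 1 ≤ p) {S : Finset (Fin (d + 1))}
    {a : Fin (d + 1) → ℕ} (ha : a ∈ nodeIdx d p) (h : ∀ s, s ∉ S → a s = 0) :
    (refNode p a : E d) ∈ refFace S := by
  refine ⟨refNode_mem_refSimplex hp (mem_nodeIdx.1 ha), fun s hs => ?_⟩
  rw [bary_refNode hp (mem_nodeIdx.1 ha), h s hs]
  simp

/-- Nodal interpolants on two elements with a common face coincide on that face. -/
theorem refInterp_permMap {p : ℕ} (hp : 1 ≤ p) {S : Finset (Fin (d + 1))}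
    (σ : Equiv.Perm (Fin (d + 1))) {f g : E d → ℂ}
    (hfg : ∀ x ∈ refFace S, f x = g (permMap σ x)) {x : E d} (hx : x ∈ refFace S) :
    refInterp p g (permMap σ x) = refInterp p f x := by
  symm
  refine Finset.sum_equiv (σ.arrowCongr (Equiv.refl ℕ)) (fun a => ?_) fun a ha => ?_
  · change a ∈ nodeIdx d p ↔ a ∘ σ.symm ∈ nodeIdx d p
    rw [mem_nodeIdx, mem_nodeIdx]
    exact Eq.congr_left (Equiv.sum_comp σ.symm a).symm
  · change _ = (lagrange p (a ∘ σ.symm) (permMap σ x) : ℂ) * g (refNode p (a ∘ σ.symm))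
    rw [lagrange_permMap]
    -- A node off the face does not matter: its basis function vanishes on the face. At a node on
    -- the face the two functions have the same value.
    by_cases h : ∀ s, s ∉ S → a s = 0
    · rw [hfg _ (refNode_mem_refFace hp ha h), permMap_refNode hp σ ha]
    · push Not at h
      obtain ⟨s, hs, has⟩ := h
      rw [lagrange_eq_zero_of_mem_refFace hx hs has]
      simp

end Relabelling

/-! ### Elementary properties of meshes -/

namespace Mesh

variable {d : ℕ} {Ω : Set (E d)} (T : Mesh Ω)

theorem injOn_map (i : Fin T.n) : InjOn (T.map i) (refSimplex d) := fun x hx y hy h => by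
  rw [← T.left_inv i x hx, ← T.left_inv i y hy, h]

theorem isCompact_elem (i : Fin T.n) : IsCompact (T.elem i) :=
  isCompact_refSimplex.image_of_continuousOn (T.continuousOn_map i)

/-- The arbitrary choice of an element in `interp` is harmless: two elements sharing the point
parametrize their common face up to a permutation of vertices, and nodal interpolation respects
this. -/
theorem interp_map {p : ℕ} (hp : 1 ≤ p) (w : E d → ℂ) (i : Fin T.n) {x : E d}
    (hx : x ∈ refSimplex d) :
    T.interp p w (T.map i x) = refInterp p (fun y => w (T.map i y)) x := by
  obtain ⟨k, hk, hint⟩ : ∃ k, T.map i x ∈ T.elem k ∧ T.interp p w (T.map i x) =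
      refInterp p (fun y => w (T.map k y)) (T.inv k (T.map i x)) := by
    have h : ∃ k, T.map i x ∈ T.elem k := ⟨i, x, hx, rfl⟩
    refine ⟨h.choose, h.choose_spec, ?_⟩
    rw [interp, dif_pos h]
  rw [hint]
  by_cases hik : i = k
  · subst hik
    rw [T.left_inv i x hx]
  · obtain ⟨S, σ, -, hS, hσ⟩ := T.conforming i k hik
    obtain ⟨x', hx', hxx'⟩ : T.map i x ∈ T.map i '' refFace S := by
      rw [← hS]; exact ⟨⟨x, hx, rfl⟩, hk⟩
    have hxS : x ∈ refFace S := by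
      rwa [← T.injOn_map i hx'.1 hx hxx']
    rw [hσ x hxS, T.left_inv k _ (permMap_mem_refSimplex σ hx)]
    exact refInterp_permMap hp σ (fun y hy => by rw [hσ y hy]) hxS

theorem interior_elem (i : Fin T.n) :
    interior (T.elem i) = T.map i '' interior (refSimplex d) := (T.image_interior i).symm

theorem elem_diff_interior_subset (i : Fin T.n) :
    T.elem i \ interior (T.elem i) ⊆ T.map i '' (refSimplex d \ interior (refSimplex d)) := by
  rintro _ ⟨⟨x, hx, rfl⟩, hx'⟩
  refine ⟨x, ⟨hx, fun h => hx' ?_⟩, rfl⟩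
  rw [T.interior_elem]
  exact mem_image_of_mem _ h

/-- A common point lies on a proper face, where some barycentric coordinate is zero; in the interior
all are positive. -/
theorem disjoint_interior_elem (hd : 1 ≤ d) {i j : Fin T.n} (hij : i ≠ j) :
    Disjoint (interior (T.elem i)) (T.elem j) := by
  rw [Set.disjoint_left]
  intro y hy hyj
  rw [T.interior_elem] at hy
  obtain ⟨x, hx, rfl⟩ := hy
  obtain ⟨S, σ, hSu, hS, -⟩ := T.conforming i j hij
  obtain ⟨x', hx', hxx'⟩ : T.map i x ∈ T.map i '' refFace S := by
    rw [← hS]; exact ⟨⟨x, interior_subset hx, rfl⟩, hyj⟩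
  have hxS : x ∈ refFace S := by
    rwa [← T.injOn_map i hx'.1 (interior_subset hx) hxx']
  obtain ⟨s, hs⟩ : ∃ s, s ∉ S := by
    by_contra! h
    exact hSu (Finset.eq_univ_iff_forall.2 h)
  rw [interior_refSimplex hd] at hx
  exact (hx s).ne' (hxS.2 s hs)

theorem elem_subset_closure (i : Fin T.n) : T.elem i ⊆ closure Ω := by
  rw [← T.cover]; exact subset_iUnion (fun i => T.map i '' refSimplex d) i

theorem isCompact_closure {d : ℕ} {Ω : Set (E d)} (T : Mesh Ω) : IsCompact (closure Ω) := by
  rw [← T.cover]; exact isCompact_iUnion fun i => T.isCompact_elem i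

theorem diam_pos (hd : 1 ≤ d) (i : Fin T.n) : 0 < T.diam i := by
  have h0 : (0 : E d) ∈ refSimplex d := zero_mem_refSimplex
  have h1 : (e ⟨0, hd⟩ : E d) ∈ refSimplex d := by
    intro s
    refine Fin.cases ?_ (fun j => ?_) s
    · simp [e]
    · rw [bary_succ]
      by_cases hj : j = ⟨0, hd⟩ <;> simp [e, hj]
  have hne : T.map i 0 ≠ T.map i (e ⟨0, hd⟩) := fun h => by
    have h2 := T.injOn_map i h0 h1 h
    have h3 := norm_e (d := d) ⟨0, hd⟩
    rw [← h2, norm_zero] at h3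
    exact zero_ne_one h3
  exact (dist_pos.2 hne).trans_le (Metric.dist_le_diam_of_mem (T.isCompact_elem i).isBounded
    (mem_image_of_mem _ h0) (mem_image_of_mem _ h1))

theorem diam_le_diam (i : Fin T.n) : T.diam i ≤ Metric.diam Ω := by
  rw [← Metric.diam_closure Ω]
  exact Metric.diam_mono (T.elem_subset_closure i) T.isCompact_closure.isBounded

theorem diam_le_localWidth {U : Set (E d)} {i : Fin T.n} (hi : T.elem i ⊆ closure U) :
    T.diam i ≤ T.localWidth U :=
  le_ciSup (f := fun i : {i : Fin T.n // T.elem i ⊆ closure U} => T.diam i)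
    (Set.finite_range _).bddAbove ⟨i, hi⟩

theorem localWidth_nonneg (U : Set (E d)) : 0 ≤ T.localWidth U :=
  Real.iSup_nonneg fun _ => Metric.diam_nonneg

end Mesh

/-! ### Regular elements -/

section Elements

variable {d : ℕ}

/-- An element with the map `F`, the inverse map `G` and size `h`: `‖D^m F‖ ≤ C h b^{m-1}` for
`1 ≤ m ≤ n + 1`, `D^{n+1} F` is Lipschitz with constant `C h b^{n+1}`, and `‖D G‖ ≤ C / h`. -/
structure RegularElement (F G : E d → E d) (n : ℕ) (h C b : ℝ) : Prop where
  h_pos : 0 < h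
  one_le_C : 1 ≤ C
  b_nonneg : 0 ≤ b
  left_inv : ∀ x ∈ refSimplex d, G (F x) = x
  continuousOn : ContinuousOn F (refSimplex d)
  image_interior : F '' interior (refSimplex d) = interior (F '' refSimplex d)
  differentiableAt : ∀ x ∈ interior (refSimplex d), DifferentiableAt ℝ F x
  sClass : SClass (interior (refSimplex d)) n (fderiv ℝ F) (C * h) b
  differentiableAt_inv : ∀ y ∈ interior (F '' refSimplex d), DifferentiableAt ℝ G y
  norm_fderiv_inv_le : ∀ y ∈ interior (F '' refSimplex d), ‖fderiv ℝ G y‖ ≤ C / h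
  diam_le : Metric.diam (F '' refSimplex d) ≤ h

namespace RegularElement

variable {F G : E d → E d} {n : ℕ} {h C b : ℝ}

theorem mapsTo (R : RegularElement F G n h C b) :
    MapsTo F (interior (refSimplex d)) (interior (F '' refSimplex d)) := by
  rw [← R.image_interior]; exact mapsTo_image _ _

theorem norm_sub_le (hd : 1 ≤ d) (R : RegularElement F G n h C b) {x y : E d}
    (hx : x ∈ refSimplex d) (hy : y ∈ refSimplex d) : ‖F y - F x‖ ≤ C * h * ‖y - x‖ :=
  norm_sub_le_of_locLip_refSimplex hd R.continuousOn
    (locLip_of_fderiv_le isOpen_interior R.differentiableAt fun _ hx => R.sClass.norm_le hx)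
    (mul_nonneg (zero_le_one.trans R.one_le_C) R.h_pos.le) hx hy

theorem fderiv_inv_apply_fderiv (R : RegularElement F G n h C b) {x : E d}
    (hx : x ∈ interior (refSimplex d)) (v : E d) : fderiv ℝ G (F x) (fderiv ℝ F x v) = v := by
  have h1 := (R.differentiableAt_inv _ (R.mapsTo hx)).hasFDerivAt.comp x
    (R.differentiableAt x hx).hasFDerivAt
  have h2 : G ∘ F =ᶠ[𝓝 x] id := by
    filter_upwards [isOpen_interior.mem_nhds hx] with y hy
    exact R.left_inv y (interior_subset hy)
  have h3 := h1.unique ((hasFDerivAt_id x).congr_of_eventuallyEq h2)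
  exact DFunLike.congr_fun h3 v

/-- The inverse of the element map is Lipschitz on the closed element. -/
theorem exists_norm_sub_le_inv (hd : 1 ≤ d) (R : RegularElement F G n h C b) :
    ∃ M, 0 ≤ M ∧ ∀ x ∈ refSimplex d, ∀ y ∈ refSimplex d, ‖y - x‖ ≤ M * ‖F y - F x‖ := by
  have hC : 0 < C := one_pos.trans_le R.one_le_C
  have hh := R.h_pos
  have hb := R.b_nonneg
  set M₂ := C * h * b with hM₂
  have hM₂0 : 0 ≤ M₂ := by positivity
  have hcv : Convex ℝ (interior (refSimplex d)) := convex_refSimplex.interior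
  -- The element need not be convex, so the bound on `D G` cannot be integrated along segments in
  -- it. Instead `D F x` is bounded below by `h / C`, and `F` deviates from its linearization
  -- quadratically, with `M₂` the Lipschitz constant of `D F`.
  have hquad : ∀ x ∈ interior (refSimplex d), ∀ y ∈ interior (refSimplex d),
      ‖y - x‖ ≤ C / h * (‖F y - F x‖ + M₂ * ‖y - x‖ * ‖y - x‖) := by
    intro x hx y hy
    have hseg := hcv.segment_subset hx hy
    have h1 : ‖F y - F x - fderiv ℝ F x (y - x)‖ ≤ M₂ * ‖y - x‖ * ‖y - x‖ := by
      refine (convex_segment x y).norm_image_sub_le_of_norm_fderiv_le'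
        (fun z hz => R.differentiableAt z (hseg hz)) (fun z hz => ?_)
        (left_mem_segment ℝ x y) (right_mem_segment ℝ x y)
      refine ((R.sClass.locLip isOpen_interior).norm_sub_le_of_convex hcv hx (hseg hz)).trans ?_
      gcongr
      exact norm_sub_le_of_mem_segment hz
    have h2 : ‖y - x‖ ≤ C / h * ‖fderiv ℝ F x (y - x)‖ := by
      conv_lhs => rw [← R.fderiv_inv_apply_fderiv hx (y - x)]
      exact ((fderiv ℝ G (F x)).le_opNorm _).trans
        (by gcongr; exact R.norm_fderiv_inv_le _ (R.mapsTo hx))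
    refine h2.trans ?_
    gcongr
    have h3 := norm_sub_norm_le (fderiv ℝ F x (y - x)) (F y - F x)
    rw [norm_sub_rev (F y - F x)] at h1
    linarith
  -- For points closer than `r` the quadratic term is absorbed; the `+ 1` avoids division by zero
  -- when `M₂ = 0`, as for affine maps.
  obtain ⟨r, hr, hrle⟩ : ∃ r : ℝ, 0 < r ∧ C / h * (M₂ * r) ≤ 1 / 2 := by
    refine ⟨(2 * (C / h) * M₂ + 1)⁻¹, by positivity, ?_⟩
    rw [← mul_assoc, ← div_eq_mul_inv, div_le_iff₀ (by positivity)]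
    have : 0 ≤ C / h * M₂ := by positivity
    linarith
  -- For points at distance at least `r`, injectivity and compactness give a lower bound. It is not
  -- uniform over elements, which is enough for membership in H¹.
  obtain ⟨m, hm, hmle⟩ : ∃ m : ℝ, 0 < m ∧ ∀ x ∈ refSimplex d, ∀ y ∈ refSimplex d,
      r ≤ ‖y - x‖ → m ≤ ‖F y - F x‖ := by
    set P : Set (E d × E d) := (refSimplex d ×ˢ refSimplex d) ∩ {z | r ≤ ‖z.2 - z.1‖} with hP
    have hPc : IsCompact P := (isCompact_refSimplex.prod isCompact_refSimplex).inter_right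
      (isClosed_le (by fun_prop) (by fun_prop))
    have hcont : ContinuousOn (fun z : E d × E d => ‖F z.2 - F z.1‖) P :=
      ((R.continuousOn.comp continuousOn_snd fun z hz => hz.1.2).sub
        (R.continuousOn.comp continuousOn_fst fun z hz => hz.1.1)).norm
    rcases P.eq_empty_or_nonempty with hPe | hPn
    · refine ⟨1, one_pos, fun x hx y hy hxy => ?_⟩
      have : (x, y) ∈ P := ⟨⟨hx, hy⟩, hxy⟩
      rw [hPe] at this
      exact absurd this (notMem_empty _)
    · obtain ⟨z, hz, hmin⟩ := hPc.exists_isMinOn hPn hcont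
      refine ⟨‖F z.2 - F z.1‖, ?_, fun x hx y hy hxy => hmin (a := (x, y)) ⟨⟨hx, hy⟩, hxy⟩⟩
      rw [norm_pos_iff, sub_ne_zero]
      intro heq
      have h1 : z.2 = z.1 := by rw [← R.left_inv _ hz.1.2, heq, R.left_inv _ hz.1.1]
      have h2 : r ≤ ‖z.2 - z.1‖ := hz.2
      rw [h1, sub_self, norm_zero] at h2
      linarith
  set M := max (2 * (C / h)) (2 / m) with hM
  have hint : ∀ x ∈ interior (refSimplex d), ∀ y ∈ interior (refSimplex d),
      ‖y - x‖ ≤ M * ‖F y - F x‖ := by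
    intro x hx y hy
    rcases le_total r ‖y - x‖ with hc | hc
    · have h1 := hmle x (interior_subset hx) y (interior_subset hy) hc
      calc ‖y - x‖ ≤ 2 := norm_sub_le_two_of_mem_refSimplex (interior_subset hx)
            (interior_subset hy)
        _ = 2 / m * m := by field_simp
        _ ≤ M * ‖F y - F x‖ := by
          gcongr
          exact le_max_right _ _
    · have h1 := hquad x hx y hy
      have h2 : C / h * (M₂ * ‖y - x‖ * ‖y - x‖) ≤ 1 / 2 * ‖y - x‖ := by
        rw [← mul_assoc]
        refine mul_le_mul_of_nonneg_right (le_trans ?_ hrle) (norm_nonneg _)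
        gcongr
      have h3 : ‖y - x‖ ≤ 2 * (C / h) * ‖F y - F x‖ := by
        rw [mul_add] at h1
        linarith
      exact h3.trans (by gcongr; exact le_max_left _ _)
  refine ⟨M, le_trans (by positivity) (le_max_left _ _), fun x hx y hy => ?_⟩
  obtain ⟨z, hz⟩ := nonempty_interior_refSimplex hd
  have hF : ∀ w ∈ refSimplex d, Tendsto (fun t : ℝ => F (z + t • (w - z))) (𝓝[<] 1) (𝓝 (F w)) := by
    intro w hw
    have h1 : ContinuousOn (fun t : ℝ => F (z + t • (w - z))) (Icc 0 1) :=
      R.continuousOn.comp (by fun_prop) fun t ht =>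
        convex_refSimplex.add_smul_sub_mem (interior_subset hz) hw ht
    have h2 := (h1 1 (right_mem_Icc.2 zero_le_one)).tendsto.mono_left
      (nhdsWithin_mono (1 : ℝ) Ico_subset_Icc_self)
    rw [nhdsWithin_Ico_eq_nhdsLT one_pos] at h2
    simpa using h2
  have hI : ∀ w : E d, Tendsto (fun t : ℝ => z + t • (w - z)) (𝓝[<] 1) (𝓝 w) := fun w => by
    have h1 : ContinuousAt (fun t : ℝ => z + t • (w - z)) 1 := by fun_prop
    simpa using h1.tendsto.mono_left (nhdsWithin_le_nhds (s := Iio 1))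
  refine le_of_tendsto_of_tendsto ((hI y).sub (hI x)).norm
    (((hF y hy).sub (hF x hx)).norm.const_mul M) ?_
  filter_upwards [Ico_mem_nhdsLT (one_pos : (0 : ℝ) < 1)] with t ht
  exact hint _ (add_smul_sub_mem_interior_refSimplex hd hz hx ht) _
    (add_smul_sub_mem_interior_refSimplex hd hz hy ht)

/-- Lipschitz maps do not create `d`-dimensional Hausdorff measure from null sets, and on `ℝ^d` this
measure and Lebesgue measure have the same null sets. -/
theorem volume_image_diff_interior (hd : 1 ≤ d) (R : RegularElement F G n h C b) :
    volume (F '' (refSimplex d \ interior (refSimplex d))) = 0 := by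
  have hCh : 0 ≤ C * h := mul_nonneg (zero_le_one.trans R.one_le_C) R.h_pos.le
  have hl : LipschitzOnWith ⟨C * h, hCh⟩ F (refSimplex d \ interior (refSimplex d)) :=
    LipschitzOnWith.of_dist_le_mul fun y hy x hx => by
      rw [dist_eq_norm, dist_eq_norm]
      exact R.norm_sub_le hd hx.1 hy.1
  have h1 := hl.hausdorffMeasure_image_le (d := d) (by positivity)
  have hac : ∀ μ ν : Measure (E d), μ.IsAddHaarMeasure → ν.IsAddHaarMeasure →
      ∀ s, ν s = 0 → μ s = 0 := fun μ ν _ _ s hs => Measure.absolutelyContinuous_isAddHaarMeasure μ ν hs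
  have h2 : (Measure.hausdorffMeasure d : Measure (E d))
      (refSimplex d \ interior (refSimplex d)) = 0 :=
    hac _ volume inferInstance inferInstance _ volume_refSimplex_diff_interior
  rw [h2, mul_zero] at h1
  exact hac volume (Measure.hausdorffMeasure d) inferInstance inferInstance _ (le_antisymm h1 (by simp))

end RegularElement

theorem sClass_const {U : Set (E d)} {n : ℕ} {G : Type} [NormedAddCommGroup G] [NormedSpace ℝ G]
    {a : G} {A c : ℝ} (ha : ‖a‖ ≤ A) (hc : 0 ≤ c) : SClass U n (fun _ => a) A c := by
  have hA : 0 ≤ A := (norm_nonneg a).trans ha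
  induction n generalizing G A with
  | zero =>
    refine ⟨fun _ _ => ha, fun x _ => Eventually.of_forall fun y => ?_⟩
    simp only [sub_self, norm_zero]
    positivity
  | succ n ih =>
    refine ⟨fun _ _ => ⟨ha, differentiableAt_const a⟩, ?_⟩
    rw [fderiv_fun_const]
    refine ih (a := (0 : E d →L[ℝ] G)) ?_ (mul_nonneg hA hc)
    rw [norm_zero]
    exact mul_nonneg hA hc

end Elements

/-! ### Affine and curved meshes have regular elements -/

namespace Mesh

variable {d : ℕ} {Ω : Set (E d)}

/-- The rate is `0`, since higher derivatives of an affine map vanish. The linear part maps each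
coordinate vector to a difference of two points of the element, which gives `‖L‖ ≤ d * h`; the
inscribed ball bounds its inverse by `1 / r ≤ 2 |κ| / h`. -/
theorem regularElement_of_shapeRegularSimplicial (hd : 1 ≤ d) (n : ℕ) {T : Mesh Ω} {κ : ℝ}
    (hT : T.ShapeRegularSimplicial κ) (i : Fin T.n) :
    RegularElement (T.map i) (T.inv i) n (T.diam i) (max 1 (max d (2 * |κ|))) 0 := by
  obtain ⟨⟨A, hA⟩, z, r, hr, hball, hκ⟩ := hT i
  set h := T.diam i with hh
  have hpos : 0 < h := T.diam_pos hd i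
  set L : E d →L[ℝ] E d := LinearMap.toContinuousLinearMap A.linear with hL
  have hAL : ∀ x y, A y - A x = L (y - x) := fun x y => (A.linearMap_vsub y x).symm
  have hAx : ∀ x, A x = L x + A 0 := fun x => by
    rw [← sub_eq_iff_eq_add, hAL, sub_zero]
  have hAd : ∀ x, HasFDerivAt A L x := fun x => by
    rw [show (A : E d → E d) = fun x => L x + A 0 from funext hAx]
    exact L.hasFDerivAt.add_const _
  have hev : ∀ x ∈ interior (refSimplex d), T.map i =ᶠ[𝓝 x] A := fun x hx => by
    filter_upwards [isOpen_interior.mem_nhds hx] with y hy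
    exact hA (interior_subset hy)
  have hbdd : Bornology.IsBounded (T.elem i) := (T.isCompact_elem i).isBounded
  have hLe : ∀ j, ‖L (e j)‖ ≤ h := fun j => by
    have h0 : (0 : E d) ∈ refSimplex d := zero_mem_refSimplex
    have h1 : (e j : E d) ∈ refSimplex d := by
      intro s
      refine Fin.cases ?_ (fun k => ?_) s
      · simp [e]
      · rw [bary_succ]
        by_cases hk : k = j <;> simp [e, hk]
    have h2 := Metric.dist_le_diam_of_mem hbdd (mem_image_of_mem (T.map i) h1)
      (mem_image_of_mem (T.map i) h0)
    rwa [hA h1, hA h0, dist_eq_norm, hAL, sub_zero] at h2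
  have hLn : ‖L‖ ≤ d * h := (norm_le_sum_apply_e L).trans
    ((Finset.sum_le_sum fun j _ => hLe j).trans (by simp))
  have hpre : ∀ w ∈ Metric.closedBall z r, ∃ x ∈ refSimplex d, A x = w := fun w hw => by
    obtain ⟨x, hx, rfl⟩ := hball hw
    exact ⟨x, hx, (hA hx).symm⟩
  -- Antipodal points `z ± u` of the inscribed sphere have preimages at distance at most `2`, and
  -- `L` maps the difference of these preimages to `2 u`.
  have hlow : ∀ w : E d, ∃ x, L x = w ∧ ‖x‖ ≤ 1 / r * ‖w‖ := by
    intro w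
    rcases eq_or_ne w 0 with rfl | hw
    · exact ⟨0, by simp⟩
    · have hw' : 0 < ‖w‖ := norm_pos_iff.2 hw
      set u := (r / ‖w‖) • w with hu
      have hun : ‖u‖ = r := by
        rw [hu, norm_smul, Real.norm_of_nonneg (by positivity)]; field_simp
      obtain ⟨x, hx, hxw⟩ := hpre (z + u) (by simp [hun])
      obtain ⟨y, hy, hyw⟩ := hpre (z - u) (by simp [hun])
      refine ⟨(‖w‖ / (2 * r)) • (x - y), ?_, ?_⟩
      · rw [map_smul, ← hAL, hxw, hyw, add_sub_sub_cancel, ← two_smul ℝ u, hu, smul_smul,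
          smul_smul]
        rw [show ‖w‖ / (2 * r) * 2 * (r / ‖w‖) = 1 by field_simp, one_smul]
      · rw [norm_smul, Real.norm_of_nonneg (by positivity)]
        calc ‖w‖ / (2 * r) * ‖x - y‖ ≤ ‖w‖ / (2 * r) * 2 := by
              gcongr; exact norm_sub_le_two_of_mem_refSimplex hy hx
          _ = _ := by field_simp
  have hsurj : Function.Surjective A.linear := fun w => by
    obtain ⟨x, hx, -⟩ := hlow w
    exact ⟨x, hx⟩
  have hinj : Function.Injective A.linear := LinearMap.injective_iff_surjective.2 hsurj
  set Φ := (LinearEquiv.ofBijective A.linear ⟨hinj, hsurj⟩).toContinuousLinearEquiv with hΦ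
  have hΦL : ∀ x, Φ x = L x := fun _ => rfl
  have hΦinv : ‖(Φ.symm : E d →L[ℝ] E d)‖ ≤ 1 / r := by
    refine ContinuousLinearMap.opNorm_le_bound _ (by positivity) fun w => ?_
    obtain ⟨x, hx, hxw⟩ := hlow w
    have : Φ.symm w = x := by rw [ContinuousLinearEquiv.symm_apply_eq, hΦL, hx]
    simpa [this] using hxw
  have hinv : ∀ y ∈ T.elem i, T.inv i y = Φ.symm (y - A 0) := by
    rintro _ ⟨x, hx, rfl⟩
    rw [T.left_inv i x hx, hA hx, hAx, add_sub_cancel_right, ← hΦL,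
      ContinuousLinearEquiv.symm_apply_apply]
  have hinvd : ∀ y ∈ interior (T.elem i),
      HasFDerivAt (T.inv i) (Φ.symm : E d →L[ℝ] E d) y := fun y hy => by
    have h1 : HasFDerivAt (fun y => Φ.symm (y - A 0)) (Φ.symm : E d →L[ℝ] E d) y := by
      have h2 := (Φ.symm : E d →L[ℝ] E d).hasFDerivAt (x := y)
      have h3 := h2.sub_const ((Φ.symm : E d →L[ℝ] E d) (A 0))
      refine h3.congr_of_eventuallyEq (Eventually.of_forall fun w => ?_)
      exact map_sub Φ.symm w (A 0)
    refine h1.congr_of_eventuallyEq ?_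
    filter_upwards [isOpen_interior.mem_nhds hy] with w hw
    exact hinv w (interior_subset hw)
  refine ⟨hpos, le_max_left _ _, le_rfl, T.left_inv i, T.continuousOn_map i, T.image_interior i,
    fun x hx => ((hev x hx).differentiableAt_iff).2 (hAd x).differentiableAt, ?_,
    fun y hy => (hinvd y hy).differentiableAt, fun y hy => ?_, le_rfl⟩
  · refine (sClass_const (a := L) ?_ le_rfl).congr isOpen_interior fun x hx => ?_
    · refine hLn.trans ?_
      gcongr
      exact (le_max_left _ _).trans (le_max_right _ _)
    · rw [(hev x hx).fderiv_eq, (hAd x).fderiv]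
  · rw [(hinvd y hy).fderiv]
    refine hΦinv.trans ?_
    rw [div_le_div_iff₀ hr hpos, one_mul]
    calc h ≤ κ * (2 * r) := hκ
      _ ≤ |κ| * (2 * r) := by gcongr; exact le_abs_self κ
      _ = 2 * |κ| * r := by ring
      _ ≤ _ := by
        gcongr
        exact (le_max_right _ _).trans (le_max_right _ _)

theorem _root_.FEM.PartialsBounded.mono {G : Type*} [NormedAddCommGroup G] [NormedSpace ℝ G]
    {m : ℕ} {K : Set (E d)} {f : E d → G} {B B' : ℝ} (h : PartialsBounded m K f B)
    (hB : B ≤ B') : PartialsBounded m K f B' := fun j =>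
  (h j).mono fun _ hx => hx.trans hB

/-- The rate is `h / L`, because `C L (h / L)^m = C h (h / L)^(m - 1)`. -/
theorem regularElement_of_curvedRegular (hd : 1 ≤ d) {n : ℕ} {T : Mesh Ω} {C L : ℝ} (hL : 0 < L)
    (hT : T.CurvedRegular (n + 1) C L) (i : Fin T.n) :
    RegularElement (T.map i) (T.inv i) n (T.diam i) (max 1 ((d : ℝ) ^ (n + 2) * |C|))
      (T.diam i / L) := by
  obtain ⟨hF, hG, hb⟩ := hT i
  set h := T.diam i with hh
  have hpos : 0 < h := T.diam_pos hd i
  obtain ⟨hF1, hF2⟩ := sClass_fderiv_of_partials hd hF (A := |C| * h) (c := h / L)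
    (by positivity) (by positivity) fun m h1 h2 => (hb m h1 h2).1.mono (by
      obtain ⟨m, rfl⟩ := Nat.exists_eq_add_of_le' h1
      rw [Nat.add_sub_cancel, pow_succ]
      calc C * L * ((h / L) ^ m * (h / L)) = C * (h * (h / L) ^ m) := by field_simp
        _ ≤ |C| * (h * (h / L) ^ m) := by gcongr; exact le_abs_self C
        _ = _ := by ring)
  obtain ⟨hG1, hG2⟩ := sClass_fderiv_of_partials hd hG (A := |C| * h⁻¹) (c := h⁻¹)
    (by positivity) (by positivity) fun m h1 h2 => (hb m h1 h2).2.mono (by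
      obtain ⟨m, rfl⟩ := Nat.exists_eq_add_of_le' h1
      rw [Nat.add_sub_cancel, pow_succ]
      calc C * (h⁻¹ ^ m * h⁻¹) ≤ |C| * (h⁻¹ ^ m * h⁻¹) := by gcongr; exact le_abs_self C
        _ = _ := by ring)
  refine ⟨hpos, le_max_left _ _, by positivity, T.left_inv i, T.continuousOn_map i,
    T.image_interior i, hF1, ?_, hG1, fun y hy => ?_, le_rfl⟩
  · refine hF2.mono (by positivity) ?_ (by positivity) le_rfl
    rw [← mul_assoc]
    gcongr
    exact le_max_right _ _
  · refine (hG2.norm_le hy).trans ?_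
    rw [← mul_assoc, ← div_eq_mul_inv]
    gcongr
    exact le_max_right _ _

end Mesh

/-! ### Estimates on a single element -/

namespace RegularElement

variable {d : ℕ} {F G : E d → E d} {n : ℕ} {h C b : ℝ}

theorem inv_mem (R : RegularElement F G n h C b) {y : E d}
    (hy : y ∈ interior (F '' refSimplex d)) :
    G y ∈ interior (refSimplex d) ∧ F (G y) = y := by
  rw [← R.image_interior] at hy
  obtain ⟨x, hx, rfl⟩ := hy
  rw [R.left_inv x (interior_subset hx)]
  exact ⟨hx, rfl⟩

theorem image_inv_interior (R : RegularElement F G n h C b) :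
    G '' interior (F '' refSimplex d) = interior (refSimplex d) := by
  refine Subset.antisymm ?_ fun x hx => ⟨F x, R.mapsTo hx, R.left_inv x (interior_subset hx)⟩
  rintro _ ⟨y, hy, rfl⟩
  exact (R.inv_mem hy).1

theorem injOn_inv (R : RegularElement F G n h C b) : InjOn G (interior (F '' refSimplex d)) :=
  fun y hy z hz hyz => by rw [← (R.inv_mem hy).2, hyz, (R.inv_mem hz).2]

theorem isCompact_image (R : RegularElement F G n h C b) : IsCompact (F '' refSimplex d) :=
  isCompact_refSimplex.image_of_continuousOn R.continuousOn

theorem volume_interior_lt_top (R : RegularElement F G n h C b) :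
    volume (interior (F '' refSimplex d)) < ⊤ :=
  (measure_mono interior_subset).trans_lt R.isCompact_image.measure_lt_top

theorem measureReal_interior_le (R : RegularElement F G n h C b) :
    volume.real (interior (F '' refSimplex d)) ≤ h ^ d * volume.real (Metric.ball (0 : E d) 1) := by
  have hsub : interior (F '' refSimplex d) ⊆ Metric.closedBall (F 0) h := fun y hy => by
    rw [Metric.mem_closedBall]
    exact (Metric.dist_le_diam_of_mem R.isCompact_image.isBounded (interior_subset hy)
      (mem_image_of_mem F zero_mem_refSimplex)).trans R.diam_le
  refine (measureReal_mono hsub (Metric.isBounded_closedBall.measure_lt_top.ne)).trans ?_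
  rw [measureReal_def, Measure.addHaar_closedBall _ _ R.h_pos.le, ENNReal.toReal_mul,
    ENNReal.toReal_ofReal (pow_nonneg R.h_pos.le _), finrank_euclideanSpace_fin]
  rfl

/-- The derivative of a function that is given on an element by its pull-back. -/
theorem hasFDerivAt_of_pullback (R : RegularElement F G n h C b) {u r : E d → ℂ}
    (hu : ∀ x ∈ refSimplex d, u (F x) = r x) {y : E d} (hy : y ∈ interior (F '' refSimplex d))
    (hr : DifferentiableAt ℝ r (G y)) :
    HasFDerivAt u ((fderiv ℝ r (G y)).comp (fderiv ℝ G y)) y := by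
  have h1 := hr.hasFDerivAt.comp y (R.differentiableAt_inv y hy).hasFDerivAt
  refine h1.congr_of_eventuallyEq ?_
  filter_upwards [isOpen_interior.mem_nhds hy] with z hz
  obtain ⟨h2, h3⟩ := R.inv_mem hz
  rw [Function.comp_apply, ← hu _ (interior_subset h2), h3]

theorem norm_fderiv_le_of_pullback (R : RegularElement F G n h C b) {u r : E d → ℂ}
    (hu : ∀ x ∈ refSimplex d, u (F x) = r x) {y : E d} (hy : y ∈ interior (F '' refSimplex d))
    (hr : DifferentiableAt ℝ r (G y)) {B : ℝ} (hB : ‖fderiv ℝ r (G y)‖ ≤ B) :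
    ‖fderiv ℝ u y‖ ≤ B * (C / h) := by
  rw [(R.hasFDerivAt_of_pullback hu hy hr).fderiv]
  exact (ContinuousLinearMap.opNorm_comp_le _ _).trans
    (mul_le_mul hB (R.norm_fderiv_inv_le y hy) (norm_nonneg _) ((norm_nonneg _).trans hB))

section PolyPullback

variable {q : MvPolynomial (Fin d) ℂ} {v : E d → ℂ}

theorem exists_bounds_of_poly (R : RegularElement F G n h C b)
    (hv : ∀ x ∈ refSimplex d, v (F x) = polyFun q x) :
    ∃ B, 0 ≤ B ∧ ∀ y ∈ interior (F '' refSimplex d), ‖v y‖ ≤ B ∧ DifferentiableAt ℝ v y ∧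
      ‖fderiv ℝ v y‖ ≤ B := by
  obtain ⟨C₁, h₁⟩ := isCompact_refSimplex.exists_bound_of_continuousOn
    (contDiff_polyFun q).continuous.continuousOn (s := refSimplex d)
  obtain ⟨C₂, h₂⟩ := isCompact_refSimplex.exists_bound_of_continuousOn
    ((contDiff_polyFun q).continuous_fderiv (by simp)).continuousOn (s := refSimplex d)
  have hC₁ : 0 ≤ C₁ := (norm_nonneg _).trans (h₁ 0 zero_mem_refSimplex)
  refine ⟨max C₁ (C₂ * (C / h)), hC₁.trans (le_max_left _ _), fun y hy => ?_⟩
  obtain ⟨hG, hFG⟩ := R.inv_mem hy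
  have hd := differentiable_polyFun q (G y)
  refine ⟨?_, (R.hasFDerivAt_of_pullback hv hy hd).differentiableAt,
    (R.norm_fderiv_le_of_pullback hv hy hd (h₂ _ (interior_subset hG))).trans (le_max_right _ _)⟩
  rw [← hFG, hv _ (interior_subset hG)]
  exact (h₁ _ (interior_subset hG)).trans (le_max_left _ _)

theorem integrableOn_sq_of_bound (R : RegularElement F G n h C b) {f : E d → ℂ} {B : ℝ}
    (hm : AEStronglyMeasurable f (volume.restrict (interior (F '' refSimplex d))))
    (hB : ∀ y ∈ interior (F '' refSimplex d), ‖f y‖ ≤ B) :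
    IntegrableOn (fun y => ‖f y‖ ^ 2) (interior (F '' refSimplex d)) := by
  have : IsFiniteMeasure (volume.restrict (interior (F '' refSimplex d))) :=
    ⟨by rw [Measure.restrict_apply_univ]; exact R.volume_interior_lt_top⟩
  have h1 : MemLp f 2 (volume.restrict (interior (F '' refSimplex d))) :=
    MemLp.of_bound hm B ((ae_restrict_iff' isOpen_interior.measurableSet).2
      (Eventually.of_forall hB))
  exact (memLp_two_iff_integrable_sq_norm hm).1 h1

theorem integrableOn_sq_of_poly (R : RegularElement F G n h C b)
    (hv : ∀ x ∈ refSimplex d, v (F x) = polyFun q x) :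
    IntegrableOn (fun y => ‖v y‖ ^ 2) (interior (F '' refSimplex d)) ∧
    ∀ j, IntegrableOn (fun y => ‖fderiv ℝ v y (e j)‖ ^ 2) (interior (F '' refSimplex d)) := by
  obtain ⟨B, -, hB⟩ := R.exists_bounds_of_poly hv
  refine ⟨R.integrableOn_sq_of_bound (ContinuousOn.aestronglyMeasurable (fun y hy =>
    (hB y hy).2.1.continuousAt.continuousWithinAt) isOpen_interior.measurableSet)
    fun y hy => (hB y hy).1, fun j => R.integrableOn_sq_of_bound
    (measurable_fderiv_apply_const ℝ v (e j)).aestronglyMeasurable fun y hy =>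
    (norm_apply_e_le _ j).trans (hB y hy).2.2⟩

theorem integral_sq_ref_le (R : RegularElement F G n h C b)
    (hv : ∀ x ∈ refSimplex d, v (F x) = polyFun q x) :
    ∫ x in interior (refSimplex d), ‖polyFun q x‖ ^ 2 ≤
      (C / h) ^ d * ∫ y in interior (F '' refSimplex d), ‖v y‖ ^ 2 := by
  have heq : EqOn (fun y => ‖polyFun q (G y)‖ ^ 2) (fun y => ‖v y‖ ^ 2)
      (interior (F '' refSimplex d)) := fun y hy => by
    obtain ⟨hG, hFG⟩ := R.inv_mem hy
    simp only
    rw [← hv _ (interior_subset hG), hFG]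
  have h1 := setIntegral_image_le (g := fun x => ‖polyFun q x‖ ^ 2) isOpen_interior
    R.differentiableAt_inv R.norm_fderiv_inv_le R.injOn_inv (fun x => by positivity)
    ((R.integrableOn_sq_of_poly hv).1.congr_fun heq.symm isOpen_interior.measurableSet)
  rwa [R.image_inv_interior, setIntegral_congr_fun isOpen_interior.measurableSet heq] at h1

/-- The chain rule gains `(C h)²` from `D F`. One factor `d` comes from the sum over `j`, the other
from bounding an operator norm by partial derivatives. -/
theorem sum_integral_sq_ref_le (R : RegularElement F G n h C b)
    (hv : ∀ x ∈ refSimplex d, v (F x) = polyFun q x) :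
    ∑ j, ∫ x in interior (refSimplex d), ‖fderiv ℝ (polyFun q) x (e j)‖ ^ 2 ≤
      (d * d * C ^ 2) * ((C / h) ^ d * h ^ 2) *
        ∑ i, ∫ y in interior (F '' refSimplex d), ‖fderiv ℝ v y (e i)‖ ^ 2 := by
  have hh := R.h_pos
  have hC : 0 < C := one_pos.trans_le R.one_le_C
  set N₁ := ∑ i, ∫ y in interior (F '' refSimplex d), ‖fderiv ℝ v y (e i)‖ ^ 2 with hN₁
  have hint := (R.integrableOn_sq_of_poly hv).2
  have hj : ∀ j, ∫ x in interior (refSimplex d), ‖fderiv ℝ (polyFun q) x (e j)‖ ^ 2 ≤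
      (C / h) ^ d * ((C * h) ^ 2 * d * N₁) := by
    intro j
    have hpt : ∀ y ∈ interior (F '' refSimplex d), ‖fderiv ℝ (polyFun q) (G y) (e j)‖ ^ 2 ≤
        (C * h) ^ 2 * d * ∑ i, ‖fderiv ℝ v y (e i)‖ ^ 2 := by
      intro y hy
      obtain ⟨hG, hFG⟩ := R.inv_mem hy
      have h1 := R.hasFDerivAt_of_pullback hv hy (differentiable_polyFun q (G y))
      have h2 : fderiv ℝ (polyFun q) (G y) (e j) = fderiv ℝ v y (fderiv ℝ F (G y) (e j)) := by
        rw [h1.fderiv, ContinuousLinearMap.comp_apply]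
        conv_rhs => rw [← hFG]
        rw [hFG]
        have h3 := R.fderiv_inv_apply_fderiv hG (e j)
        rw [hFG] at h3
        rw [h3]
      have h4 : ‖fderiv ℝ (polyFun q) (G y) (e j)‖ ≤ ‖fderiv ℝ v y‖ * (C * h) := by
        rw [h2]
        refine ((fderiv ℝ v y).le_opNorm _).trans ?_
        gcongr
        have h5 := (fderiv ℝ F (G y)).le_opNorm (e j)
        rw [norm_e, mul_one] at h5
        exact h5.trans (R.sClass.norm_le hG)
      calc _ ≤ (‖fderiv ℝ v y‖ * (C * h)) ^ 2 := by gcongr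
        _ = (C * h) ^ 2 * ‖fderiv ℝ v y‖ ^ 2 := by ring
        _ ≤ (C * h) ^ 2 * (d * ∑ i, ‖fderiv ℝ v y (e i)‖ ^ 2) := by
          gcongr; exact sq_norm_le_sum_sq_apply_e _
        _ = _ := by ring
    have hintS : IntegrableOn (fun y => (C * h) ^ 2 * d * ∑ i, ‖fderiv ℝ v y (e i)‖ ^ 2)
        (interior (F '' refSimplex d)) :=
      (integrable_finsetSum _ fun i _ => hint i).const_mul _
    have hcontG : ContinuousOn (fun y => ‖fderiv ℝ (polyFun q) (G y) (e j)‖ ^ 2)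
        (interior (F '' refSimplex d)) := by
      have h1 : Continuous fun x => ‖fderiv ℝ (polyFun q) x (e j)‖ ^ 2 :=
        ((((contDiff_polyFun q).continuous_fderiv (by simp)).clm_apply continuous_const).norm).pow 2
      exact h1.comp_continuousOn fun y hy =>
        (R.differentiableAt_inv y hy).continuousAt.continuousWithinAt
    have hintG : IntegrableOn (fun y => ‖fderiv ℝ (polyFun q) (G y) (e j)‖ ^ 2)
        (interior (F '' refSimplex d)) := by
      refine hintS.mono' (hcontG.aestronglyMeasurable isOpen_interior.measurableSet) ?_
      refine (ae_restrict_iff' isOpen_interior.measurableSet).2 (Eventually.of_forall fun y hy => ?_)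
      rw [Real.norm_of_nonneg (by positivity)]
      exact hpt y hy
    have h1 := setIntegral_image_le (g := fun x => ‖fderiv ℝ (polyFun q) x (e j)‖ ^ 2)
      isOpen_interior R.differentiableAt_inv R.norm_fderiv_inv_le R.injOn_inv
      (fun x => by positivity) hintG
    rw [R.image_inv_interior] at h1
    refine h1.trans ?_
    gcongr
    refine (setIntegral_mono_on hintG hintS isOpen_interior.measurableSet hpt).trans (le_of_eq ?_)
    rw [integral_const_mul, integral_finsetSum _ fun i _ => hint i]
  calc _ ≤ ∑ _j : Fin d, (C / h) ^ d * ((C * h) ^ 2 * d * N₁) := Finset.sum_le_sum fun j _ => hj j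
    _ = _ := by
      rw [Finset.sum_const, Finset.card_univ, Fintype.card_fin, nsmul_eq_mul]; ring

end PolyPullback

theorem setIntegral_sq_le (R : RegularElement F G n h C b) {f : E d → ℂ} {B : ℝ}
    (hB : ∀ y ∈ interior (F '' refSimplex d), ‖f y‖ ≤ B) :
    ∫ y in interior (F '' refSimplex d), ‖f y‖ ^ 2 ≤
      B ^ 2 * (h ^ d * volume.real (Metric.ball (0 : E d) 1)) := by
  have h1 := norm_setIntegral_le_of_norm_le_const (f := fun y => ‖f y‖ ^ 2) (C := B ^ 2)
    R.volume_interior_lt_top fun y hy => by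
      rw [norm_pow, norm_norm]
      have := hB y hy
      gcongr
  refine (le_abs_self _).trans (h1.trans ?_)
  gcongr
  exact R.measureReal_interior_le

/-- Pull-back of a cut-off function to the reference simplex. -/
theorem exists_sClass_pullback (n : ℕ) (C : ℝ) : ∃ K, 0 ≤ K ∧ ∀ {d : ℕ} {F G : E d → E d}
    {h b : ℝ}, RegularElement F G n h C b → ∀ {χ : E d → ℝ} {A δ c : ℝ}, 0 ≤ A → 0 < δ →
    h / δ ≤ c → b ≤ c →
    (∀ y ∈ interior (F '' refSimplex d), DifferentiableAt ℝ χ y) →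
    SClass (interior (F '' refSimplex d)) n (fderiv ℝ χ) (A / δ) (1 / δ) →
    (∀ x ∈ interior (refSimplex d), DifferentiableAt ℝ (fun x => χ (F x)) x) ∧
    SClass (interior (refSimplex d)) n (fderiv ℝ fun x => χ (F x)) (K * A * (h / δ)) c := by
  obtain ⟨K, hK1, hK⟩ := SClass.comp n C
  refine ⟨2 ^ (n + 1) * K * |C|, by positivity, ?_⟩
  intro d F G h b R χ A δ c hA hδ hac hbc hχd hχ
  have hh := R.h_pos
  have hC : 0 < C := one_pos.trans_le R.one_le_C
  have hc : 0 ≤ c := (by positivity : 0 ≤ h / δ).trans hac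
  have hder : ∀ x ∈ interior (refSimplex d), HasFDerivAt (fun x => χ (F x))
      ((fderiv ℝ χ (F x)).comp (fderiv ℝ F x)) x := fun x hx =>
    (hχd _ (R.mapsTo hx)).hasFDerivAt.comp x (R.differentiableAt x hx).hasFDerivAt
  refine ⟨fun x hx => (hder x hx).differentiableAt, ?_⟩
  have hF : SClass (interior (refSimplex d)) n (fderiv ℝ F) (C * h) c :=
    R.sClass.mono (by positivity) le_rfl R.b_nonneg hbc
  have h1 := hK isOpen_interior isOpen_interior R.mapsTo (A := A / δ) (t := 1 / δ) (H := C * h)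
    (c := c) (by positivity) (by positivity) (by positivity) hc
    -- The compatibility condition of `SClass.comp`: here it reads `C h / δ ≤ C c`.
    (by rw [mul_one_div, mul_div_assoc]; gcongr) R.differentiableAt hF hχ
  have h2 := SClass.bilin isOpen_interior (ContinuousLinearMap.compL ℝ (E d) (E d) ℝ)
    (ContinuousLinearMap.norm_compL_le ℝ (E d) (E d) ℝ) (by positivity) (by positivity) hc h1 hF
  refine (h2.congr isOpen_interior (g := fderiv ℝ fun x => χ (F x)) fun x hx =>
    (hder x hx).fderiv.symm).mono (by positivity) (le_of_eq ?_) hc le_rfl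
  rw [abs_of_pos hC]
  ring

set_option maxHeartbeats 800000 in
/-- Super-approximation on one element. -/
theorem exists_element_estimate (hd : 1 ≤ d) (n : ℕ) (C A : ℝ) (hA : 0 ≤ A) : ∃ D, 0 ≤ D ∧
    ∀ {F G : E d → E d} {h b : ℝ}, RegularElement F G n h C b →
    ∀ {χ : E d → ℝ} {δ c : ℝ} {q : MvPolynomial (Fin d) ℂ} {v w : E d → ℂ}, 0 < δ →
    h / δ ≤ c → b ≤ c → c ≤ 1 → ContinuousOn χ (F '' refSimplex d) →
    (∀ y ∈ interior (F '' refSimplex d), DifferentiableAt ℝ χ y) →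
    SClass (interior (F '' refSimplex d)) n (fderiv ℝ χ) (A / δ) (1 / δ) →
    q.totalDegree ≤ n + 1 → (∀ x ∈ refSimplex d, v (F x) = polyFun q x) →
    (∀ x ∈ refSimplex d, w (F x) = χ (F x) * v (F x) -
      refInterp (n + 1) (fun y => χ (F y) * v (F y)) x) →
    (∃ M, 0 ≤ M ∧ ∀ x ∈ refSimplex d, ∀ y ∈ refSimplex d,
      ‖w (F y) - w (F x)‖ ≤ M * ‖F y - F x‖) ∧
    ∫ y in interior (F '' refSimplex d), ‖w y‖ ^ 2 ≤
      D * ((h / δ) ^ 2 * ∫ y in interior (F '' refSimplex d), ‖v y‖ ^ 2) ∧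
    ∑ j, ∫ y in interior (F '' refSimplex d), ‖fderiv ℝ w y (e j)‖ ^ 2 ≤
      D * ((h / δ) ^ 2 * (∑ j, ∫ y in interior (F '' refSimplex d), ‖fderiv ℝ v y (e j)‖ ^ 2) +
        (h / δ * c ^ (n + 1) / h) ^ 2 * ∫ y in interior (F '' refSimplex d), ‖v y‖ ^ 2) := by
  obtain ⟨K, hK0, hK⟩ := exists_sClass_pullback n C
  obtain ⟨Cs, hCs0, hCs⟩ := exists_ref_superapprox hd n
  obtain ⟨Ci, hCi0, hCi⟩ := exists_inverse_estimate hd (n + 1)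
  set β := volume.real (Metric.ball (0 : E d) 1) with hβ
  set B₀ := Cs * (K * A) with hB₀
  have hβ0 : 0 ≤ β := measureReal_nonneg
  have hB₀0 : 0 ≤ B₀ := by positivity
  have hCsq : ∀ m, 0 ≤ |C| ^ m := fun m => by positivity
  -- The first summand serves the L² bound and the second the gradient bound; both are added so that
  -- one constant fits both. Absolute values are used since `1 ≤ C` is known only once an element is
  -- given.
  refine ⟨4 * B₀ ^ 2 * Ci * |C| ^ d * β + 2 * d * B₀ ^ 2 * Ci * β * |C| ^ 2 * |C| ^ d *
    (d * d * |C| ^ 2 + 1), by positivity, ?_⟩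
  intro F G h b R χ δ c q v w hδ hac hbc hc1 hχc hχd hχ hq hv hw
  have hh := R.h_pos
  have hC : 0 < C := one_pos.trans_le R.one_le_C
  rw [abs_of_pos hC]
  set a := h / δ with ha
  have ha0 : 0 < a := by positivity
  have hc0 : 0 ≤ c := ha0.le.trans hac
  obtain ⟨hfd, hfS⟩ := hK R hA hδ hac hbc hχd hχ
  set f : E d → ℝ := fun x => χ (F x) with hf
  have hfc : ContinuousOn f (refSimplex d) := hχc.comp R.continuousOn (mapsTo_image _ _)
  set r : E d → ℂ := fun x => f x * polyFun q x -
    refInterp (n + 1) (fun y => f y * polyFun q y) x with hr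
  have hwr : ∀ x ∈ refSimplex d, w (F x) = r x := fun x hx => by
    rw [hw x hx, hr, hv x hx]
    congr 1
    exact refInterp_congr (by omega) (fun y hy => by simp only [hf, hv y hy]) x
  set I₀ := ∫ x in interior (refSimplex d), ‖polyFun q x‖ ^ 2 with hI₀
  set I₁ := ∑ j, ∫ x in interior (refSimplex d), ‖fderiv ℝ (polyFun q) x (e j)‖ ^ 2 with hI₁
  have hI₀0 : 0 ≤ I₀ := integral_nonneg fun _ => by positivity
  have hI₁0 : 0 ≤ I₁ := Finset.sum_nonneg fun j _ => integral_nonneg fun _ => by positivity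
  set N₀ := ∫ y in interior (F '' refSimplex d), ‖v y‖ ^ 2 with hN₀
  set N₁ := ∑ j, ∫ y in interior (F '' refSimplex d), ‖fderiv ℝ v y (e j)‖ ^ 2 with hN₁
  have hN₀0 : 0 ≤ N₀ := integral_nonneg fun _ => by positivity
  have hN₁0 : 0 ≤ N₁ := Finset.sum_nonneg fun j _ => integral_nonneg fun _ => by positivity
  have hIN₀ : I₀ ≤ (C / h) ^ d * N₀ := R.integral_sq_ref_le hv
  have hIN₁ : I₁ ≤ (d * d * C ^ 2) * ((C / h) ^ d * h ^ 2) * N₁ := R.sum_integral_sq_ref_le hv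
  set Q₀ := √(Ci * I₀) with hQ₀
  -- One gradient bound with two uses: `I₁` yields the gradient term of the H¹ estimate, while `I₀`
  -- gives `Q₁ ≤ Q₀` and so an L² estimate free of gradients.
  set Q₁ := √(Ci * min I₀ I₁) with hQ₁
  have hQ₀0 : 0 ≤ Q₀ := Real.sqrt_nonneg _
  have hQ₁0 : 0 ≤ Q₁ := Real.sqrt_nonneg _
  have hQ₀sq : Q₀ ^ 2 = Ci * I₀ := Real.sq_sqrt (by positivity)
  have hQ₁sq : Q₁ ^ 2 = Ci * min I₀ I₁ := Real.sq_sqrt (by positivity)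
  have hQ₁₀ : Q₁ ≤ Q₀ := Real.sqrt_le_sqrt (by gcongr; exact min_le_left _ _)
  have hb0 : ∀ x ∈ refSimplex d, ‖polyFun q x‖ ≤ Q₀ := fun x hx =>
    Real.le_sqrt_of_sq_le (hCi q hq x hx).1
  have hb1 : ∀ x ∈ refSimplex d, ‖fderiv ℝ (polyFun q) x‖ ≤ Q₁ := fun x hx => by
    refine Real.le_sqrt_of_sq_le ?_
    rw [mul_min_of_nonneg _ _ hCi0]
    exact le_min (hCi q hq x hx).2.1 (hCi q hq x hx).2.2
  have hsup := hCs (A := K * A * a) (c := c) (by positivity) hc0 hfc hfd hfS hq hb0 hb1 r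
    (fun x => rfl)
  set S := Cs * (K * A * a * Q₁ + K * A * a * c ^ (n + 1) * Q₀) with hS
  have hSeq : S = B₀ * a * (Q₁ + c ^ (n + 1) * Q₀) := by rw [hS, hB₀]; ring
  have hS0 : 0 ≤ S := by rw [hSeq]; positivity
  have hhC : h ^ d * (C / h) ^ d = C ^ d := by rw [← mul_pow, mul_div_cancel₀ _ hh.ne']
  have hgh : h⁻¹ * h = 1 := inv_mul_cancel₀ hh.ne'
  clear hK hCs hCi
  clear_value β B₀ I₀ I₁ N₀ N₁ Q₀ Q₁ S a
  refine ⟨?_, ?_, ?_⟩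
  · obtain ⟨M, hM0, hM⟩ := R.exists_norm_sub_le_inv hd
    refine ⟨S * M, by positivity, fun x hx y hy => ?_⟩
    have hrc : ContinuousOn r (refSimplex d) := by
      refine ContinuousOn.sub (ContinuousOn.mul ?_ (contDiff_polyFun q).continuous.continuousOn)
        (contDiff_refInterp _ _).continuous.continuousOn
      exact Complex.continuous_ofReal.comp_continuousOn hfc
    have hrl : LocLip (interior (refSimplex d)) r S := locLip_of_fderiv_le isOpen_interior
      (fun x hx => (hsup x hx).1) fun x hx => (hsup x hx).2.2
    rw [hwr x hx, hwr y hy]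
    calc ‖r y - r x‖ ≤ S * ‖y - x‖ := norm_sub_le_of_locLip_refSimplex hd hrc hrl hS0 hx hy
      _ ≤ S * (M * ‖F y - F x‖) := by gcongr; exact hM x hx y hy
      _ = _ := by ring
  · have h1 : ∀ y ∈ interior (F '' refSimplex d), ‖w y‖ ≤ 2 * B₀ * a * Q₀ := fun y hy => by
      obtain ⟨hG, hFG⟩ := R.inv_mem hy
      rw [← hFG, hwr _ (interior_subset hG)]
      refine (hsup _ hG).2.1.trans ?_
      rw [hSeq]
      -- The power of `c` is discarded here, which needs `c ≤ 1`; the L² bound uses only the factor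
      -- `a`.
      have h2 : c ^ (n + 1) * Q₀ ≤ Q₀ := mul_le_of_le_one_left hQ₀0 (pow_le_one₀ hc0 hc1)
      calc B₀ * a * (Q₁ + c ^ (n + 1) * Q₀) ≤ B₀ * a * (Q₀ + Q₀) := by gcongr
        _ = _ := by ring
    refine (R.setIntegral_sq_le h1).trans ?_
    rw [← hβ]
    calc (2 * B₀ * a * Q₀) ^ 2 * (h ^ d * β) = 4 * B₀ ^ 2 * a ^ 2 * Ci * β * (h ^ d * I₀) := by
          rw [mul_pow, hQ₀sq]; ring
      _ ≤ 4 * B₀ ^ 2 * a ^ 2 * Ci * β * (h ^ d * ((C / h) ^ d * N₀)) := by gcongr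
      _ = 4 * B₀ ^ 2 * Ci * C ^ d * β * (a ^ 2 * N₀) := by rw [← hhC]; ring
      _ ≤ _ := by
        refine mul_le_mul_of_nonneg_right (le_add_of_nonneg_right ?_) (by positivity)
        positivity
  · have h1 : ∀ j, ∀ y ∈ interior (F '' refSimplex d), ‖fderiv ℝ w y (e j)‖ ≤ S * (C / h) :=
      fun j y hy => by
        obtain ⟨hG, -⟩ := R.inv_mem hy
        exact (norm_apply_e_le _ j).trans
          (R.norm_fderiv_le_of_pullback hwr hy (hsup _ hG).1 (hsup _ hG).2.2)
    have hSsq : S ^ 2 ≤ 2 * B₀ ^ 2 * a ^ 2 * Ci * (I₁ + (c ^ (n + 1)) ^ 2 * I₀) := by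
      have h2 : (Q₁ + c ^ (n + 1) * Q₀) ^ 2 ≤ 2 * (Q₁ ^ 2 + (c ^ (n + 1) * Q₀) ^ 2) := add_sq_le
      have h3 : Q₁ ^ 2 ≤ Ci * I₁ := by rw [hQ₁sq]; gcongr; exact min_le_right _ _
      calc S ^ 2 = B₀ ^ 2 * a ^ 2 * (Q₁ + c ^ (n + 1) * Q₀) ^ 2 := by rw [hSeq]; ring
        _ ≤ B₀ ^ 2 * a ^ 2 * (2 * (Ci * I₁ + (c ^ (n + 1)) ^ 2 * (Ci * I₀))) := by
          refine mul_le_mul_of_nonneg_left (h2.trans ?_) (by positivity)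
          rw [mul_pow, hQ₀sq]
          linarith
        _ = _ := by ring
    calc ∑ j, ∫ y in interior (F '' refSimplex d), ‖fderiv ℝ w y (e j)‖ ^ 2
        ≤ ∑ _j : Fin d, (S * (C / h)) ^ 2 * (h ^ d * β) :=
          Finset.sum_le_sum fun j _ => (R.setIntegral_sq_le (h1 j)).trans (by rw [← hβ])
      _ = d * (C / h) ^ 2 * (h ^ d * β) * S ^ 2 := by
        rw [Finset.sum_const, Finset.card_univ, Fintype.card_fin, nsmul_eq_mul]; ring
      _ ≤ d * (C / h) ^ 2 * (h ^ d * β) * (2 * B₀ ^ 2 * a ^ 2 * Ci *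
          ((d * d * C ^ 2) * ((C / h) ^ d * h ^ 2) * N₁ +
            (c ^ (n + 1)) ^ 2 * ((C / h) ^ d * N₀))) := by
        refine mul_le_mul_of_nonneg_left (hSsq.trans ?_) (by positivity)
        gcongr
      _ = 2 * d * B₀ ^ 2 * Ci * β * C ^ 2 * C ^ d * ((d * d * C ^ 2) * (a ^ 2 * N₁) +
          (a * c ^ (n + 1) / h) ^ 2 * N₀) := by
        rw [div_eq_mul_inv] at hhC
        rw [div_eq_mul_inv, div_eq_mul_inv _ h]
        -- All powers of `h` cancel: the volume `h ^ d` against `(C / h) ^ d`, and in the gradient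
        -- term `h ^ 2` against the `(C / h) ^ 2` from `D G`.
        linear_combination
          2 * d * B₀ ^ 2 * β * Ci * a ^ 2 * C ^ 2 * h⁻¹ ^ 2 *
            (d * d * C ^ 2 * h ^ 2 * N₁ + (c ^ (n + 1)) ^ 2 * N₀) * hhC +
          2 * d * B₀ ^ 2 * β * Ci * a ^ 2 * C ^ 2 * C ^ d * (d * d * C ^ 2) * N₁ *
            (h⁻¹ * h + 1) * hgh
      _ ≤ 2 * d * B₀ ^ 2 * Ci * β * C ^ 2 * C ^ d * ((d * d * C ^ 2 + 1) *
          (a ^ 2 * N₁ + (a * c ^ (n + 1) / h) ^ 2 * N₀)) := by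
        refine mul_le_mul_of_nonneg_left ?_ (by positivity)
        have e1 : 0 ≤ a ^ 2 * N₁ := by positivity
        have e2 : 0 ≤ (a * c ^ (n + 1) / h) ^ 2 * N₀ := by positivity
        have e3 : (0 : ℝ) ≤ d * d * C ^ 2 := by positivity
        nlinarith [mul_nonneg e3 e2]
      _ = 2 * d * B₀ ^ 2 * Ci * β * C ^ 2 * C ^ d * (d * d * C ^ 2 + 1) *
          (a ^ 2 * N₁ + (a * c ^ (n + 1) / h) ^ 2 * N₀) := by ring
      _ ≤ _ := by
        refine mul_le_mul_of_nonneg_right (le_add_of_nonneg_left ?_) (by positivity)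
        positivity

end RegularElement

/-! ### Summation over the elements -/

namespace Mesh

variable {d : ℕ} {Ω : Set (E d)} {T : Mesh Ω}

theorem exists_mem_elem {x : E d} (hx : x ∈ closure Ω) : ∃ i, x ∈ T.elem i := by
  rw [← T.cover] at hx
  exact mem_iUnion.1 hx

/-- A function that is Lipschitz continuous on every element is locally Lipschitz continuous with
a uniform constant, and bounded. -/
theorem locLip_of_elem {U : Set (E d)} (hU : IsOpen U) (hUΩ : U ⊆ closure Ω) {w : E d → ℂ}
    (hw : ∀ i, ∃ M, 0 ≤ M ∧ ∀ x ∈ T.elem i, ∀ y ∈ T.elem i, ‖w y - w x‖ ≤ M * ‖y - x‖) :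
    (∃ M, 0 ≤ M ∧ LocLip U w M) ∧ ∃ B, 0 ≤ B ∧ ∀ x ∈ U, ‖w x‖ ≤ B := by
  choose M hM0 hM using hw
  refine ⟨⟨∑ i, M i, Finset.sum_nonneg fun i _ => hM0 i, fun x hx => ?_⟩,
    ∑ i, (‖w (T.map i 0)‖ + M i * T.diam i),
    Finset.sum_nonneg fun i _ => add_nonneg (norm_nonneg _)
      (mul_nonneg (hM0 i) Metric.diam_nonneg), fun x hx => ?_⟩
  · have h1 : ∀ᶠ y in 𝓝 x, ∀ i, y ∈ T.elem i → x ∈ T.elem i := by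
      refine eventually_all.2 fun i => ?_
      by_cases hxi : x ∈ T.elem i
      · exact Eventually.of_forall fun y _ => hxi
      · filter_upwards [(T.isCompact_elem i).isClosed.isOpen_compl.mem_nhds hxi] with y hy hy'
        exact absurd hy' hy
    filter_upwards [h1, hU.mem_nhds hx] with y hy hyU
    obtain ⟨i, hi⟩ := T.exists_mem_elem (hUΩ hyU)
    refine (hM i x (hy i hi) y hi).trans ?_
    gcongr
    exact Finset.single_le_sum (fun i _ => hM0 i) (Finset.mem_univ i)
  · obtain ⟨i, hi⟩ := T.exists_mem_elem (hUΩ hx)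
    have h0 : T.map i 0 ∈ T.elem i := mem_image_of_mem _ zero_mem_refSimplex
    have h1 : ‖w x‖ ≤ ‖w (T.map i 0)‖ + M i * T.diam i := by
      have h2 := norm_le_norm_add_norm_sub (w (T.map i 0)) (w x)
      have h3 := hM i _ h0 x hi
      have h4 : ‖x - T.map i 0‖ ≤ T.diam i := by
        rw [← dist_eq_norm]
        exact Metric.dist_le_diam_of_mem (T.isCompact_elem i).isBounded hi h0
      have h5 := mul_le_mul_of_nonneg_left h4 (hM0 i)
      rw [norm_sub_rev] at h2
      linarith
    refine h1.trans (Finset.single_le_sum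
      (f := fun i => ‖w (T.map i 0)‖ + M i * T.diam i) (fun i _ => ?_) (Finset.mem_univ i))
    exact add_nonneg (norm_nonneg _) (mul_nonneg (hM0 i) Metric.diam_nonneg)

/-- An integral is the sum of the integrals over the interiors of the elements. -/
theorem setIntegral_eq_sum (hd : 1 ≤ d) {n : ℕ} {C : ℝ} {b : Fin T.n → ℝ}
    (hR : ∀ i, RegularElement (T.map i) (T.inv i) n (T.diam i) C (b i)) {U : Set (E d)}
    (hU : IsOpen U) (hUΩ : U ⊆ closure Ω) {f : E d → ℝ} (hf : IntegrableOn f U) :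
    ∫ x in U, f x = ∑ i, ∫ x in U ∩ interior (T.elem i), f x := by
  rw [← integral_iUnion_fintype (fun i => (hU.inter isOpen_interior).measurableSet)
    (fun i j hij => ?_) fun i => hf.mono_set inter_subset_left]
  · refine setIntegral_congr_set ?_
    refine (ae_eq_set.2 ⟨measure_mono_null (t := ⋃ i, T.map i '' (refSimplex d \
      interior (refSimplex d))) (fun x hx => ?_)
      (measure_iUnion_null fun i => (hR i).volume_image_diff_interior hd), ?_⟩)
    · obtain ⟨i, hi⟩ := T.exists_mem_elem (hUΩ hx.1)
      exact mem_iUnion.2 ⟨i, T.elem_diff_interior_subset i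
        ⟨hi, fun h => hx.2 (mem_iUnion.2 ⟨i, hx.1, h⟩)⟩⟩
    · rw [sdiff_eq_empty.2 (iUnion_subset fun i => inter_subset_left), measure_empty]
  · exact ((T.disjoint_interior_elem hd hij).mono_right interior_subset).mono
      inter_subset_right inter_subset_right

/-- Finite element functions, plus local ones, are in `H¹` of the subdomain, and polynomial on the
elements of the subdomain. -/
theorem memH1_and_poly {p : ℕ} {V W : Submodule ℂ (E d → ℂ)} {U : Set (E d)} (hV : V ≤ H1 Ω)
    (hUΩ : U ⊆ Ω) (hW : W ≤ T.feSpace p (closure U) (H1 U)) {v : E d → ℂ}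
    (hv : v ∈ T.feSpace p (closure Ω) V ⊔ W) :
    MemH1 U v ∧ ∀ i, T.elem i ⊆ closure U → ∃ q : MvPolynomial (Fin d) ℂ, q.totalDegree ≤ p ∧
      ∀ x ∈ refSimplex d, v (T.map i x) = polyFun q x := by
  obtain ⟨v₁, ⟨h1, h1'⟩, v₂, h2, rfl⟩ := Submodule.mem_sup.1 hv
  obtain ⟨h2, h2'⟩ := hW h2
  refine ⟨(H1 U).add_mem (MemH1.restrict hUΩ (hV h1)) h2, fun i hi => ?_⟩
  obtain ⟨q₁, hq₁, h₁⟩ := h1' i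
  obtain ⟨q₂, hq₂, h₂⟩ := h2' i
  refine ⟨q₁ + q₂, (MvPolynomial.totalDegree_add _ _).trans (max_le hq₁ hq₂), fun x hx => ?_⟩
  have hx' : T.map i x ∈ T.elem i := mem_image_of_mem _ hx
  rw [Pi.add_apply, h₁ x hx (T.elem_subset_closure i hx'), h₂ x hx (hi hx'), polyFun, map_add]

/-- Inside an element `v` is a smooth pull-back, whose classical gradient is also its weak gradient
there; uniqueness of weak gradients does the rest. -/
theorem setIntegral_weakGrad_eq {U : Set (E d)} {n : ℕ} {F G : E d → E d} {h C b : ℝ}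
    (R : RegularElement F G n h C b) (hFU : interior (F '' refSimplex d) ⊆ U) {v : E d → ℂ}
    (hv : MemH1 U v) {q : MvPolynomial (Fin d) ℂ}
    (hq : ∀ x ∈ refSimplex d, v (F x) = polyFun q x) (j : Fin d) :
    ∫ y in interior (F '' refSimplex d), ‖weakGrad U v j y‖ ^ 2 =
      ∫ y in interior (F '' refSimplex d), ‖fderiv ℝ v y (e j)‖ ^ 2 := by
  obtain ⟨B, hB0, hB⟩ := R.exists_bounds_of_poly hq
  have h1 : LocLip (interior (F '' refSimplex d)) v B := locLip_of_fderiv_le isOpen_interior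
    (fun y hy => (hB y hy).2.1) fun y hy => (hB y hy).2.2
  have h2 := h1.isWeakGrad isOpen_interior R.volume_interior_lt_top hB0 hB0
    fun y hy => (hB y hy).1
  refine integral_congr_ae ?_
  filter_upwards [(hv.isWeakGrad.restrict hFU).ae_eq isOpen_interior R.volume_interior_lt_top
    h2 j] with y hy
  rw [hy]

/-- The contribution of one element to the super-approximation estimate. -/
theorem exists_elem_superapprox (hd : 1 ≤ d) (n : ℕ) (C CPoU : ℝ) {L : ℝ} (hL : 0 < L) :
    ∃ D, 0 ≤ D ∧ ∀ {Ω : Set (E d)} {T : Mesh Ω} {b : ℝ} {i : Fin T.n},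
    RegularElement (T.map i) (T.inv i) n (T.diam i) C b → b ≤ T.diam i / L → b ≤ 1 →
    ∀ {U : Set (E d)}, interior (closure U) = U → ∀ {χ : E d → ℝ} {δ : ℝ},
    ((∃ x ∈ T.elem i, χ x ≠ 0) → T.elem i ⊆ closure U) → MemCLip (n + 1) (T.elem i) χ →
    (∀ m ≤ n + 2, PartialsBounded m (T.elem i) χ (CPoU * δ⁻¹ ^ m)) → 0 < δ →
    T.localWidth U ≤ δ → ∀ {v : E d → ℂ}, MemH1 U v →
    (T.elem i ⊆ closure U → ∃ q : MvPolynomial (Fin d) ℂ, q.totalDegree ≤ n + 1 ∧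
      ∀ x ∈ refSimplex d, v (T.map i x) = polyFun q x) →
    (∃ M, 0 ≤ M ∧ ∀ x ∈ T.elem i, ∀ y ∈ T.elem i,
      ‖T.interpError (n + 1) χ v y - T.interpError (n + 1) χ v x‖ ≤ M * ‖y - x‖) ∧
    ∫ y in U ∩ interior (T.elem i), ‖T.interpError (n + 1) χ v y‖ ^ 2 ≤
      D * ((T.localWidth U / δ) ^ 2 * ∫ y in U ∩ interior (T.elem i), ‖v y‖ ^ 2) ∧
    ∑ j, ∫ y in U ∩ interior (T.elem i), ‖fderiv ℝ (T.interpError (n + 1) χ v) y (e j)‖ ^ 2 ≤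
      D * ((T.localWidth U / δ) ^ 2 *
          (∑ j, ∫ y in U ∩ interior (T.elem i), ‖weakGrad U v j y‖ ^ 2) +
        ((T.localWidth U / δ) ^ (n + 1) / δ + T.localWidth U / δ / L) ^ 2 *
          ∫ y in U ∩ interior (T.elem i), ‖v y‖ ^ 2) := by
  obtain ⟨D, hD0, hD⟩ := RegularElement.exists_element_estimate hd n C
    ((d : ℝ) ^ (n + 2) * |CPoU|) (by positivity)
  refine ⟨D, hD0, ?_⟩
  intro Ω T b i R hbL hb1 U hU χ δ hact hχ hχb hδ hδU v hv hpoly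
  set w := T.interpError (n + 1) χ v with hw
  have hwF : ∀ x ∈ refSimplex d, w (T.map i x) = χ (T.map i x) * v (T.map i x) -
      refInterp (n + 1) (fun y => χ (T.map i y) * v (T.map i y)) x := fun x hx => by
    rw [hw, interpError, T.interp_map (by omega) _ i hx]
  have hlw := T.localWidth_nonneg U
  by_cases hi : ∃ x ∈ T.elem i, χ x ≠ 0
  · have hiU := hact hi
    have hint : interior (T.elem i) ⊆ U := by rw [← hU]; exact interior_mono hiU
    obtain ⟨q, hq, hvq⟩ := hpoly hiU
    have hhl : T.diam i ≤ T.localWidth U := T.diam_le_localWidth hiU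
    have hh := R.h_pos
    have ha1 : T.diam i / δ ≤ 1 := (div_le_one hδ).2 (hhl.trans hδU)
    have ha0 : 0 < T.diam i / δ := by positivity
    obtain ⟨hχd, hχS⟩ := sClass_fderiv_of_partials hd hχ (A := |CPoU| / δ) (c := 1 / δ)
      (by positivity) (by positivity) fun m h1 h2 => (hχb m h2).mono (by
        obtain ⟨m, rfl⟩ : ∃ k, m = k + 1 := ⟨m - 1, by omega⟩
        rw [Nat.add_sub_cancel, pow_succ, one_div, div_eq_mul_inv]
        calc CPoU * (δ⁻¹ ^ m * δ⁻¹) ≤ |CPoU| * (δ⁻¹ ^ m * δ⁻¹) := by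
              gcongr; exact le_abs_self _
          _ = _ := by ring)
    have key := hD R (c := max (T.diam i / δ) b) hδ (le_max_left _ _) (le_max_right _ _)
      (max_le ha1 hb1) hχ.1 hχd (by rw [mul_div_assoc]; exact hχS) hq hvq hwF
    obtain ⟨⟨M, hM0, hM⟩, k1, k2⟩ := key
    rw [inter_eq_right.2 hint]
    have hs : T.diam i / δ * max (T.diam i / δ) b ^ (n + 1) / T.diam i ≤
        (T.localWidth U / δ) ^ (n + 1) / δ + T.localWidth U / δ / L := by
      -- One power of `b ≤ 1` is kept, with `b ≤ h / L`; this is the source of the additional term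
      -- `(h/δ)/L`.
      have h1 : max (T.diam i / δ) b ^ (n + 1) ≤ (T.diam i / δ) ^ (n + 1) + T.diam i / L := by
        have h2 : b ^ (n + 1) ≤ T.diam i / L :=
          (pow_le_of_le_one R.b_nonneg hb1 (by omega)).trans hbL
        rcases max_choice (T.diam i / δ) b with h | h <;> rw [h]
        · exact le_add_of_nonneg_right (by positivity)
        · exact h2.trans (le_add_of_nonneg_left (by positivity))
      calc T.diam i / δ * max (T.diam i / δ) b ^ (n + 1) / T.diam i
          = max (T.diam i / δ) b ^ (n + 1) / δ := by field_simp
        _ ≤ ((T.diam i / δ) ^ (n + 1) + T.diam i / L) / δ := by gcongr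
        _ = (T.diam i / δ) ^ (n + 1) / δ + T.diam i / δ / L := by ring
        _ ≤ _ := by gcongr
    have hN : 0 ≤ ∫ y in interior (T.elem i), ‖v y‖ ^ 2 := integral_nonneg fun _ => by positivity
    refine ⟨⟨M, hM0, ?_⟩, k1.trans ?_, k2.trans ?_⟩
    · rintro _ ⟨x, hx, rfl⟩ _ ⟨y, hy, rfl⟩
      exact hM x hx y hy
    · change D * ((T.diam i / δ) ^ 2 * ∫ y in interior (T.elem i), ‖v y‖ ^ 2) ≤ _
      gcongr
    · rw [Finset.sum_congr rfl fun j _ => (setIntegral_weakGrad_eq R hint hv hvq j).symm]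
      change D * ((T.diam i / δ) ^ 2 *
        (∑ j, ∫ y in interior (T.elem i), ‖weakGrad U v j y‖ ^ 2) + _ *
          ∫ y in interior (T.elem i), ‖v y‖ ^ 2) ≤ _
      have hG : 0 ≤ ∑ j, ∫ y in interior (T.elem i), ‖weakGrad U v j y‖ ^ 2 :=
        Finset.sum_nonneg fun j _ => integral_nonneg fun _ => by positivity
      gcongr
  · push Not at hi
    -- Where the cut-off vanishes on the whole element, so does its interpolant; such an element
    -- need not lie in the closure of `U`.
    have hw0 : ∀ y ∈ T.elem i, w y = 0 := by
      rintro _ ⟨x, hx, rfl⟩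
      rw [hwF x hx, refInterp_congr (g := fun _ => 0) (by omega) fun y hy => by
        rw [hi _ (mem_image_of_mem _ hy), Complex.ofReal_zero, zero_mul],
        hi _ (mem_image_of_mem _ hx)]
      simp [refInterp]
    have hm : MeasurableSet (U ∩ interior (T.elem i)) := by
      rw [← hU]; exact (isOpen_interior.inter isOpen_interior).measurableSet
    have hf0 : ∀ y ∈ interior (T.elem i), fderiv ℝ w y = 0 := fun y hy => by
      have : w =ᶠ[𝓝 y] fun _ => 0 := by
        filter_upwards [isOpen_interior.mem_nhds hy] with z hz using hw0 z (interior_subset hz)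
      rw [this.fderiv_eq, fderiv_fun_const, Pi.zero_apply]
    refine ⟨⟨0, le_rfl, fun x hx y hy => by rw [hw0 x hx, hw0 y hy]; simp⟩, ?_, ?_⟩
    · rw [setIntegral_eq_zero_of_forall_eq_zero fun y hy => by
        rw [hw0 y (interior_subset hy.2)]; simp]
      have : 0 ≤ ∫ y in U ∩ interior (T.elem i), ‖v y‖ ^ 2 :=
        integral_nonneg fun _ => by positivity
      positivity
    · rw [Finset.sum_eq_zero fun j _ => setIntegral_eq_zero_of_forall_eq_zero fun y hy => by
        rw [hf0 y hy.2]; simp]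
      have h1 : 0 ≤ ∫ y in U ∩ interior (T.elem i), ‖v y‖ ^ 2 :=
        integral_nonneg fun _ => by positivity
      have h2 : 0 ≤ ∑ j, ∫ y in U ∩ interior (T.elem i), ‖weakGrad U v j y‖ ^ 2 :=
        Finset.sum_nonneg fun j _ => integral_nonneg fun _ => by positivity
      positivity

/-- The `k`-weighted norm of a bounded locally Lipschitz function in terms of its classical
gradient. -/
theorem _root_.FEM.LocLip.h1kNorm_eq {U : Set (E d)} (hU : IsOpen U) (hfin : volume U < ⊤)
    {u : E d → ℂ} {M B : ℝ} (hM : 0 ≤ M) (hu : LocLip U u M) (hB0 : 0 ≤ B)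
    (hB : ∀ x ∈ U, ‖u x‖ ≤ B) (k : ℝ) :
    MemH1 U u ∧ h1kNorm k U u = Real.sqrt ((k ^ 2)⁻¹ *
      (∑ j, ∫ x in U, ‖fderiv ℝ u x (e j)‖ ^ 2) + ∫ x in U, ‖u x‖ ^ 2) := by
  have h1 := hu.isWeakGrad hU hfin hM hB0 hB
  have h2 : MemH1 U u := ⟨hu.memLp hU hfin hB, _, h1⟩
  refine ⟨h2, ?_⟩
  have h3 : ∀ j, ∫ x in U, ‖weakGrad U u j x‖ ^ 2 = ∫ x in U, ‖fderiv ℝ u x (e j)‖ ^ 2 :=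
    fun j => by
      refine integral_congr_ae ?_
      filter_upwards [h2.isWeakGrad.ae_eq hU hfin h1 j] with y hy
      rw [hy]
  rw [h1kNorm]
  simp only [h3]

/-- Super-approximation for one cut-off function. -/
theorem exists_superapprox (hd : 1 ≤ d) (n : ℕ) (C CPoU : ℝ) {L k₀ : ℝ} (hL : 0 < L)
    (hk₀ : 0 < k₀) :
    ∃ D, 0 ≤ D ∧ ∀ {Ω : Set (E d)} {T : Mesh Ω} {b : Fin T.n → ℝ},
    (∀ i, RegularElement (T.map i) (T.inv i) n (T.diam i) C (b i)) →
    (∀ i, b i ≤ T.diam i / L) → (∀ i, b i ≤ 1) →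
    ∀ {V W : Submodule ℂ (E d → ℂ)} {U : Set (E d)}, V ≤ H1 Ω → U ⊆ Ω →
    interior (closure U) = U → W ≤ T.feSpace (n + 1) (closure U) (H1 U) →
    ∀ {χ : E d → ℝ} {δ : ℝ}, (∀ i, (∃ x ∈ T.elem i, χ x ≠ 0) → T.elem i ⊆ closure U) →
    (∀ i, MemCLip (n + 1) (T.elem i) χ) →
    (∀ i, ∀ m ≤ n + 2, PartialsBounded m (T.elem i) χ (CPoU * δ⁻¹ ^ m)) → 0 < δ →
    T.localWidth U ≤ δ → ∀ {k : ℝ}, k₀ ≤ k →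
    ∀ v ∈ T.feSpace (n + 1) (closure Ω) V ⊔ W,
    MemH1 U (T.interpError (n + 1) χ v) ∧
    h1kNorm k U (T.interpError (n + 1) χ v) ≤ D * (T.localWidth U / δ +
      (T.localWidth U / δ) ^ (n + 1) * (1 / (k * δ))) * h1kNorm k U v := by
  obtain ⟨D, hD0, hD⟩ := exists_elem_superapprox hd n C CPoU hL
  -- The `1` covers the terms with factor `a`; the other square covers `s / k`.
  refine ⟨√(D * (1 + (1 + 1 / (L * k₀)) ^ 2)), Real.sqrt_nonneg _, ?_⟩
  intro Ω T b hR hbL hb1 V W U hV hUΩ hU hW χ δ hact hχ hχb hδ hδU k hk v hv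
  have hk0 : 0 < k := hk₀.trans_le hk
  obtain ⟨hvH, hvp⟩ := T.memH1_and_poly hV hUΩ hW hv
  have hel := fun i => hD (hR i) (hbL i) (hb1 i) hU (hact i) (hχ i) (hχb i) hδ hδU hvH (hvp i)
  have hUo : IsOpen U := by rw [← hU]; exact isOpen_interior
  have hUc : U ⊆ closure Ω := hUΩ.trans subset_closure
  have hfin : volume U < ⊤ := (measure_mono hUc).trans_lt T.isCompact_closure.measure_lt_top
  set w := T.interpError (n + 1) χ v with hw
  obtain ⟨⟨M, hM0, hM⟩, B, hB0, hB⟩ := T.locLip_of_elem hUo hUc fun i => (hel i).1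
  obtain ⟨hwH, hwn⟩ := hM.h1kNorm_eq hUo hfin hM0 hB0 hB k
  refine ⟨hwH, ?_⟩
  have hsq : ∀ {f : E d → ℂ}, MemLp f 2 (volume.restrict U) →
      IntegrableOn (fun x => ‖f x‖ ^ 2) U := fun hf =>
    (memLp_two_iff_integrable_sq_norm hf.1).1 hf
  have hsum := fun {f : E d → ℂ} (hf : MemLp f 2 (volume.restrict U)) =>
    T.setIntegral_eq_sum hd hR hUo hUc (hsq hf)
  have hwG := (hM.isWeakGrad hUo hfin hM0 hB0 hB).1
  set a := T.localWidth U / δ with ha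
  set s := a ^ (n + 1) / δ + a / L with hs
  have ha0 : 0 ≤ a := div_nonneg (T.localWidth_nonneg U) hδ.le
  set Nv := ∫ x in U, ‖v x‖ ^ 2 with hNv
  set Gv := ∑ j, ∫ x in U, ‖weakGrad U v j x‖ ^ 2 with hGv
  have hNv0 : 0 ≤ Nv := integral_nonneg fun _ => by positivity
  have hGv0 : 0 ≤ Gv := Finset.sum_nonneg fun j _ => integral_nonneg fun _ => by positivity
  have e0 : ∫ x in U, ‖w x‖ ^ 2 ≤ D * (a ^ 2 * Nv) := by
    rw [hsum hwH.1, hNv, hsum hvH.1, Finset.mul_sum, Finset.mul_sum]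
    exact Finset.sum_le_sum fun i _ => (hel i).2.1
  have e1 : ∑ j, ∫ x in U, ‖fderiv ℝ w x (e j)‖ ^ 2 ≤ D * (a ^ 2 * Gv + s ^ 2 * Nv) := by
    have h1 : Gv = ∑ i, ∑ j, ∫ x in U ∩ interior (T.elem i), ‖weakGrad U v j x‖ ^ 2 := by
      rw [hGv, Finset.sum_comm]
      exact Finset.sum_congr rfl fun j _ => hsum (hvH.isWeakGrad.1 j)
    rw [h1, hNv, hsum hvH.1, Finset.mul_sum, Finset.mul_sum, ← Finset.sum_add_distrib,
      Finset.mul_sum, Finset.sum_congr rfl fun j _ => hsum (hwG j), Finset.sum_comm]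
    exact Finset.sum_le_sum fun i _ => (hel i).2.2
  set μ := a + a ^ (n + 1) * (1 / (k * δ)) with hμ
  have hμ0 : 0 ≤ μ := by positivity
  -- The curvature term `a / L / k` is at most `a / (L k₀)`, the only place where `k ≥ k₀` is used
  -- quantitatively.
  have hsk : s / k ≤ (1 + 1 / (L * k₀)) * μ := by
    have h1 : a / L / k ≤ 1 / (L * k₀) * a := by
      rw [div_div, div_eq_mul_one_div, mul_comm]
      gcongr
    have h2 : 0 ≤ 1 / (L * k₀) * (a ^ (n + 1) * (1 / (k * δ))) := by positivity
    have h3 : a ^ (n + 1) / δ / k = a ^ (n + 1) * (1 / (k * δ)) := by field_simp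
    rw [hs, add_div, h3, hμ]
    linarith
  have haμ : a ≤ μ := le_add_of_nonneg_right (by positivity)
  have hvn : h1kNorm k U v = √((k ^ 2)⁻¹ * Gv + Nv) := rfl
  rw [hwn, hvn, mul_assoc, ← Real.sqrt_sq hμ0, ← Real.sqrt_mul (by positivity),
    ← Real.sqrt_mul (by positivity)]
  refine Real.sqrt_le_sqrt ?_
  have hk2 : 0 ≤ (k ^ 2)⁻¹ := by positivity
  have hs0 : 0 ≤ s / k := by positivity
  calc (k ^ 2)⁻¹ * (∑ j, ∫ x in U, ‖fderiv ℝ w x (e j)‖ ^ 2) + ∫ x in U, ‖w x‖ ^ 2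
      ≤ (k ^ 2)⁻¹ * (D * (a ^ 2 * Gv + s ^ 2 * Nv)) + D * (a ^ 2 * Nv) := by gcongr
    _ = D * (a ^ 2 * ((k ^ 2)⁻¹ * Gv + Nv) + (s / k) ^ 2 * Nv) := by rw [div_pow]; ring
    _ ≤ D * (μ ^ 2 * ((k ^ 2)⁻¹ * Gv + Nv) +
        ((1 + 1 / (L * k₀)) * μ) ^ 2 * ((k ^ 2)⁻¹ * Gv + Nv)) := by
      gcongr
      exact le_add_of_nonneg_left (by positivity)
    _ = _ := by ring

end Mesh

end FEM

end

theorem lemma4p3 (d p : ℕ) (hd : 1 ≤ d) (hp : 1 ≤ p)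
    (k₀ κ Ccurved L CPoU : ℝ) (hk₀ : 0 < k₀) (hL : 0 < L) :
    ∃ Csuper : ℝ, 0 < Csuper ∧
      ∀ (Ω : Set (FEM.E d)) (T : FEM.Mesh Ω),
        IsOpen Ω →
        (T.ShapeRegularSimplicial κ ∨ (Metric.diam Ω ≤ L ∧ T.CurvedRegular p Ccurved L)) →
      -- the space `V` and the subdomains
      ∀ (V : Submodule ℂ (FEM.E d → ℂ)) (N : ℕ) (Ωl : Fin N → Set (FEM.E d))
        (Vlh : Fin N → Submodule ℂ (FEM.E d → ℂ)),
        V ≤ FEM.H1 Ω →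
        (∀ l, Ωl l ⊆ Ω ∧ interior (closure (Ωl l)) = Ωl l) →
        (∀ l, Vlh l ≤ T.feSpace p (closure (Ωl l)) (FEM.H1 (Ωl l))) →
      -- the cutoff functions
      ∀ (χ χ' : Fin N → FEM.E d → ℝ) (δ : Fin N → ℝ),
        (∀ l i, (∃ x ∈ T.elem i, χ l x ≠ 0 ∨ χ' l x ≠ 0) → T.elem i ⊆ closure (Ωl l)) →
        (∀ l i, FEM.MemCLip p (T.elem i) (χ l) ∧ FEM.MemCLip p (T.elem i) (χ' l)) →
        (∀ l i, ∀ m ≤ p + 1,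
          FEM.PartialsBounded m (T.elem i) (χ l) (CPoU * (δ l)⁻¹ ^ m) ∧
          FEM.PartialsBounded m (T.elem i) (χ' l) (CPoU * (δ l)⁻¹ ^ m)) →
        (∀ l, 0 < δ l ∧ T.localWidth (Ωl l) ≤ δ l) →
      ∀ (l : Fin N) (k : ℝ), k₀ ≤ k →
        ∀ v ∈ T.feSpace p (closure Ω) V ⊔ Vlh l,
          FEM.MemH1 (Ωl l) (T.interpError p (χ l) v) ∧
          FEM.MemH1 (Ωl l) (T.interpError p (χ' l) v) ∧
          max (FEM.h1kNorm k (Ωl l) (T.interpError p (χ l) v))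
              (FEM.h1kNorm k (Ωl l) (T.interpError p (χ' l) v)) ≤
            Csuper * (T.localWidth (Ωl l) / δ l
                + (T.localWidth (Ωl l) / δ l) ^ p * (1 / (k * δ l))) *
              FEM.h1kNorm k (Ωl l) v := by
  obtain ⟨n, rfl⟩ : ∃ n, p = n + 1 := ⟨p - 1, by omega⟩
  obtain ⟨D₁, hD₁, h₁⟩ := FEM.Mesh.exists_superapprox hd n (max 1 (max d (2 * |κ|))) CPoU hL hk₀
  obtain ⟨D₂, hD₂, h₂⟩ := FEM.Mesh.exists_superapprox hd n
    (max 1 ((d : ℝ) ^ (n + 2) * |Ccurved|)) CPoU hL hk₀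
  -- The constant is fixed before the mesh and must serve both alternatives; the `1` makes it
  -- positive.
  refine ⟨D₁ + D₂ + 1, by positivity, ?_⟩
  intro Ω T _ hT V N Ωl Vlh hV hΩl hVlh χ χ' δ hact hχ hχb hδ l k hk v hv
  have hw := T.localWidth_nonneg (Ωl l)
  have hδ0 := (hδ l).1
  have hk0 : 0 < k := hk₀.trans_le hk
  have hn : 0 ≤ FEM.h1kNorm k (Ωl l) v := Real.sqrt_nonneg _
  have key : ∀ ψ : FEM.E d → ℝ, (∀ i, (∃ x ∈ T.elem i, ψ x ≠ 0) → T.elem i ⊆ closure (Ωl l)) →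
      (∀ i, FEM.MemCLip (n + 1) (T.elem i) ψ) →
      (∀ i, ∀ m ≤ n + 2, FEM.PartialsBounded m (T.elem i) ψ (CPoU * (δ l)⁻¹ ^ m)) →
      FEM.MemH1 (Ωl l) (T.interpError (n + 1) ψ v) ∧
      FEM.h1kNorm k (Ωl l) (T.interpError (n + 1) ψ v) ≤
        (D₁ + D₂ + 1) * (T.localWidth (Ωl l) / δ l
          + (T.localWidth (Ωl l) / δ l) ^ (n + 1) * (1 / (k * δ l))) *
        FEM.h1kNorm k (Ωl l) v := by
    intro ψ hψ1 hψ2 hψ3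
    rcases hT with hT | ⟨hdiam, hT⟩
    · obtain ⟨h3, h4⟩ := h₁ (T := T) (b := fun _ => 0)
        (fun i => T.regularElement_of_shapeRegularSimplicial hd n hT i)
        (fun i => div_nonneg Metric.diam_nonneg hL.le) (fun _ => zero_le_one) hV (hΩl l).1
        (hΩl l).2 (hVlh l) hψ1 hψ2 hψ3 hδ0 (hδ l).2 hk v hv
      refine ⟨h3, h4.trans ?_⟩
      gcongr
      linarith
    · obtain ⟨h3, h4⟩ := h₂ (T := T) (b := fun i => T.diam i / L)
        (fun i => T.regularElement_of_curvedRegular hd hL hT i) (fun _ => le_rfl)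
        -- Here `diam Ω ≤ L` enters: it gives `h / L ≤ 1`.
        (fun i => (div_le_one hL).2 ((T.diam_le_diam i).trans hdiam)) hV (hΩl l).1
        (hΩl l).2 (hVlh l) hψ1 hψ2 hψ3 hδ0 (hδ l).2 hk v hv
      refine ⟨h3, h4.trans ?_⟩
      gcongr
      linarith
  obtain ⟨h3, h4⟩ := key (χ l) (fun i ⟨x, hx, h⟩ => hact l i ⟨x, hx, Or.inl h⟩)
    (fun i => (hχ l i).1) fun i m hm => (hχb l i m hm).1
  obtain ⟨h5, h6⟩ := key (χ' l) (fun i ⟨x, hx, h⟩ => hact l i ⟨x, hx, Or.inr h⟩)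
    (fun i => (hχ l i).2) fun i m hm => (hχb l i m hm).2
  exact ⟨h3, h5, max_le h4 h6⟩
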